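/- Setting. Let $\beta>0$ and let $G=(V,E)$ be a graph with couplings $J_e>0$ $(e\in E)$. Spins are points $\sigma=\mathrm e^{i\theta}$ of the unit circle, and $\sigma_x\cdot\sigma_y=\cos(\theta_x-\theta_y)$. The metric graph $\mathcal M(G)$ is obtained by making each edge a segment of length $1$. Fix an orientation of every edge (the choice is irrelevant). If $G$ is finite, the Villain model on $G$ (free boundary conditions) is the probability measure on $\theta\in[-\pi,\pi)^V$ with density proportional to $$\prod_{(u,v)\in E}\ \sum_{n\in\mathbb Z}\exp\Big(-\tfrac{\beta J_{uv}}2(\theta_v-\theta_u+2\pi n)^2\Big),$$ and $\langle\cdot\rangle^{\mathrm{Vill},G}_{\beta,J}$ is its expectation. The Villain model on $\mathcal M(G)$ extends it to a random spin function on $\mathcal M(G)$: given the angles at the vertices, choose independently for each edge $(u,v)$ an integer $n_{uv}$ with probability proportional to $\exp(-\frac{\beta J_{uv}}2(\theta_v-\theta_u+2\pi n_{uv})^2)$ and a standard Brownian bridge $b_{uv}$ on $[0,1]$, and put $$\theta(t)=\theta_u+t(\theta_v-\theta_u+2\pi n_{uv})+(\beta J_{uv})^{-1/2}b_{uv}(t)$$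 at the point of the edge with coordinate $t\in[0,1]$ (so that, given the spins at the vertices, the edges carry independent Brownian bridges on the circle). For $N\ge1$ the refined $XY$ model is obtained by inserting $N-1$ new sites in each edge $(u,v)$, giving sites $x_0=u,x_1,\dots,x_N=v$ at coordinates $j/N$, and taking for the angles at all the sites the probability density (with respect to Lebesgue measure on angles in $[-\pi,\pi)$) proportional to $$\prod_{(u,v)\in E}\exp\Big(-\tfrac{\beta J_{uv}N}2\sum_{j=1}^N\big|\mathrm e^{i\theta_{x_j}}-\mathrm e^{i\theta_{x_{j-1}}}\big|^2\Big).$$ Its spins are extended to $\mathcal M(G)$ by linear interpolation of the angle, along the shorter arc, between neighboring sites. Let $\langle\cdot\rangle^{XY,\mathcal M(G)}_{\beta,N}$ be the resulting expectation. Theorem. (1) For every finite graph $G$, $$\lim_{N\to\infty}\langle\sigma_x\cdot\sigma_y\rangle^{XY,\mathcal M(G)}_{\beta,N}=\langle\sigma_x\cdot\sigma_y\rangle^{\mathrm{Vill},\mathcal M(G)}_{\beta},$$ uniformly in $x,y\in\mathcal M(G)$. (2) For every finite graph $G$, if $0<J_e\le J'_e$ for all edges $e$, then $\langle\sigma_x\cdot\sigma_y\rangle^{\mathrm{Vill},G}_{\beta,J}\le\langle\sigma_x\cdot\sigma_y\rangle^{\mathrm{Vill},G}_{\beta,J'}$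 for all vertices $x,y$. (3) Let $G$ be any graph, possibly infinite, with couplings $J_e>0$, and for finite $\Lambda\subset V$ let $\langle\cdot\rangle^{\mathrm{Vill},\Lambda}_{\beta,J}$ be the Villain model on the subgraph of $G$ induced on $\Lambda$. Then for all vertices $x,y$, $\langle\sigma_x\cdot\sigma_y\rangle^{\mathrm{Vill},\Lambda}_{\beta,J}\le\langle\sigma_x\cdot\sigma_y\rangle^{\mathrm{Vill},\Lambda'}_{\beta,J}$ whenever $x,y\in\Lambda\subset\Lambda'$, and the limit of $\langle\sigma_x\cdot\sigma_y\rangle^{\mathrm{Vill},\Lambda}_{\beta,J}$ as $\Lambda\uparrow V$, along the finite subsets of $V$ directed by inclusion, exists. -/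

import Mathlib

open Real Filter Topology MeasureTheory ProbabilityTheory

universe u

namespace MetricVillain

noncomputable section

/-! ### The metric graph -/

/-- The initial vertex of an edge, for an arbitrarily selected orientation of the edges. -/
def src {V : Type u} {G : SimpleGraph V} (e : G.edgeSet) : V := (Quot.out (e : Sym2 V)).1

/-- The final vertex of an edge, for the same orientation of the edges. -/
def tgt {V : Type u} {G : SimpleGraph V} (e : G.edgeSet) : V := (Quot.out (e : Sym2 V)).2

/-- The gluing of the unit-length segments (one per edge) to the vertices of the graph. -/
inductive Glue {V : Type u} (G : SimpleGraph V) :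
    V ⊕ (G.edgeSet × unitInterval) → V ⊕ (G.edgeSet × unitInterval) → Prop
  | atSrc (e : G.edgeSet) : Glue G (Sum.inr (e, 0)) (Sum.inl (src e))
  | atTgt (e : G.edgeSet) : Glue G (Sum.inr (e, 1)) (Sum.inl (tgt e))

/-- The metric graph of `G`: every edge becomes a segment of length one whose ends are the
vertices joined by the edge. -/
def MetricGraph {V : Type u} (G : SimpleGraph V) : Type u := Quot (Glue G)

/-! ### Spins and Gibbs averages -/

/-- The spin with angle `θ`, as a point of the unit circle in `ℂ`. The dot product of two spins is
their real inner product, so that `σ_x · σ_y = cos (θ_x - θ_y)`. -/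
def spin (θ : ℝ) : ℂ := Complex.exp (θ * Complex.I)

/-- The angle configurations on the sites `ι`. -/
def angleBox (ι : Type u) : Set (ι → ℝ) := Set.univ.pi fun _ => Set.Ico (-π) π

/-- The average of `f` for the normalized density `w` on angle configurations. -/
def gibbsMean {ι : Type u} [Fintype ι] (w f : (ι → ℝ) → ℝ) : ℝ :=
  (∫ θ in angleBox ι, f θ * w θ) / ∫ θ in angleBox ι, w θ

/-! ### The Villain model on the vertices -/

open Classical in
/-- The Villain Gibbs factor with free boundary conditions. -/
def villainWeight {V : Type u} [Fintype V] (G : SimpleGraph V) (J : Sym2 V → ℝ) (β : ℝ)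
    (θ : V → ℝ) : ℝ :=
  ∏ e : G.edgeSet, ∑' n : ℤ,
    Real.exp (-(β * J e / 2) * (θ (tgt e) - θ (src e) + 2 * π * n) ^ 2)

/-- The two-point function `⟨σ_x · σ_y⟩` of the Villain model on a finite graph. -/
def villainCorr {V : Type u} [Fintype V] (G : SimpleGraph V) (J : Sym2 V → ℝ) (β : ℝ)
    (x y : V) : ℝ :=
  gibbsMean (villainWeight G J β) fun θ => inner ℝ (spin (θ x)) (spin (θ y))

open Classical in
/-- The two-point function of the Villain model in the finite volume `Λ` of a possibly infinite
graph: the Villain model on the graph induced on `Λ` (free boundary conditions). It is set to `0`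
if `x` or `y` is outside of `Λ`. -/
def villainVolumeCorr {V : Type u} (G : SimpleGraph V) (J : Sym2 V → ℝ) (β : ℝ)
    (Λ : Finset V) (x y : V) : ℝ :=
  if h : x ∈ Λ ∧ y ∈ Λ then
    villainCorr (V := {v : V // v ∈ Λ}) (G.comap Subtype.val) (fun e => J (e.map Subtype.val)) β
      ⟨x, h.1⟩ ⟨y, h.2⟩
  else 0

/-! ### The refined XY model, extended to the metric graph -/

/-- The sites after `N - 1` new sites have been inserted in every edge. -/
abbrev RefinedSite {V : Type u} (G : SimpleGraph V) (N : ℕ) : Type u :=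
  V ⊕ (G.edgeSet × Fin (N - 1))

/-- The `j`-th site `x_j` along the edge `e`, for `j = 0, …, N`; here `x_0` and `x_N` are the
vertices at the ends of the edge. -/
def site {V : Type u} {G : SimpleGraph V} (N : ℕ) (e : G.edgeSet) (j : ℕ) : RefinedSite G N :=
  if j = 0 then Sum.inl (src e)
  else if h : j - 1 < N - 1 then Sum.inr (e, ⟨j - 1, h⟩)
  else Sum.inl (tgt e)

open Classical in
/-- The Gibbs factor of the refined XY model, with all couplings increased `N` fold. -/
def xyWeight {V : Type u} [Fintype V] (G : SimpleGraph V) (J : Sym2 V → ℝ) (β : ℝ) (N : ℕ)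
    (θ : RefinedSite G N → ℝ) : ℝ :=
  ∏ e : G.edgeSet, Real.exp (-(β * J e * N / 2) *
    ∑ j ∈ Finset.range N, ‖spin (θ (site N e (j + 1))) - spin (θ (site N e j))‖ ^ 2)

/-- The refined XY spin at the point with coordinate `t` of the edge `e`: between neighboring sites
the angle is interpolated linearly, along the shorter arc. -/
def xyEdgeSpin {V : Type u} {G : SimpleGraph V} (N : ℕ) (θ : RefinedSite G N → ℝ)
    (e : G.edgeSet) (t : ℝ) : ℂ :=
  spin (θ (site N e ⌊N * t⌋₊)) *
    spin ((N * t - ⌊N * t⌋₊) *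
      Complex.arg (spin (θ (site N e (⌊N * t⌋₊ + 1))) / spin (θ (site N e ⌊N * t⌋₊))))

/-- The refined XY spin as a function on the metric graph. -/
def xySpin {V : Type u} {G : SimpleGraph V} (N : ℕ) [NeZero N] (θ : RefinedSite G N → ℝ) :
    MetricGraph G → ℂ :=
  Quot.lift (Sum.elim (fun v => spin (θ (Sum.inl v))) fun p => xyEdgeSpin N θ p.1 p.2) (by
    rintro _ _ (e | e)
    · simp [xyEdgeSpin, site, spin]
    · have hN : N ≠ 0 := NeZero.ne N
      simp [xyEdgeSpin, site, spin, hN])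

open Classical in
/-- The two-point function of the extended XY model on the metric graph. -/
def xyCorr {V : Type u} [Fintype V] (G : SimpleGraph V) (J : Sym2 V → ℝ) (β : ℝ) (N : ℕ)
    [NeZero N] (x y : MetricGraph G) : ℝ :=
  gibbsMean (xyWeight G J β N) fun θ => inner ℝ (xySpin N θ x) (xySpin N θ y)

/-! ### The Villain model on the metric graph -/

/-- The Schauder functions: the integrals from `0` to `t` of the (`L²`-normalized) Haar
functions. -/
def schauder (n k : ℕ) (t : ℝ) : ℝ :=
  (√2 ^ n)⁻¹ * max 0 (1 / 2 - |2 ^ n * t - k - 1 / 2|)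

/-- Lévy's construction of the standard Brownian bridge on `[0, 1]`: when the `ξ (n, k)` are
independent standard normal variables this is a centered Gaussian process, almost surely
continuous in `t`, with covariance `min s t - s * t`. -/
def bridge (ξ : ℕ × ℕ → ℝ) (t : ℝ) : ℝ :=
  ∑' n : ℕ, ∑ k ∈ Finset.range (2 ^ n), ξ (n, k) * schauder n k t

lemma bridge_zero (ξ : ℕ × ℕ → ℝ) : bridge ξ 0 = 0 := by
  have h : ∀ n k : ℕ, schauder n k 0 = 0 := by
    intro n k
    have hk : (0 : ℝ) ≤ k := Nat.cast_nonneg k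
    have : (1 : ℝ) / 2 - |(2 : ℝ) ^ n * 0 - k - 1 / 2| ≤ 0 := by
      rw [abs_of_nonpos] <;> linarith
    rw [schauder, max_eq_left this, mul_zero]
  simp [bridge, h]

lemma bridge_one (ξ : ℕ × ℕ → ℝ) : bridge ξ 1 = 0 := by
  have h : ∀ n k : ℕ, k < 2 ^ n → schauder n k 1 = 0 := by
    intro n k hlt
    have hk : (k : ℝ) + 1 ≤ 2 ^ n := by exact_mod_cast hlt
    have : (1 : ℝ) / 2 - |(2 : ℝ) ^ n * 1 - k - 1 / 2| ≤ 0 := by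
      rw [abs_of_nonneg] <;> linarith
    rw [schauder, max_eq_left this, mul_zero]
  have h' : ∀ n : ℕ, ∑ k ∈ Finset.range (2 ^ n), ξ (n, k) * schauder n k 1 = 0 := fun n =>
    Finset.sum_eq_zero fun k hk => by rw [h n k (Finset.mem_range.1 hk), mul_zero]
  simp [bridge, h']

/-- The sample space of the Villain model on the metric graph: the angles at the vertices, the
winding numbers along the edges, and the normal variables that drive the Brownian bridges. -/
abbrev Sample {V : Type u} (G : SimpleGraph V) : Type u :=
  ((V → ℝ) × (G.edgeSet → ℤ)) × (G.edgeSet × ℕ × ℕ → ℝ)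

open Classical in
/-- The angles and winding numbers `(θ, n)` have a density proportional to
`∏ exp (-(β J / 2) (θ_v - θ_u + 2 π n) ^ 2)`, and are independent of the bridges. -/
def villainMeasure {V : Type u} [Fintype V] (G : SimpleGraph V) (J : Sym2 V → ℝ) (β : ℝ) :
    Measure (Sample G) :=
  (((volume.restrict (angleBox V)).prod (Measure.count : Measure (G.edgeSet → ℤ))).withDensity
    fun p => ENNReal.ofReal (∏ e : G.edgeSet,
      Real.exp (-(β * J e / 2) * (p.1 (tgt e) - p.1 (src e) + 2 * π * p.2 e) ^ 2))).prod
    (Measure.infinitePi fun _ : G.edgeSet × ℕ × ℕ => gaussianReal 0 1)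

/-- The normalized measure. -/
def villainLaw {V : Type u} [Fintype V] (G : SimpleGraph V) (J : Sym2 V → ℝ) (β : ℝ) :
    Measure (Sample G) :=
  (villainMeasure G J β Set.univ)⁻¹ • villainMeasure G J β

/-- The Villain spin as a random function on the metric graph. Along the edge `e = (u, v)` the
angle is a Brownian path of variance `1 / (β J_e)` per unit length, conditioned to run from
`θ_u` to `θ_v + 2 π n_e`. Given the spins at the vertices these are independent Brownian bridges
on the circle. -/
def villainSpin {V : Type u} {G : SimpleGraph V} (J : Sym2 V → ℝ) (β : ℝ) (ω : Sample G) :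
    MetricGraph G → ℂ :=
  Quot.lift (Sum.elim (fun v => spin (ω.1.1 v)) fun p =>
    spin (ω.1.1 (src p.1) + p.2 * (ω.1.1 (tgt p.1) - ω.1.1 (src p.1) + 2 * π * ω.1.2 p.1) +
      bridge (fun i => ω.2 (p.1, i)) p.2 / √(β * J p.1))) (by
    rintro _ _ (e | e)
    · simp [bridge_zero]
    · have h : (ω.1.1 (tgt e) + 2 * π * ω.1.2 e : ℝ) * Complex.I
          = ω.1.1 (tgt e) * Complex.I + ω.1.2 e * (2 * π * Complex.I) := by
        push_cast; ring
      simp only [Sum.elim_inr, Sum.elim_inl, Set.Icc.coe_one, bridge_one, zero_div, one_mul,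
        add_zero, spin]
      rw [← Complex.exp_periodic.int_mul (ω.1.2 e) (ω.1.1 (tgt e) * Complex.I), ← h]
      congr 3
      ring)

/-- The two-point function of the Villain model on the metric graph. -/
def villainMetricCorr {V : Type u} [Fintype V] (G : SimpleGraph V) (J : Sym2 V → ℝ) (β : ℝ)
    (x y : MetricGraph G) : ℝ :=
  ∫ ω, inner ℝ (villainSpin J β ω x) (villainSpin J β ω y) ∂villainLaw G J β

end

end MetricVillain

/-! The two models meet on the Fourier side. A step of the refined XY model has a weight
proportional to exp(2x cos φ) with x = βJN/2, and the Fourier coefficients of this function are the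
modified Bessel functions I_k(2x) (`hasSum_bessel`). Integrating out the inner sites of an edge is
an iterated convolution, so the edge couples its end vertices through the Fourier series with
coefficients (I_k/I_0)^N (`integral_chain`). Since 2x(1 - I_k/I_0) tends to k²/2
(`tendsto_mul_one_sub_vonMises`), these tend to exp(-k²/(2βJ)), and by Poisson summation the
limiting series is the Villain interaction up to a constant.

For two points inside edges, the product of one spin with the conjugate of the other telescopes
along the edges. Each step between the two sites then carries a character, which shifts its Fourier
coefficient by one. With positions at signed distance δ on an edge, the coefficients converge to
`edgeLimit`. On the Villain side, `fser_edgeLimit` splits the series with these coefficients into a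
sum over winding numbers with phases exp(iδ(φ + 2πn)) and a factor exp(-(|δ| - δ²)/(2βJ)). The
latter is the characteristic function of a bridge increment, computed from Lévy's series in
`integral_spin_bridge`. Hence both two-point functions are described by `limitCorr`
(`tendsto_gridCorr`, `villainMetricCorr_eq`).

An interpolated spin is compared with the spin of the preceding site: the error is controlled by the
mean square distance of neighboring spins, itself expressed by a two-point function that tends to
one. In `tendsto_refCorr` the points may move while N grows. As the edges form a compact space, this
continuous convergence is uniform convergence.

The refined XY models are plane rotator models with nonnegative couplings, so Ginibre's inequality
makes their correlations increase with the couplings. It is proved by doubling the variables and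
rotating the two copies, after which the integral is a positive semidefinite form. Its limit is
monotonicity for the Villain model (`villainMean_mono`). Vanishing couplings are admitted throughout
this argument, so that enlarging the volume amounts to raising couplings from zero; being bounded by
one, the correlations then converge as the volume grows. -/

namespace MetricVillain

noncomputable section

/-! ### Modified Bessel functions -/

/-- The terms of the power series of the modified Bessel function at `2 * x`. -/
def besselTerm (k : ℕ) (x : ℝ) (m : ℕ) : ℝ :=
  x ^ (2 * m + k) / (m.factorial * (m + k).factorial)

/-- The modified Bessel function of order `k` at `2 * x`. -/
def bessel (k : ℕ) (x : ℝ) : ℝ := ∑' m, besselTerm k x m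

lemma besselTerm_nonneg {x : ℝ} (hx : 0 ≤ x) (k m : ℕ) : 0 ≤ besselTerm k x m := by
  unfold besselTerm; positivity

lemma summable_besselTerm (k : ℕ) (x : ℝ) : Summable (besselTerm k x) := by
  have h := (Real.summable_pow_div_factorial (x ^ 2)).mul_left (|x| ^ k)
  refine Summable.of_norm_bounded h.norm fun m => ?_
  rw [besselTerm, norm_div, norm_mul, norm_mul, norm_div, norm_pow, norm_pow, norm_pow, norm_pow,
    RCLike.norm_natCast, RCLike.norm_natCast, Real.norm_eq_abs, Real.norm_eq_abs, abs_abs]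
  have h1 : (1 : ℝ) ≤ (m + k).factorial := by exact_mod_cast Nat.succ_le_of_lt (Nat.factorial_pos _)
  have h2 : (0 : ℝ) < m.factorial := by positivity
  rw [pow_add, pow_mul, mul_comm, mul_div_assoc]
  gcongr
  nlinarith

lemma bessel_nonneg {x : ℝ} (hx : 0 ≤ x) (k : ℕ) : 0 ≤ bessel k x :=
  tsum_nonneg (besselTerm_nonneg hx k)

lemma besselTerm_zero_le {x : ℝ} (hx : 0 ≤ x) (m : ℕ) : besselTerm 0 x m ≤ bessel 0 x :=
  (summable_besselTerm 0 x).le_tsum m fun _ _ => besselTerm_nonneg hx 0 _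

lemma one_le_bessel_zero {x : ℝ} (hx : 0 ≤ x) : 1 ≤ bessel 0 x := by
  simpa [besselTerm] using besselTerm_zero_le hx 0

lemma sq_le_bessel_zero {x : ℝ} (hx : 0 ≤ x) : x ^ 2 ≤ bessel 0 x := by
  simpa [besselTerm] using besselTerm_zero_le hx 1

/-- Both products on the left are series in the terms of order k + 1, weighted by m + k + 1 and by m
respectively; the weights differ by k + 1. -/
lemma bessel_recurrence (k : ℕ) (x : ℝ) :
    x * (bessel k x - bessel (k + 2) x) = (k + 1) * bessel (k + 1) x := by
  have h1 : x * bessel k x = ∑' m : ℕ, (m + k + 1) * besselTerm (k + 1) x m := by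
    rw [bessel, ← tsum_mul_left]
    refine tsum_congr fun m => ?_
    rw [besselTerm, besselTerm, ← add_assoc m k 1, Nat.factorial_succ]
    push_cast
    have : ((m : ℝ) + k + 1) ≠ 0 := by positivity
    field_simp
    ring
  have hs1 : Summable fun m : ℕ => ((m : ℝ) + k + 1) * besselTerm (k + 1) x m := by
    refine ((summable_besselTerm k x).mul_left x).congr fun m => ?_
    rw [besselTerm, besselTerm, ← add_assoc m k 1, Nat.factorial_succ]
    push_cast
    have : ((m : ℝ) + k + 1) ≠ 0 := by positivity
    field_simp
    ring
  have hs2 := (summable_besselTerm (k + 1) x).mul_left ((k : ℝ) + 1)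
  have hs3 : Summable fun m : ℕ => (m : ℝ) * besselTerm (k + 1) x m :=
    (hs1.sub hs2).congr fun m => by ring
  have h2 : x * bessel (k + 2) x = ∑' m : ℕ, (m : ℝ) * besselTerm (k + 1) x m := by
    rw [hs3.tsum_eq_zero_add, bessel, ← tsum_mul_left]
    simp only [Nat.cast_zero, zero_mul, zero_add]
    refine tsum_congr fun m => ?_
    rw [besselTerm, besselTerm, Nat.factorial_succ, show m + 1 + (k + 1) = m + (k + 2) by ring]
    push_cast
    have : ((m : ℝ) + 1) ≠ 0 := by positivity
    field_simp
    ring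
  rw [mul_sub, h1, h2, ← hs1.tsum_sub hs3, bessel, ← tsum_mul_left]
  exact tsum_congr fun m => by ring

/-- The square of a term of order k + 1 is (m + 1)/(m + k + 1) times the product of two consecutive
terms of order k. Each term is therefore at most the mean of these two, and summation gives the
claim. -/
lemma bessel_succ_le {x : ℝ} (hx : 0 ≤ x) (k : ℕ) : bessel (k + 1) x ≤ bessel k x := by
  have hs := summable_besselTerm k x
  have hs' := (summable_nat_add_iff 1).2 hs
  have key : ∀ m, besselTerm (k + 1) x m ≤ (besselTerm k x m + besselTerm k x (m + 1)) / 2 := by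
    intro m
    have h0 := besselTerm_nonneg hx k m
    have h1 := besselTerm_nonneg hx k (m + 1)
    have hsq : besselTerm (k + 1) x m ^ 2 ≤ besselTerm k x m * besselTerm k x (m + 1) := by
      rw [besselTerm, besselTerm, besselTerm, div_mul_div_comm, div_pow, ← pow_mul, ← pow_add,
        show (2 * m + (k + 1)) * 2 = 2 * m + k + (2 * (m + 1) + k) by ring,
        show m + (k + 1) = m + k + 1 by ring, show m + 1 + k = m + k + 1 by ring,
        Nat.factorial_succ m, Nat.factorial_succ (m + k)]
      push_cast
      have a1 : (0 : ℝ) < m.factorial := by positivity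
      have a2 : (0 : ℝ) < (m + k).factorial := by positivity
      apply div_le_div_of_nonneg_left (by positivity) (by positivity)
      have : ((m : ℝ) + 1) * (m + k + 1) ≤ (m + k + 1) ^ 2 := by
        nlinarith [Nat.cast_nonneg (α := ℝ) m, Nat.cast_nonneg (α := ℝ) k]
      have a3 : (0 : ℝ) ≤ (m.factorial : ℝ) ^ 2 * (m + k).factorial ^ 2 := by positivity
      nlinarith [mul_le_mul_of_nonneg_left this a3]
    refine abs_le_of_sq_le_sq' ?_ (by linarith) |>.2
    nlinarith [sq_nonneg (besselTerm k x m - besselTerm k x (m + 1))]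
  have h1 : bessel (k + 1) x ≤ ∑' m, (besselTerm k x m + besselTerm k x (m + 1)) / 2 :=
    (summable_besselTerm (k + 1) x).tsum_le_tsum key ((hs.add hs').div_const 2)
  have h2 : ∑' m, besselTerm k x (m + 1) ≤ bessel k x := by
    rw [bessel, hs.tsum_eq_zero_add]
    linarith [besselTerm_nonneg hx k 0]
  rw [tsum_div_const, hs.tsum_add hs'] at h1
  change _ ≤ (bessel k x + _) / 2 at h1
  linarith

lemma bessel_antitone {x : ℝ} (hx : 0 ≤ x) : Antitone fun k => bessel k x :=
  antitone_nat_of_succ_le (bessel_succ_le hx)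

/-- Induction through the recurrence: a step from 2l to 2l + 2 costs 2l + 1 = (l + 1)² - l² times a
Bessel function that, by monotonicity in the order, is at least that of order 2l + 2. This is the
only source of decay in k for the domination arguments. -/
lemma bessel_even_bound {x : ℝ} (hx : 0 ≤ x) (l : ℕ) :
    (x + l ^ 2) * bessel (2 * l) x ≤ x * bessel 0 x := by
  induction l with
  | zero => simp
  | succ l ih =>
    have h := bessel_recurrence (2 * l) x
    have h1 := bessel_succ_le hx (2 * l)
    have h2 := bessel_succ_le hx (2 * l + 1)
    rw [show 2 * (l + 1) = 2 * l + 2 by ring]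
    push_cast at h ⊢
    nlinarith [sq_nonneg (l : ℝ), mul_le_mul_of_nonneg_left (h2.trans h1) (sq_nonneg (l : ℝ)),
      mul_le_mul_of_nonneg_left h2 (by positivity : (0 : ℝ) ≤ 2 * l + 1)]

/-- The ratio of the Bessel function of order `|k|` to that of order zero at `2 * x`. -/
def vonMises (x : ℝ) (k : ℤ) : ℝ := bessel k.natAbs x / bessel 0 x

lemma vonMises_nonneg {x : ℝ} (hx : 0 ≤ x) (k : ℤ) : 0 ≤ vonMises x k :=
  div_nonneg (bessel_nonneg hx _) (bessel_nonneg hx _)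

lemma vonMises_le_one {x : ℝ} (hx : 0 ≤ x) (k : ℤ) : vonMises x k ≤ 1 :=
  div_le_one_of_le₀ (bessel_antitone hx (Nat.zero_le _)) (bessel_nonneg hx _)

lemma vonMises_zero_right {x : ℝ} (hx : 0 ≤ x) : vonMises x 0 = 1 :=
  div_self (by have := one_le_bessel_zero hx; simp; linarith)

lemma vonMises_zero_left (k : ℤ) : vonMises 0 k = if k = 0 then 1 else 0 := by
  split_ifs with h
  · rw [h, vonMises_zero_right le_rfl]
  · have : ∀ m, besselTerm k.natAbs 0 m = 0 := fun m => by
      rw [besselTerm, zero_pow (by omega), zero_div]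
    simp [vonMises, bessel, this]

lemma vonMises_bound {x : ℝ} (hx : 0 < x) (k : ℤ) :
    vonMises x k ≤ 1 / (1 + ((k.natAbs / 2 : ℕ) : ℝ) ^ 2 / x) := by
  have h := bessel_even_bound hx.le (k.natAbs / 2)
  have h1 : bessel k.natAbs x ≤ bessel (2 * (k.natAbs / 2)) x :=
    bessel_antitone hx.le (by omega)
  have h0 := one_le_bessel_zero hx.le
  rw [vonMises, div_le_div_iff₀ (by linarith) (by positivity), one_mul, mul_add, mul_one,
    ← mul_div_assoc, ← sub_nonneg]
  have : bessel 0 x - (bessel k.natAbs x + bessel k.natAbs x * ((k.natAbs / 2 : ℕ) : ℝ) ^ 2 / x)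
      = (x * bessel 0 x - (x + ((k.natAbs / 2 : ℕ) : ℝ) ^ 2) * bessel k.natAbs x) / x := by
    field_simp
  rw [this]
  refine div_nonneg (sub_nonneg.2 (le_trans ?_ h)) hx.le
  gcongr

/-- The summable bound for high powers of `vonMises`. -/
def vonMisesBound (A : ℝ) (k : ℤ) : ℝ := 1 / (1 + A * ((k.natAbs / 2 : ℕ) : ℝ) ^ 2)

/-- Bernoulli's inequality turns m factors 1 + l²/x into at least 1 + m l²/x. Since the number of
steps of an edge grows in proportion to x, the resulting bound is summable in k and uniform in the
refinement. -/
lemma vonMises_pow_le {x A : ℝ} (hx : 0 < x) (hA : 0 ≤ A) {m : ℕ} (hm : A * x ≤ m) (k : ℤ) :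
    vonMises x k ^ m ≤ vonMisesBound A k := by
  set L : ℝ := ((k.natAbs / 2 : ℕ) : ℝ) ^ 2
  have hL : 0 ≤ L := by positivity
  have h1 : 1 + A * L ≤ (1 + L / x) ^ m := by
    refine le_trans ?_ (one_add_mul_le_pow (by have := div_nonneg hL hx.le; linarith) m)
    have : A * L = A * x * (L / x) := by field_simp
    rw [this]
    gcongr
  calc vonMises x k ^ m ≤ (1 / (1 + L / x)) ^ m :=
        pow_le_pow_left₀ (vonMises_nonneg hx.le k) (vonMises_bound hx k) m
    _ = 1 / (1 + L / x) ^ m := by rw [div_pow, one_pow]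
    _ ≤ _ := one_div_le_one_div_of_le (by positivity) h1

lemma vonMisesBound_nonneg {A : ℝ} (hA : 0 ≤ A) (k : ℤ) : 0 ≤ vonMisesBound A k := by
  unfold vonMisesBound; positivity

lemma summable_vonMisesBound {A : ℝ} (hA : 0 < A) : Summable (vonMisesBound A) := by
  -- The half-integer shift keeps the comparison series finite at k = 0. With l = ⌊|k|/2⌋, one has
  -- (k + 1/2)² ≤ 4 + 16 l² ≤ (4 + 16/A)(1 + A l²).
  have h : Summable fun k : ℤ => (4 + 16 / A) * (1 / ((k : ℝ) + 1/2) ^ 2) := by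
    refine Summable.mul_left _ ?_
    have := (Real.summable_one_div_int_add_rpow (1/2) 2).2 (by norm_num)
    refine this.congr fun k => ?_
    norm_num
  refine Summable.of_nonneg_of_le (vonMisesBound_nonneg hA.le) (fun k => ?_) h
  have hk : ((k : ℝ) + 1 / 2) ^ 2 ≤ 4 + 16 * ((k.natAbs / 2 : ℕ) : ℝ) ^ 2 := by
    have : (k.natAbs : ℝ) ≤ 2 * ((k.natAbs / 2 : ℕ) : ℝ) + 1 := by
      exact_mod_cast (by omega : k.natAbs ≤ 2 * (k.natAbs / 2) + 1)
    have h2 : |(k : ℝ)| = k.natAbs := by rw [Nat.cast_natAbs]; simp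
    have h3 := abs_add_le (k : ℝ) (1/2)
    rw [h2, abs_of_pos (by norm_num : (0:ℝ) < 1/2)] at h3
    rw [← sq_abs]
    have h4 : |(k : ℝ) + 1/2| ≤ 2 * ((k.natAbs / 2 : ℕ) : ℝ) + 3/2 := by linarith
    nlinarith [abs_nonneg ((k : ℝ) + 1/2), sq_nonneg (((k.natAbs / 2 : ℕ) : ℝ) - 1/2)]
  have hpos : 0 < ((k : ℝ) + 1 / 2) ^ 2 := by
    have : (k : ℝ) + 1 / 2 ≠ 0 := fun h => by
      have h' : (2 * k + 1 : ℝ) = 0 := by linarith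
      have : (2 * k + 1 : ℤ) = 0 := by exact_mod_cast h'
      omega
    positivity
  set L : ℝ := ((k.natAbs / 2 : ℕ) : ℝ) ^ 2
  have hL : 0 ≤ L := by positivity
  rw [vonMisesBound, mul_one_div, div_le_div_iff₀ (by positivity) hpos, one_mul]
  have h5 : (4 + 16 / A) * (1 + A * L) = 4 + 16 * L + (4 * A * L + 16 / A) := by
    field_simp; ring
  have h6 : 0 ≤ 4 * A * L + 16 / A := by positivity
  linarith

/-! ### The generating function -/

/-- Pairs of natural numbers, indexed by their difference and their minimum. -/
def diffMinEquiv : ℤ × ℕ ≃ ℕ × ℕ where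
  toFun p := (p.2 + p.1.toNat, p.2 + (-p.1).toNat)
  invFun p := ((p.1 : ℤ) - p.2, min p.1 p.2)
  left_inv p := by
    ext
    · simp
    · simp; omega
  right_inv p := by ext <;> (simp; omega)

/-- In the product of the exponential series of xz and x/z, a pair of exponents with difference k
contributes z^k, and its minimum m selects the m-th term of the Bessel series of order |k|. -/
lemma besselTerm_mul_zpow (x : ℝ) {z : ℂ} (hz : z ≠ 0) (k : ℤ) (m : ℕ) :
    ((x : ℂ) * z) ^ (m + k.toNat) / (m + k.toNat).factorial *
      ((x * z⁻¹) ^ (m + (-k).toNat) / (m + (-k).toNat).factorial) =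
      (besselTerm k.natAbs x m : ℂ) * z ^ k := by
  rw [besselTerm]
  push_cast
  rcases le_total 0 k with hk | hk
  · obtain ⟨n, rfl⟩ : ∃ n : ℕ, k = n := ⟨k.natAbs, by omega⟩
    simp only [Int.toNat_natCast, Int.natAbs_natCast, Int.toNat_neg_natCast, add_zero, zpow_natCast]
    rw [mul_pow, mul_pow, inv_pow, div_mul_div_comm, div_mul_eq_mul_div,
      mul_comm ((m + n).factorial : ℂ)]
    congr 1
    have := pow_ne_zero m hz
    field_simp
    ring
  · obtain ⟨n, rfl⟩ : ∃ n : ℕ, k = -n := ⟨k.natAbs, by omega⟩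
    simp only [Int.toNat_natCast, Int.natAbs_natCast, Int.toNat_neg_natCast, add_zero, neg_neg,
      Int.natAbs_neg, zpow_neg, zpow_natCast]
    rw [mul_pow, mul_pow, inv_pow, div_mul_div_comm, div_mul_eq_mul_div]
    congr 1
    have := pow_ne_zero m hz
    have := pow_ne_zero n hz
    field_simp
    ring

lemma hasSum_exp_mul_exp (z w : ℂ) :
    HasSum (fun p : ℕ × ℕ => z ^ p.1 / (p.1.factorial : ℂ) * (w ^ p.2 / (p.2.factorial : ℂ)))
      (Complex.exp z * Complex.exp w) := by
  have hexp : ∀ w : ℂ, HasSum (fun n : ℕ => w ^ n / (n.factorial : ℂ)) (Complex.exp w) := fun w => by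
    rw [Complex.exp_eq_exp_ℂ]; exact NormedSpace.expSeries_div_hasSum_exp w
  have hn : ∀ w : ℂ, Summable fun n : ℕ => ‖w ^ n / (n.factorial : ℂ)‖ := fun w => by
    simpa using Real.summable_pow_div_factorial ‖w‖
  exact HasSum.mul (f := fun n : ℕ => z ^ n / (n.factorial : ℂ))
    (g := fun n : ℕ => w ^ n / (n.factorial : ℂ)) (hexp z) (hexp w)
    (summable_mul_of_summable_norm (f := fun n : ℕ => z ^ n / (n.factorial : ℂ))
      (g := fun n : ℕ => w ^ n / (n.factorial : ℂ)) (hn z) (hn w))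

/-- Expand exp(xz) exp(x/z) with z = exp(iθ) and sum first over the pairs of exponents with a given
difference. -/
lemma hasSum_bessel (x θ : ℝ) :
    HasSum (fun k : ℤ => (bessel k.natAbs x : ℂ) * Complex.exp (k * θ * Complex.I))
      (Complex.exp (2 * x * Real.cos θ)) := by
  set z : ℂ := Complex.exp (θ * Complex.I)
  have hz : z ≠ 0 := Complex.exp_ne_zero _
  have hzz : (x : ℂ) * z + x * z⁻¹ = 2 * x * Real.cos θ := by
    rw [Complex.ofReal_cos, Complex.cos, ← Complex.exp_neg, ← neg_mul]
    ring
  have h1 := hasSum_exp_mul_exp (x * z) (x * z⁻¹)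
  rw [← Complex.exp_add, hzz, ← diffMinEquiv.hasSum_iff] at h1
  have h3 : HasSum (fun p : ℤ × ℕ => (besselTerm p.1.natAbs x p.2 : ℂ) * z ^ p.1)
      (Complex.exp (2 * x * Real.cos θ)) := by
    convert h1 using 1
    funext p
    exact (besselTerm_mul_zpow x hz p.1 p.2).symm
  refine HasSum.prod_fiberwise h3 fun k => ?_
  have h2 : HasSum (fun m => (besselTerm k.natAbs x m : ℂ)) (bessel k.natAbs x) :=
    Complex.hasSum_ofReal.2 (summable_besselTerm k.natAbs x).hasSum
  have hzk : Complex.exp (k * θ * Complex.I) = z ^ k := by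
    rw [← Complex.exp_int_mul, mul_assoc]
  rw [hzk]
  exact h2.mul_right (z ^ k)

/-! ### Absolutely convergent Fourier series -/

/-- The uniform probability measure on the angles in `[-π, π)`. -/
def unif : Measure ℝ := (ENNReal.ofReal (2 * π))⁻¹ • volume.restrict (Set.Ico (-π) π)

instance : IsProbabilityMeasure unif := ⟨by
  have : (0 : ℝ) < 2 * π := by positivity
  rw [unif, Measure.smul_apply, Measure.restrict_apply_univ, Real.volume_Ico, sub_neg_eq_add,
    ← two_mul, smul_eq_mul]
  exact ENNReal.inv_mul_cancel (by simpa using this) ENNReal.ofReal_ne_top⟩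

lemma integral_unif {F : Type*} [NormedAddCommGroup F] [NormedSpace ℝ F] (f : ℝ → F) :
    ∫ x, f x ∂unif = (2 * π)⁻¹ • ∫ x in (-π)..π, f x := by
  rw [unif, integral_smul_measure, intervalIntegral.integral_of_le (by linarith [Real.pi_pos]),
    integral_Ico_eq_integral_Ioo, integral_Ioc_eq_integral_Ioo, ENNReal.toReal_inv,
    ENNReal.toReal_ofReal (by positivity)]

/-- The character `e^{ikφ}` of the circle. -/
def echar (k : ℤ) (φ : ℝ) : ℂ := Complex.exp (k * φ * Complex.I)

lemma norm_echar (k : ℤ) (φ : ℝ) : ‖echar k φ‖ = 1 := by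
  rw [echar]
  exact_mod_cast Complex.norm_exp_ofReal_mul_I (k * φ)

@[fun_prop]
lemma continuous_echar (k : ℤ) : Continuous (echar k) := by
  unfold echar; fun_prop

lemma echar_zero_left (φ : ℝ) : echar 0 φ = 1 := by simp [echar]

lemma echar_add_left (k l : ℤ) (φ : ℝ) : echar (k + l) φ = echar k φ * echar l φ := by
  rw [echar, echar, echar, ← Complex.exp_add]; push_cast; ring_nf

lemma echar_add (k : ℤ) (φ ψ : ℝ) : echar k (φ + ψ) = echar k φ * echar k ψ := by
  rw [echar, echar, echar, ← Complex.exp_add]; push_cast; ring_nf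

lemma echar_sub (k : ℤ) (φ ψ : ℝ) : echar k (φ - ψ) = echar k φ * echar (-k) ψ := by
  rw [echar, echar, echar, ← Complex.exp_add]; push_cast; ring_nf

lemma conj_echar (k : ℤ) (φ : ℝ) : (starRingEnd ℂ) (echar k φ) = echar (-k) φ := by
  rw [echar, echar, ← Complex.exp_conj]
  simp

lemma integral_echar (k : ℤ) : ∫ φ, echar k φ ∂unif = if k = 0 then 1 else 0 := by
  split_ifs with h
  · simp [h, echar_zero_left]
  · rw [integral_unif]
    have hk : (k : ℂ) * Complex.I ≠ 0 := by simp [h]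
    have h1 : ∀ φ : ℝ, echar k φ = Complex.exp (k * Complex.I * φ) := fun φ => by
      rw [echar]; ring_nf
    simp only [h1]
    rw [integral_exp_mul_complex hk]
    have h2 : Complex.exp (k * Complex.I * (π : ℝ)) = Complex.exp (k * Complex.I * (-π : ℝ)) := by
      rw [Complex.exp_eq_exp_iff_exists_int]
      exact ⟨k, by push_cast; ring⟩
    rw [h2]
    simp

/-- The Fourier series with coefficients `a`. -/
def fser (a : ℤ → ℝ) (φ : ℝ) : ℂ := ∑' k, (a k : ℂ) * echar k φ

lemma norm_coeff_mul_echar (a : ℤ → ℝ) (k : ℤ) (φ : ℝ) : ‖(a k : ℂ) * echar k φ‖ = |a k| := by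
  rw [norm_mul, norm_echar, mul_one, Complex.norm_real, Real.norm_eq_abs]

lemma summable_fser {a : ℤ → ℝ} (ha : Summable a) (φ : ℝ) :
    Summable fun k => (a k : ℂ) * echar k φ :=
  Summable.of_norm (by simpa only [norm_coeff_mul_echar] using ha.abs)

lemma hasSum_fser {a : ℤ → ℝ} (ha : Summable a) (φ : ℝ) :
    HasSum (fun k => (a k : ℂ) * echar k φ) (fser a φ) :=
  (summable_fser ha φ).hasSum

lemma norm_fser_le {a : ℤ → ℝ} (ha : Summable a) (φ : ℝ) : ‖fser a φ‖ ≤ ∑' k, |a k| :=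
  tsum_of_norm_bounded ha.abs.hasSum fun k => (norm_coeff_mul_echar a k φ).le

lemma continuous_fser {a : ℤ → ℝ} (ha : Summable a) : Continuous (fser a) :=
  continuous_tsum (fun k => by fun_prop) ha.abs fun k φ => (norm_coeff_mul_echar a k φ).le

lemma integrable_of_continuous_bounded {X : Type*} [TopologicalSpace X] [MeasurableSpace X]
    [OpensMeasurableSpace X] {F : Type*} [NormedAddCommGroup F]
    [SecondCountableTopologyEither X F] {μ : Measure X}
    [IsFiniteMeasure μ] {f : X → F} (hf : Continuous f) (C : ℝ) (hC : ∀ x, ‖f x‖ ≤ C) :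
    Integrable f μ :=
  Integrable.of_bound hf.aestronglyMeasurable C (Eventually.of_forall hC)

lemma integral_fser_mul {a : ℤ → ℝ} (ha : Summable a) (α : ℝ) {g : ℝ → ℂ} (hg : Continuous g)
    {C : ℝ} (hC : ∀ φ, ‖g φ‖ ≤ C) :
    HasSum (fun k => (a k : ℂ) * (echar (-k) α * ∫ φ, echar k φ * g φ ∂unif))
      (∫ φ, fser a (φ - α) * g φ ∂unif) := by
  have hint : ∀ k, Integrable (fun φ => (a k : ℂ) * echar k (φ - α) * g φ) unif := fun k =>
    integrable_of_continuous_bounded (by fun_prop) (|a k| * C) fun φ => by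
      rw [norm_mul, norm_coeff_mul_echar]
      exact mul_le_mul_of_nonneg_left (hC φ) (abs_nonneg _)
  have hsum : Summable fun k => ∫ φ, ‖(a k : ℂ) * echar k (φ - α) * g φ‖ ∂unif := by
    refine Summable.of_nonneg_of_le (fun k => integral_nonneg fun φ => norm_nonneg _) (fun k => ?_)
      (ha.abs.mul_right C)
    calc ∫ φ, ‖(a k : ℂ) * echar k (φ - α) * g φ‖ ∂unif ≤ ∫ _φ, |a k| * C ∂unif := by
          refine integral_mono (hint k).norm (integrable_const _) fun φ => ?_
          simp only
          rw [norm_mul, norm_coeff_mul_echar]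
          exact mul_le_mul_of_nonneg_left (hC φ) (abs_nonneg _)
      _ = |a k| * C := by simp
  have h := hasSum_integral_of_summable_integral_norm hint hsum
  have h1 : ∀ φ, ∑' k, (a k : ℂ) * echar k (φ - α) * g φ = fser a (φ - α) * g φ := fun φ => by
    rw [tsum_mul_right, fser]
  have h2 : ∀ k, ∫ φ, (a k : ℂ) * echar k (φ - α) * g φ ∂unif =
      (a k : ℂ) * (echar (-k) α * ∫ φ, echar k φ * g φ ∂unif) := fun k => by
    rw [← integral_const_mul, ← integral_const_mul]
    refine integral_congr_ae (Eventually.of_forall fun φ => ?_)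
    simp only [echar_sub]
    ring
  simp only [h1, h2] at h
  exact h

lemma integral_fser_mul_echar {a : ℤ → ℝ} (ha : Summable a) (k : ℤ) :
    ∫ φ, fser a φ * echar (-k) φ ∂unif = a k := by
  have h := integral_fser_mul ha 0 (continuous_echar (-k)) fun φ => (norm_echar _ φ).le
  have h1 : ∀ l : ℤ, (a l : ℂ) * (echar (-l) 0 * ∫ φ, echar l φ * echar (-k) φ ∂unif) =
      if l = k then (a k : ℂ) else 0 := fun l => by
    simp only [← echar_add_left, integral_echar]
    have : echar (-l) 0 = 1 := by simp [echar]
    rw [this, one_mul]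
    by_cases hl : l = k
    · simp [hl]
    · simp [hl, show l + -k ≠ 0 by omega]
  simp only [h1, sub_zero] at h
  exact h.unique (hasSum_ite_eq k _)

lemma integral_echar_mul_fser {a : ℤ → ℝ} (ha : Summable a) (k : ℤ) (β : ℝ) :
    ∫ φ, echar k φ * fser a (β - φ) ∂unif = a k * echar k β := by
  have h := integral_fser_mul (a := fun k => a (-k)) ((Equiv.neg ℤ).summable_iff.2 ha) β
    (continuous_echar k) fun φ => (norm_echar _ φ).le
  have h2 : ∀ φ, fser (fun k => a (-k)) (φ - β) = fser a (β - φ) := fun φ => by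
    rw [fser, fser, ← (Equiv.neg ℤ).tsum_eq]
    refine tsum_congr fun l => ?_
    simp only [Equiv.neg_apply, neg_neg]
    congr 1
    rw [echar, echar]
    push_cast
    ring_nf
  have h1 : ∀ l : ℤ, ((a (-l) : ℝ) : ℂ) * (echar (-l) β * ∫ φ, echar l φ * echar k φ ∂unif) =
      if l = -k then (a k : ℂ) * echar k β else 0 := fun l => by
    simp only [← echar_add_left, integral_echar]
    by_cases hl : l = -k
    · simp [hl]
    · simp [hl, show l + k ≠ 0 by omega]
  simp only [h1, h2] at h
  rw [← h.unique (hasSum_ite_eq (-k) _)]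
  simp only [mul_comm]

lemma Summable.mul_of_bounded {a b : ℤ → ℝ} (ha : Summable a) {C : ℝ} (hb : ∀ k, |b k| ≤ C) :
    Summable fun k => a k * b k := by
  refine Summable.of_norm_bounded (ha.abs.mul_right C) fun k => ?_
  rw [norm_mul, Real.norm_eq_abs, Real.norm_eq_abs]
  exact mul_le_mul_of_nonneg_left (hb k) (abs_nonneg _)

lemma abs_le_tsum_abs {b : ℤ → ℝ} (hb : Summable b) (k : ℤ) : |b k| ≤ ∑' k, |b k| :=
  hb.abs.le_tsum k fun _ _ => abs_nonneg _

lemma Summable.mul_summable {a b : ℤ → ℝ} (ha : Summable a) (hb : Summable b) :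
    Summable fun k => a k * b k :=
  Summable.mul_of_bounded ha (abs_le_tsum_abs hb)

/-- Convolution multiplies Fourier coefficients. -/
lemma integral_fser_mul_fser {a b : ℤ → ℝ} (ha : Summable a) (hb : Summable b) (α β : ℝ) :
    ∫ φ, fser a (φ - α) * fser b (β - φ) ∂unif = fser (fun k => a k * b k) (β - α) := by
  have h := integral_fser_mul ha α (g := fun φ => fser b (β - φ))
    ((continuous_fser hb).comp (by fun_prop)) fun φ => norm_fser_le hb _
  refine h.unique ?_
  convert hasSum_fser (Summable.mul_summable ha hb) (β - α) using 1
  funext k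
  rw [integral_echar_mul_fser hb, echar_sub]
  push_cast
  ring

/-! ### Asymptotics of the Bessel functions -/

lemma summable_bessel {x : ℝ} : Summable fun k : ℤ => bessel k.natAbs x := by
  have h := (hasSum_bessel x 0).summable
  simp only [Complex.ofReal_zero, mul_zero, zero_mul, Complex.exp_zero, mul_one] at h
  exact Complex.summable_ofReal.1 h

lemma summable_vonMises (x : ℝ) : Summable (vonMises x) :=
  summable_bessel.div_const _

lemma fser_bessel (x θ : ℝ) :
    fser (fun k => bessel k.natAbs x) θ = (Real.exp (2 * x * Real.cos θ) : ℝ) := by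
  rw [fser]
  simp only [echar]
  rw [(hasSum_bessel x θ).tsum_eq]
  push_cast
  rfl

lemma fser_vonMises (x θ : ℝ) :
    fser (vonMises x) θ = ((bessel 0 x)⁻¹ * Real.exp (2 * x * Real.cos θ) : ℝ) := by
  have : vonMises x = fun k => (bessel 0 x)⁻¹ * bessel k.natAbs x := by
    funext k; rw [vonMises, div_eq_inv_mul]
  rw [Complex.ofReal_mul, ← fser_bessel, fser, fser, ← tsum_mul_left, this]
  exact tsum_congr fun k => by push_cast; ring

lemma integral_cos_mul_exp (x : ℝ) (k : ℤ) :
    ∫ φ, Real.cos (k * φ) * Real.exp (2 * x * Real.cos φ) ∂unif = bessel k.natAbs x := by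
  have h := congrArg Complex.re (integral_fser_mul_echar (summable_bessel (x := x)) k)
  simp only [fser_bessel, Complex.ofReal_re] at h
  rw [← h]
  have hi : Integrable (fun φ => ((Real.exp (2 * x * Real.cos φ) : ℝ) : ℂ) * echar (-k) φ) unif := by
    refine integrable_of_continuous_bounded (by fun_prop) (Real.exp (2 * |x|)) fun φ => ?_
    rw [norm_mul, norm_echar, mul_one, Complex.norm_real, Real.norm_eq_abs, Real.abs_exp]
    refine Real.exp_le_exp.2 ?_
    have := abs_mul x (Real.cos φ)
    nlinarith [Real.abs_cos_le_one φ, le_abs_self (x * Real.cos φ), abs_nonneg x]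
  rw [← RCLike.re_eq_complex_re, ← integral_re hi]
  refine integral_congr_ae (Eventually.of_forall fun φ => ?_)
  simp only [RCLike.re_eq_complex_re, Complex.re_ofReal_mul]
  rw [echar, show ((-k : ℤ) : ℂ) * φ * Complex.I = ((-(k * φ) : ℝ) : ℂ) * Complex.I by
    push_cast; ring, Complex.exp_ofReal_mul_I_re, Real.cos_neg, mul_comm]

lemma tendsto_of_sub_vonMises {k : ℤ} {a : ℝ}
    (h : Tendsto (fun x => 2 * x * (1 - vonMises x k)) atTop (𝓝 a)) :
    Tendsto (fun x => vonMises x k) atTop (𝓝 1) := by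
  have h1 : Tendsto (fun x : ℝ => (2 * x)⁻¹) atTop (𝓝 0) :=
    tendsto_inv_atTop_zero.comp (tendsto_id.const_mul_atTop (by norm_num))
  have h2 := (h1.mul h).const_sub 1
  rw [zero_mul, sub_zero] at h2
  refine h2.congr' ?_
  filter_upwards [eventually_gt_atTop 0] with x hx
  field_simp
  ring

lemma vonMises_recurrence {x : ℝ} (hx : 0 ≤ x) (k : ℕ) :
    x * (vonMises x k - vonMises x (k + 2 : ℕ)) = (k + 1) * vonMises x (k + 1 : ℕ) := by
  have h := bessel_recurrence k x
  have h0 := one_le_bessel_zero hx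
  simp only [vonMises, Int.natAbs_natCast]
  field_simp
  linarith

/-- Let E be the mean for the density proportional to exp(2x cos φ), and q_k the mean of cos(kφ).
The recurrence gives 2x(1 - q_1) - q_1/2 = x E(1 - cos φ)². Where cos φ ≥ 0, the square is at most
sin⁴ φ, and E sin⁴ φ = 3q_2/(4x²). Where cos φ ≤ 0, the unnormalized weight is at most 1, while the
normalization I_0 is at least x². The difference is thus O(1/x), and the limit is that of q_1/2. -/
lemma tendsto_vonMises_one :
    Tendsto (fun x => 2 * x * (1 - vonMises x 1)) atTop (𝓝 (1 / 2)) := by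
  have key : ∀ x : ℝ, 0 < x → |2 * x * (1 - vonMises x 1) - vonMises x 1 / 2| ≤ 8 * x⁻¹ := by
    intro x hx
    have hB := one_le_bessel_zero hx.le
    have hB2 := sq_le_bessel_zero hx.le
    have hci : ∀ k : ℤ, Integrable
        (fun φ => Real.cos (k * φ) * Real.exp (2 * x * Real.cos φ)) unif := fun k => by
      refine integrable_of_continuous_bounded (by fun_prop) (Real.exp (2 * x)) fun φ => ?_
      rw [norm_mul, Real.norm_eq_abs, Real.norm_eq_abs, Real.abs_exp]
      have : Real.exp (2 * x * Real.cos φ) ≤ Real.exp (2 * x) :=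
        Real.exp_le_exp.2 (by nlinarith [Real.cos_le_one φ])
      nlinarith [Real.abs_cos_le_one (k * φ), Real.exp_pos (2 * x * Real.cos φ)]
    have hlin : ∀ a b c d : ℝ, ∫ φ, (a + b * Real.cos φ + c * Real.cos (2 * φ) +
        d * Real.cos (4 * φ)) * Real.exp (2 * x * Real.cos φ) ∂unif =
        bessel 0 x * (a + b * vonMises x 1 + c * vonMises x 2 + d * vonMises x 4) := by
      intro a b c d
      have e : ∀ k : ℤ, bessel k.natAbs x = bessel 0 x * vonMises x k := fun k => by
        rw [vonMises]; field_simp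
      have e0 := integral_cos_mul_exp x 0
      have e1 := integral_cos_mul_exp x 1
      have e2 := integral_cos_mul_exp x 2
      have e4 := integral_cos_mul_exp x 4
      have i0 := (hci 0).const_mul a
      have i1 := (hci 1).const_mul b
      have i2 := (hci 2).const_mul c
      have i4 := (hci 4).const_mul d
      have : ∀ φ, (a + b * Real.cos φ + c * Real.cos (2 * φ) +
          d * Real.cos (4 * φ)) * Real.exp (2 * x * Real.cos φ) =
          a * (Real.cos ((0 : ℤ) * φ) * Real.exp (2 * x * Real.cos φ)) +
          b * (Real.cos ((1 : ℤ) * φ) * Real.exp (2 * x * Real.cos φ)) +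
          c * (Real.cos ((2 : ℤ) * φ) * Real.exp (2 * x * Real.cos φ)) +
          d * (Real.cos ((4 : ℤ) * φ) * Real.exp (2 * x * Real.cos φ)) := fun φ => by
        push_cast; simp; ring
      simp only [this]
      rw [integral_add (Integrable.fun_add (i0.fun_add i1) i2) i4,
        integral_add (i0.fun_add i1) i2, integral_add i0 i1,
        integral_const_mul, integral_const_mul, integral_const_mul, integral_const_mul,
        e0, e1, e2, e4, e, e, e, e, vonMises_zero_right hx.le]
      ring
    have hci' : ∀ p : ℝ → ℝ, Continuous p → (∀ φ, |p φ| ≤ 16) → Integrable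
        (fun φ => p φ * Real.exp (2 * x * Real.cos φ)) unif := fun p hp hb => by
      refine integrable_of_continuous_bounded (by fun_prop) (16 * Real.exp (2 * x)) fun φ => ?_
      rw [norm_mul, Real.norm_eq_abs, Real.norm_eq_abs, Real.abs_exp]
      exact mul_le_mul (hb φ) (Real.exp_le_exp.2 (by nlinarith [Real.cos_le_one φ]))
        (Real.exp_pos _).le (by norm_num)
    have c4 : ∀ φ, Real.cos (4 * φ) = 2 * (2 * Real.cos φ ^ 2 - 1) ^ 2 - 1 := fun φ => by
      rw [show 4 * φ = 2 * (2 * φ) by ring, Real.cos_two_mul, Real.cos_two_mul]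
    -- The two trigonometric polynomials (1 - cos φ)² and sin⁴ φ, expanded in cosines so that their
    -- means become combinations of Bessel ratios.
    have p1 : ∀ φ, (3 / 2 : ℝ) + (-2) * Real.cos φ + 1 / 2 * Real.cos (2 * φ) +
        0 * Real.cos (4 * φ) = (1 - Real.cos φ) ^ 2 := fun φ => by
      rw [Real.cos_two_mul]; ring
    have p2 : ∀ φ, (3 / 8 : ℝ) + 0 * Real.cos φ + (-1 / 2) * Real.cos (2 * φ) +
        1 / 8 * Real.cos (4 * φ) = (1 - Real.cos φ ^ 2) ^ 2 := fun φ => by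
      rw [c4, Real.cos_two_mul]; ring
    have L1 := hlin (3 / 2) (-2) (1 / 2) 0
    have L2 := hlin (3 / 8) 0 (-1 / 2) (1 / 8)
    simp only [p1, p2] at L1 L2
    have hnn : 0 ≤ ∫ φ, (1 - Real.cos φ) ^ 2 * Real.exp (2 * x * Real.cos φ) ∂unif :=
      integral_nonneg fun φ => by positivity
    have i1 : Integrable (fun φ => (1 - Real.cos φ) ^ 2 * Real.exp (2 * x * Real.cos φ)) unif :=
      hci' _ (by fun_prop) fun φ => by
        rw [abs_of_nonneg (by positivity)]
        nlinarith [Real.cos_le_one φ, Real.neg_one_le_cos φ]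
    have i2 : Integrable (fun φ => (1 - Real.cos φ ^ 2) ^ 2 * Real.exp (2 * x * Real.cos φ)) unif :=
      hci' _ (by fun_prop) fun φ => by
        rw [abs_of_nonneg (by positivity)]
        nlinarith [Real.cos_sq_le_one φ, sq_nonneg (Real.cos φ)]
    have hle : ∫ φ, (1 - Real.cos φ) ^ 2 * Real.exp (2 * x * Real.cos φ) ∂unif ≤
        (∫ φ, (1 - Real.cos φ ^ 2) ^ 2 * Real.exp (2 * x * Real.cos φ) ∂unif) + 4 := by
      have : ∫ φ, ((1 - Real.cos φ ^ 2) ^ 2 * Real.exp (2 * x * Real.cos φ) + 4) ∂unif =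
          (∫ φ, (1 - Real.cos φ ^ 2) ^ 2 * Real.exp (2 * x * Real.cos φ) ∂unif) + 4 := by
        rw [integral_add i2 (integrable_const _)]; simp
      rw [← this]
      refine integral_mono i1 (i2.add (integrable_const _)) fun φ => ?_
      have hc1 := Real.cos_le_one φ
      have hc2 := Real.neg_one_le_cos φ
      have he := Real.exp_pos (2 * x * Real.cos φ)
      show (1 - Real.cos φ) ^ 2 * Real.exp (2 * x * Real.cos φ) ≤
        (1 - Real.cos φ ^ 2) ^ 2 * Real.exp (2 * x * Real.cos φ) + 4
      rcases le_total 0 (Real.cos φ) with h | h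
      · have : (1 - Real.cos φ) ^ 2 ≤ (1 - Real.cos φ ^ 2) ^ 2 := by
          apply pow_le_pow_left₀ (by linarith); nlinarith
        nlinarith [mul_le_mul_of_nonneg_right this he.le]
      · have : Real.exp (2 * x * Real.cos φ) ≤ 1 :=
          Real.exp_le_one_iff.2 (mul_nonpos_of_nonneg_of_nonpos (by positivity) h)
        have h3 : (1 - Real.cos φ) ^ 2 ≤ 4 := by nlinarith
        have h4 : 0 ≤ (1 - Real.cos φ ^ 2) ^ 2 * Real.exp (2 * x * Real.cos φ) := by positivity
        nlinarith [mul_le_mul h3 this he.le (by norm_num)]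
    rw [L1, L2] at hle
    rw [L1] at hnn
    have r0 := vonMises_recurrence hx.le 0
    have r1 := vonMises_recurrence hx.le 1
    have r2 := vonMises_recurrence hx.le 2
    have u2 := vonMises_le_one hx.le 2
    norm_num at r0 r1 r2
    rw [vonMises_zero_right hx.le] at r0
    set q1 := vonMises x 1
    set q2 := vonMises x 2
    set q3 := vonMises x 3
    set q4 := vonMises x 4
    have hnn' := nonneg_of_mul_nonneg_right hnn (by linarith : 0 < bessel 0 x)
    have d2 : q2 = 1 - q1 * x⁻¹ := by field_simp; linarith
    have d3 : q3 = q1 - 2 * q2 * x⁻¹ := by field_simp; linarith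
    have d4 : q4 = q2 - 3 * q3 * x⁻¹ := by field_simp; linarith
    have hy : 0 < x⁻¹ := by positivity
    have hxy : x * x⁻¹ = 1 := by field_simp
    have hle' : 3 / 2 + -2 * q1 + 1 / 2 * q2 + 0 * q4 ≤ 3 / 4 * q2 * x⁻¹ ^ 2 + 4 * x⁻¹ ^ 2 := by
      -- Three uses of the recurrence reduce the mean of sin⁴ φ to 3q_2/(4x²).
      have h1 : 3 / 8 + 0 * q1 + -1 / 2 * q2 + 1 / 8 * q4 = 3 / 4 * q2 * x⁻¹ ^ 2 := by
        rw [d4, d3]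
        linear_combination (-3/8 : ℝ) * d2
      rw [h1] at hle
      have h2 : 4 ≤ bessel 0 x * (4 * x⁻¹ ^ 2) := by
        have : x ^ 2 * (4 * x⁻¹ ^ 2) = 4 := by field_simp
        exact this.symm.le.trans (mul_le_mul_of_nonneg_right hB2 (by positivity))
      have h3 : bessel 0 x * (3 / 2 + -2 * q1 + 1 / 2 * q2 + 0 * q4) ≤
          bessel 0 x * (3 / 4 * q2 * x⁻¹ ^ 2 + 4 * x⁻¹ ^ 2) := by
        rw [mul_add (bessel 0 x) (3 / 4 * q2 * x⁻¹ ^ 2)]; linarith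
      exact le_of_mul_le_mul_left h3 (by linarith)
    have e1 : 2 * x * (1 - q1) - q1 / 2 = x * (3 / 2 + -2 * q1 + 1 / 2 * q2 + 0 * q4) := by
      rw [d2]
      linear_combination (q1 / 2) * hxy
    rw [e1, abs_of_nonneg (mul_nonneg hx.le hnn')]
    calc x * (3 / 2 + -2 * q1 + 1 / 2 * q2 + 0 * q4)
        ≤ x * (3 / 4 * 1 * x⁻¹ ^ 2 + 4 * x⁻¹ ^ 2) := by
          refine mul_le_mul_of_nonneg_left (hle'.trans ?_) hx.le
          gcongr
      _ = (3 / 4 + 4) * x⁻¹ * (x * x⁻¹) := by ring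
      _ ≤ 8 * x⁻¹ := by rw [hxy]; nlinarith
  have hinv : Tendsto (fun x : ℝ => 8 * x⁻¹) atTop (𝓝 0) := by
    simpa using tendsto_inv_atTop_zero.const_mul (8 : ℝ)
  have h1 : Tendsto (fun x => 2 * x * (1 - vonMises x 1) - vonMises x 1 / 2) atTop (𝓝 0) :=
    squeeze_zero_norm' ((eventually_gt_atTop 0).mono fun x hx => key x hx) hinv
  -- a bounded version first shows that the ratio itself tends to one
  have h2 : Tendsto (fun x => vonMises x 1) atTop (𝓝 1) := by
    have h3 : Tendsto (fun x : ℝ => (2 * x)⁻¹) atTop (𝓝 0) :=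
      tendsto_inv_atTop_zero.comp (tendsto_id.const_mul_atTop (by norm_num))
    have h4 : Tendsto (fun x => (2 * x)⁻¹ * (vonMises x 1 / 2)) atTop (𝓝 0) := by
      refine squeeze_zero_norm' ?_ h3
      filter_upwards [eventually_gt_atTop 0] with x hx
      have := vonMises_nonneg hx.le 1
      have := vonMises_le_one hx.le 1
      rw [Real.norm_eq_abs, abs_of_nonneg (by positivity)]
      have : (0 : ℝ) < (2 * x)⁻¹ := by positivity
      nlinarith
    have h5 := ((h3.mul h1).add h4).const_sub 1
    simp only [zero_mul, add_zero, sub_zero] at h5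
    refine h5.congr' ?_
    filter_upwards [eventually_gt_atTop 0] with x hx
    field_simp
    ring
  have h3 := h1.add (h2.div_const 2)
  simp only [zero_add, sub_add_cancel] at h3
  exact h3

/-- The recurrence adds 2(k + 1) times the ratio of order k + 1, which tends to one, in passing from
k to k + 2; this matches (k + 2)²/2 - k²/2 = 2(k + 1). -/
lemma tendsto_mul_one_sub_vonMises_nat (k : ℕ) :
    Tendsto (fun x => 2 * x * (1 - vonMises x k)) atTop (𝓝 ((k : ℝ) ^ 2 / 2)) := by
  induction k using Nat.twoStepInduction with
  | zero =>
    refine Tendsto.congr' ?_ (tendsto_const_nhds (x := ((0 : ℕ) : ℝ) ^ 2 / 2))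
    filter_upwards [eventually_ge_atTop 0] with x hx
    simp [vonMises_zero_right hx]
  | one => simpa using tendsto_vonMises_one
  | more k h0 h1 =>
    have h2 := h0.add ((tendsto_of_sub_vonMises h1).const_mul (2 * ((k : ℝ) + 1)))
    rw [show ((k + 2 : ℕ) : ℝ) ^ 2 / 2 = (k : ℝ) ^ 2 / 2 + 2 * ((k : ℝ) + 1) * 1 by
      push_cast; ring]
    refine h2.congr' ?_
    filter_upwards [eventually_ge_atTop 0] with x hx
    have := vonMises_recurrence hx k
    linear_combination (-2 : ℝ) * this

lemma tendsto_mul_one_sub_vonMises (k : ℤ) :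
    Tendsto (fun x => 2 * x * (1 - vonMises x k)) atTop (𝓝 ((k : ℝ) ^ 2 / 2)) := by
  have h := tendsto_mul_one_sub_vonMises_nat k.natAbs
  have h1 : ((k.natAbs : ℕ) : ℝ) ^ 2 = (k : ℝ) ^ 2 := by
    rw [Nat.cast_natAbs]; push_cast; rw [sq_abs]
  have h2 : ∀ x, vonMises x (k.natAbs : ℤ) = vonMises x k := fun x => by
    rw [vonMises, vonMises, Int.natAbs_natCast]
  simp only [h1, h2] at h
  exact h

/-! ### Integrating out the sites of a refined graph -/

/-- Independent uniform angles. -/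
abbrev unifPi (ι : Type*) [Fintype ι] : Measure (ι → ℝ) := Measure.pi fun _ => unif

lemma restrict_angleBox (ι : Type u) [Fintype ι] :
    (volume : Measure (ι → ℝ)).restrict (angleBox ι) =
      ENNReal.ofReal (2 * π) ^ Fintype.card ι • unifPi ι := by
  have h0 : ENNReal.ofReal (2 * π) ≠ 0 := by
    simpa using Real.pi_pos
  rw [angleBox, volume_pi, Measure.restrict_pi_pi]
  refine Measure.pi_eq fun s hs => ?_
  rw [Measure.smul_apply, Measure.pi_pi, smul_eq_mul, ← Finset.card_univ, ← Finset.prod_const,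
    ← Finset.prod_mul_distrib]
  refine Finset.prod_congr rfl fun i _ => ?_
  rw [unif, Measure.smul_apply, smul_eq_mul, ← mul_assoc,
    ENNReal.mul_inv_cancel h0 ENNReal.ofReal_ne_top, one_mul]

lemma gibbsMean_eq {ι : Type u} [Fintype ι] (w f : (ι → ℝ) → ℝ) :
    gibbsMean w f = (∫ θ, f θ * w θ ∂unifPi ι) / ∫ θ, w θ ∂unifPi ι := by
  rw [gibbsMean, restrict_angleBox, integral_smul_measure, integral_smul_measure, smul_eq_mul,
    smul_eq_mul]
  refine mul_div_mul_left _ _ ?_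
  rw [ENNReal.toReal_pow, ENNReal.toReal_ofReal (by positivity)]
  positivity

/-- The angle at the `l`-th site of a chain from `a` to `b` with the inner angles `θ`. -/
def chainPath (n : ℕ) (a b : ℝ) (θ : Fin n → ℝ) (l : ℕ) : ℝ :=
  if l = 0 then a else if h : l - 1 < n then θ ⟨l - 1, h⟩ else b

@[fun_prop]
lemma continuous_chainPath {X : Type*} [TopologicalSpace X] {n : ℕ} {a b : X → ℝ}
    {θ : X → Fin n → ℝ} (ha : Continuous a) (hb : Continuous b) (hθ : Continuous θ) (l : ℕ) :
    Continuous fun x => chainPath n (a x) (b x) (θ x) l := by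
  unfold chainPath
  split_ifs <;> fun_prop

lemma chainPath_cons (n : ℕ) (a b φ : ℝ) (θ : Fin n → ℝ) {l : ℕ} (hl : l ≤ n + 1) :
    chainPath (n + 1) a b (Fin.cons φ θ) (l + 1) = chainPath n φ b θ l := by
  rcases l with _ | l
  · simp [chainPath]
  · simp only [chainPath, Nat.add_eq_zero_iff, one_ne_zero, and_false, if_false,
      Nat.add_sub_cancel, Nat.add_lt_add_iff_right]
    split_ifs with h
    · exact Fin.cons_succ (α := fun _ => ℝ) φ θ ⟨l, h⟩
    · rfl

/-- The increments of a chain. -/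
def chainStep (n : ℕ) (a b : ℝ) (θ : Fin n → ℝ) (l : ℕ) : ℝ :=
  chainPath n a b θ (l + 1) - chainPath n a b θ l

@[fun_prop]
lemma continuous_chainStep {X : Type*} [TopologicalSpace X] {n : ℕ} {a b : X → ℝ}
    {θ : X → Fin n → ℝ} (ha : Continuous a) (hb : Continuous b) (hθ : Continuous θ) (l : ℕ) :
    Continuous fun x => chainStep n (a x) (b x) (θ x) l := by
  unfold chainStep; fun_prop

@[fun_prop]
lemma continuous_fser_comp {X : Type*} [TopologicalSpace X] {a : ℤ → ℝ} (ha : Summable a)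
    {f : X → ℝ} (hf : Continuous f) : Continuous fun x => fser a (f x) :=
  (continuous_fser ha).comp hf

lemma norm_prod_fser_le {ι : Type*} (S : Finset ι) {g : ι → ℤ → ℝ} (hg : ∀ l, Summable (g l))
    (φ : ι → ℝ) : ‖∏ l ∈ S, fser (g l) (φ l)‖ ≤ ∏ l ∈ S, ∑' k, |g l k| := by
  rw [norm_prod]
  exact Finset.prod_le_prod (fun _ _ => norm_nonneg _) fun l _ => norm_fser_le (hg l) _

lemma summable_prod_coeff (m : ℕ) {g : ℕ → ℤ → ℝ} (hg : ∀ l, Summable (g l)) :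
    Summable fun k => ∏ l ∈ Finset.range (m + 1), g l k := by
  induction m with
  | zero => simpa using hg 0
  | succ m ih =>
    simp only [Finset.prod_range_succ _ (m + 1)]
    exact Summable.mul_summable ih (hg _)

/-- Integrating over the first inner angle convolves the first step with the weight of the remaining
chain, which is a Fourier series by induction; convolution multiplies coefficients. -/
lemma integral_chain (n : ℕ) (a b : ℝ) (g : ℕ → ℤ → ℝ) (hg : ∀ l, Summable (g l)) :
    ∫ θ, ∏ l ∈ Finset.range (n + 1), fser (g l) (chainStep n a b θ l) ∂unifPi (Fin n) =
      fser (fun k => ∏ l ∈ Finset.range (n + 1), g l k) (b - a) := by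
  induction n generalizing a g with
  | zero => simp [chainStep, chainPath]
  | succ n ih =>
    have hmp := measurePreserving_piFinSuccAbove (fun _ : Fin (n + 1) => unif) 0
    have hcons : ∀ p : ℝ × (Fin n → ℝ),
        (MeasurableEquiv.piFinSuccAbove (fun _ : Fin (n + 1) => ℝ) 0).symm p =
          Fin.cons p.1 p.2 := fun p => by
      simp [MeasurableEquiv.piFinSuccAbove, Fin.insertNthEquiv]
    have hsplit : ∀ p : ℝ × (Fin n → ℝ), ∏ l ∈ Finset.range (n + 1 + 1), fser (g l)
        (chainStep (n + 1) a b ((MeasurableEquiv.piFinSuccAbove (fun _ : Fin (n + 1) => ℝ) 0).symm p) l)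
        = fser (g 0) (p.1 - a) *
          ∏ l ∈ Finset.range (n + 1), fser (g (l + 1)) (chainStep n p.1 b p.2 l) := fun p => by
      rw [Finset.prod_range_succ', hcons, mul_comm (fser (g 0) (p.1 - a))]
      refine congrArg₂ (· * ·) (Finset.prod_congr rfl fun l hl => ?_) ?_
      · have := Finset.mem_range.1 hl
        simp only [chainStep]
        rw [chainPath_cons _ _ _ _ _ (by omega), chainPath_cons _ _ _ _ _ (by omega)]
      · simp only [chainStep]
        rw [chainPath_cons _ _ _ _ _ (by omega)]
        simp [chainPath]
    rw [← hmp.symm.integral_comp']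
    simp only [hsplit]
    have hint : Integrable (fun p : ℝ × (Fin n → ℝ) => fser (g 0) (p.1 - a) *
        ∏ l ∈ Finset.range (n + 1), fser (g (l + 1)) (chainStep n p.1 b p.2 l))
        (unif.prod (unifPi (Fin n))) := by
      refine integrable_of_continuous_bounded (.mul (continuous_fser_comp (hg 0) (by fun_prop))
        (continuous_finsetProd _ fun l _ => continuous_fser_comp (hg _) (by fun_prop)))
        ((∑' k, |g 0 k|) * ∏ l ∈ Finset.range (n + 1), ∑' k, |g (l + 1) k|) fun p => ?_
      rw [norm_mul]
      exact mul_le_mul (norm_fser_le (hg 0) _) (norm_prod_fser_le _ (fun l => hg (l + 1)) _)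
        (norm_nonneg _) (tsum_nonneg fun _ => abs_nonneg _)
    rw [integral_prod _ hint]
    simp only [integral_const_mul, ih _ (fun l => g (l + 1)) fun l => hg _]
    rw [integral_fser_mul_fser (hg 0) (summable_prod_coeff n fun l => hg (l + 1))]
    congr 1
    funext k
    rw [Finset.prod_range_succ' _ (n + 1), mul_comm]

/-- Once the angles at the vertices are fixed, the interiors of different edges are independent. -/
lemma integral_prod_curry {E : Type*} [Fintype E] {κ : Type*} [Fintype κ] (G : E → (κ → ℝ) → ℂ) :
    ∫ θ, ∏ e, G e (fun j => θ (e, j)) ∂unifPi (E × κ) = ∏ e, ∫ θ, G e θ ∂unifPi κ := by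
  rw [← integral_fintype_prod_eq_prod]
  have h := Measure.infinitePi_map_curry (X := ℝ) fun (_ : E) (_ : κ) => unif
  simp only [Measure.infinitePi_eq_pi] at h
  rw [← h, integral_map_equiv (MeasurableEquiv.curry E κ ℝ)]
  rfl

/-- Integration over the interior sites of all edges of a refined graph. -/
lemma integral_refined {V E : Type*} [Fintype V] [Fintype E] (s t : E → V) (n : ℕ)
    (g : E → ℕ → ℤ → ℝ) (hg : ∀ e l, Summable (g e l)) {F : (V → ℝ) → ℂ} (hF : Continuous F)
    (C : ℝ) (hC : ∀ θ, ‖F θ‖ ≤ C) :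
    ∫ θ, F (fun v => θ (Sum.inl v)) * ∏ e, ∏ l ∈ Finset.range (n + 1), fser (g e l)
      (chainStep n (θ (Sum.inl (s e))) (θ (Sum.inl (t e))) (fun j => θ (Sum.inr (e, j))) l)
      ∂unifPi (V ⊕ (E × Fin n)) =
    ∫ θ, F θ * ∏ e, fser (fun k => ∏ l ∈ Finset.range (n + 1), g e l k) (θ (t e) - θ (s e))
      ∂unifPi V := by
  rw [← (measurePreserving_sumPiEquivProdPi_symm
    (fun _ : V ⊕ (E × Fin n) => unif)).integral_comp']
  have hint : Integrable (fun p : (V → ℝ) × (E × Fin n → ℝ) => F p.1 * ∏ e,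
      ∏ l ∈ Finset.range (n + 1), fser (g e l)
        (chainStep n (p.1 (s e)) (p.1 (t e)) (fun j => p.2 (e, j)) l))
      ((unifPi V).prod (unifPi (E × Fin n))) := by
    refine integrable_of_continuous_bounded (.mul (by fun_prop)
      (continuous_finsetProd _ fun e _ => continuous_finsetProd _ fun l _ =>
        continuous_fser_comp (hg e l) (by fun_prop)))
      (C * ∏ e, ∏ l ∈ Finset.range (n + 1), ∑' k, |g e l k|) fun p => ?_
    rw [norm_mul, norm_prod]
    exact mul_le_mul (hC _) (Finset.prod_le_prod (fun _ _ => norm_nonneg _) fun e _ =>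
      norm_prod_fser_le _ (hg e) _) (Finset.prod_nonneg fun _ _ => norm_nonneg _)
      ((norm_nonneg _).trans (hC 0))
  refine (integral_prod _ hint).trans ?_
  refine integral_congr_ae (Eventually.of_forall fun θ => ?_)
  simp only [integral_const_mul]
  congr 1
  rw [integral_prod_curry fun e θ' => ∏ l ∈ Finset.range (n + 1), fser (g e l)
    (chainStep n (θ (s e)) (θ (t e)) θ' l)]
  exact Finset.prod_congr rfl fun e _ => integral_chain n _ _ _ (hg e)

/-! ### Insertions -/

/-- This is how inserted spins act: a character carried by a step only translates its Fourier
coefficients. -/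
lemma echar_mul_fser (r : ℤ) (a : ℤ → ℝ) (φ : ℝ) :
    echar r φ * fser a φ = fser (fun k => a (k - r)) φ := by
  rw [fser, fser, ← tsum_mul_left,
    ← (Equiv.addRight r).tsum_eq fun k => (a (k - r) : ℂ) * echar k φ]
  refine tsum_congr fun k => ?_
  simp only [Equiv.coe_addRight, add_sub_cancel_right, echar_add_left]
  ring

lemma summable_shift {a : ℤ → ℝ} (ha : Summable a) (r : ℤ) : Summable fun k => a (k - r) :=
  (Equiv.subRight r).summable_iff.2 ha

/-- The Gibbs integral with the spins of the edge variables integrated out. -/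
def edgeMean {V E : Type*} [Fintype V] [Fintype E] (s t : E → V) (a : E → ℤ → ℝ) (p p' : V) : ℂ :=
  ∫ θ, echar 1 (θ p - θ p') * ∏ e, fser (a e) (θ (t e) - θ (s e)) ∂unifPi V

/-- The Fourier coefficients of an edge with `N` steps, among which `a` carry the character `1` and
`b` the character `-1`. -/
def edgeCoeff (x : ℝ) (N a b : ℕ) (k : ℤ) : ℝ :=
  vonMises x k ^ (N - a - b) * vonMises x (k - 1) ^ a * vonMises x (k + 1) ^ b

/-- The character carried by the step `l` when `σ_j` and the conjugate of `σ_j'` are inserted. -/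
def insertion (j j' l : ℕ) : ℤ := (if l < j then 1 else 0) - if l < j' then 1 else 0

/-- Steps before both sites, or after both, carry no net character; those between the sites carry 1
or -1 according to the order of the sites. By truncated subtraction at most one of j - j' and j' - j
is nonzero. -/
lemma prod_insertion (f : ℤ → ℝ) (N j j' : ℕ) (hj : j ≤ N) (hj' : j' ≤ N) :
    ∏ l ∈ Finset.range N, f (insertion j j' l) =
      f 0 ^ (N - (j - j') - (j' - j)) * f 1 ^ (j - j') * f (-1) ^ (j' - j) := by
  have h : ∀ l ∈ Finset.range N, f (insertion j j' l) =
      (if l ∈ Finset.Ico j' j then f 1 else 1) * (if l ∈ Finset.Ico j j' then f (-1) else 1) *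
        (if l ∈ Finset.range (min j j') ∪ Finset.Ico (max j j') N then f 0 else 1) := by
    intro l hl
    have hl := Finset.mem_range.1 hl
    simp only [insertion, Finset.mem_Ico, Finset.mem_union, Finset.mem_range]
    by_cases h1 : l < j <;> by_cases h2 : l < j'
    · simp [h1, h2, not_le.2 h1, not_le.2 h2]
    · have : max j j' > l := lt_max_of_lt_left h1
      simp [h1, h2, not_lt.1 h2, not_le.2 h1]
    · simp [h1, h2, not_lt.1 h1, not_le.2 h2]
    · simp [h1, h2, not_lt.1 h1, not_lt.1 h2, hl]
  rw [Finset.prod_congr rfl h, Finset.prod_mul_distrib, Finset.prod_mul_distrib,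
    Finset.prod_ite_mem, Finset.prod_ite_mem, Finset.prod_ite_mem, Finset.prod_const,
    Finset.prod_const, Finset.prod_const]
  have c1 : (Finset.range N ∩ Finset.Ico j' j).card = j - j' := by
    rw [Finset.inter_eq_right.2, Nat.card_Ico]
    intro l hl; simp at hl ⊢; omega
  have c2 : (Finset.range N ∩ Finset.Ico j j').card = j' - j := by
    rw [Finset.inter_eq_right.2, Nat.card_Ico]
    intro l hl; simp at hl ⊢; omega
  have c3 : (Finset.range N ∩ (Finset.range (min j j') ∪ Finset.Ico (max j j') N)).card =
      N - (j - j') - (j' - j) := by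
    rw [Finset.inter_eq_right.2, Finset.card_union_of_disjoint, Nat.card_Ico, Finset.card_range]
    · omega
    · rw [Finset.disjoint_left]
      intro l hl; simp at hl ⊢; omega
    · intro l hl; simp at hl ⊢; omega
  rw [c1, c2, c3]
  ring

lemma integral_insertion {V E : Type*} [Fintype V] [Fintype E] (s t : E → V) (n : ℕ) (x : E → ℝ)
    (j j' : E → ℕ) (hj : ∀ e, j e ≤ n + 1) (hj' : ∀ e, j' e ≤ n + 1) (p p' : V) :
    ∫ θ, echar 1 (θ (Sum.inl p) - θ (Sum.inl p')) * ∏ e, ∏ l ∈ Finset.range (n + 1),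
      (echar (insertion (j e) (j' e) l) (chainStep n (θ (Sum.inl (s e))) (θ (Sum.inl (t e)))
        (fun i => θ (Sum.inr (e, i))) l) *
      fser (vonMises (x e)) (chainStep n (θ (Sum.inl (s e))) (θ (Sum.inl (t e)))
        (fun i => θ (Sum.inr (e, i))) l)) ∂unifPi (V ⊕ (E × Fin n)) =
    edgeMean s t (fun e => edgeCoeff (x e) (n + 1) (j e - j' e) (j' e - j e)) p p' := by
  simp only [echar_mul_fser]
  rw [integral_refined s t n (fun e l k => vonMises (x e) (k - insertion (j e) (j' e) l))
    (fun e l => summable_shift (summable_vonMises _) _)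
    (F := fun θ => echar 1 (θ p - θ p')) (by fun_prop) 1 (fun θ => (norm_echar _ _).le), edgeMean]
  have : ∀ e k, ∏ l ∈ Finset.range (n + 1), vonMises (x e) (k - insertion (j e) (j' e) l) =
      edgeCoeff (x e) (n + 1) (j e - j' e) (j' e - j e) k := fun e k => by
    rw [prod_insertion (fun r => vonMises (x e) (k - r)) _ _ _ (hj e) (hj' e), edgeCoeff, sub_zero,
      sub_neg_eq_add]
  simp only [this]

/-! ### Limits of edge weights -/

lemma tendsto_fser {ι : Type*} {L : Filter ι} {a : ι → ℤ → ℝ}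
    {a₀ bd : ℤ → ℝ} (hbd : Summable bd) (hle : ∀ᶠ i in L, ∀ k, |a i k| ≤ bd k)
    (hlim : ∀ k, Tendsto (fun i => a i k) L (𝓝 (a₀ k))) (φ : ℝ) :
    Tendsto (fun i => fser (a i) φ) L (𝓝 (fser a₀ φ)) := by
  refine tendsto_tsum_of_dominated_convergence hbd (fun k => ?_) ?_
  · exact ((Complex.continuous_ofReal.tendsto _).comp (hlim k)).mul_const _
  · filter_upwards [hle] with i hi k
    rw [norm_coeff_mul_echar]
    exact hi k

/-- Dominated convergence twice: in the Fourier index for fixed angles, with the summable bound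
`bd`, then in the angles, where the sums of these bounds give a constant majorant. -/
lemma tendsto_edgeMean {V E : Type*} [Fintype V] [Fintype E] (s t : E → V) {ι : Type*}
    {L : Filter ι} [L.IsCountablyGenerated] {a : ι → E → ℤ → ℝ} {a₀ bd : E → ℤ → ℝ}
    (hbd : ∀ e, Summable (bd e)) (hle : ∀ e, ∀ᶠ i in L, ∀ k, |a i e k| ≤ bd e k)
    (hlim : ∀ e k, Tendsto (fun i => a i e k) L (𝓝 (a₀ e k))) (p p' : V) :
    Tendsto (fun i => edgeMean s t (a i) p p') L (𝓝 (edgeMean s t a₀ p p')) := by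
  have hsum : ∀ i e, (∀ k, |a i e k| ≤ bd e k) → Summable (a i e) := fun i e h =>
    Summable.of_norm_bounded (hbd e) h
  refine tendsto_integral_filter_of_dominated_convergence (fun _ => ∏ e, ∑' k, bd e k) ?_ ?_
    (integrable_const _) ?_
  · filter_upwards [eventually_all.2 hle] with i hi
    exact (Continuous.mul (by fun_prop) (continuous_finsetProd _ fun e _ =>
      continuous_fser_comp (hsum i e (hi e)) (by fun_prop))).aestronglyMeasurable
  · filter_upwards [eventually_all.2 hle] with i hi
    refine Eventually.of_forall fun θ => ?_
    rw [norm_mul, norm_echar, one_mul, norm_prod]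
    refine Finset.prod_le_prod (fun _ _ => norm_nonneg _) fun e _ => ?_
    exact (norm_fser_le (hsum i e (hi e)) _).trans
      ((hsum i e (hi e)).abs.tsum_le_tsum (hi e) (hbd e))
  · refine Eventually.of_forall fun θ => Tendsto.const_mul _ (tendsto_finsetProd _ fun e _ => ?_)
    exact tendsto_fser (hbd e) (hle e) (hlim e) _

/-- Of the exponents N - a - b, a and b, at least one is N/3 or more. That power has the summable
bound, the other two are at most one, and the sum on the right covers the three cases. -/
lemma abs_edgeCoeff_le {x : ℝ} (hx : 0 < x) {A : ℝ} (hA : 0 ≤ A) {N a b : ℕ} (hab : a + b ≤ N)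
    (hN : 3 * (A * x) ≤ N) (k : ℤ) :
    |edgeCoeff x N a b k| ≤
      vonMisesBound A k + vonMisesBound A (k - 1) + vonMisesBound A (k + 1) := by
  have h0 := fun k => vonMises_nonneg hx.le k
  have h1 := fun (k : ℤ) (m : ℕ) => pow_le_one₀ (n := m) (h0 k) (vonMises_le_one hx.le k)
  have hb := fun k => vonMisesBound_nonneg hA k
  have hp := fun (k : ℤ) (m : ℕ) => pow_nonneg (h0 k) m
  rw [edgeCoeff, abs_of_nonneg (mul_nonneg (mul_nonneg (hp _ _) (hp _ _)) (hp _ _))]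
  have hcase : A * x ≤ (N - a - b : ℕ) ∨ A * x ≤ a ∨ A * x ≤ b := by
    by_contra! h
    have : (N : ℝ) = (N - a - b : ℕ) + a + b := by
      exact_mod_cast (by omega : N = (N - a - b) + a + b)
    linarith
  rcases hcase with h | h | h
  · have := vonMises_pow_le hx hA h k
    have h2 : vonMises x k ^ (N - a - b) * vonMises x (k - 1) ^ a * vonMises x (k + 1) ^ b ≤
        vonMises x k ^ (N - a - b) * 1 * 1 :=
      mul_le_mul (mul_le_mul_of_nonneg_left (h1 _ _) (hp _ _)) (h1 _ _) (hp _ _)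
        (mul_nonneg (hp _ _) zero_le_one)
    linarith [hb (k - 1), hb (k + 1)]
  · have := vonMises_pow_le hx hA h (k - 1)
    have h2 : vonMises x k ^ (N - a - b) * vonMises x (k - 1) ^ a * vonMises x (k + 1) ^ b ≤
        1 * vonMises x (k - 1) ^ a * 1 :=
      mul_le_mul (mul_le_mul_of_nonneg_right (h1 _ _) (hp _ _)) (h1 _ _) (hp _ _)
        (mul_nonneg zero_le_one (hp _ _))
    linarith [hb k, hb (k + 1)]
  · have := vonMises_pow_le hx hA h (k + 1)
    have h2 : vonMises x k ^ (N - a - b) * vonMises x (k - 1) ^ a * vonMises x (k + 1) ^ b ≤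
        1 * 1 * vonMises x (k + 1) ^ b :=
      mul_le_mul_of_nonneg_right (mul_le_mul (h1 _ _) (h1 _ _) (hp _ _) zero_le_one) (hp _ _)
    linarith [hb k, hb (k - 1)]

/-- At x = κN/2 one has 2x = κN, so N times the deviation of the ratio from one tends to -k²/(2κ);
then (1 + c_N/N)^N → exp(lim c_N). -/
lemma tendsto_vonMises_pow {κ : ℝ} (hκ : 0 < κ) (k : ℤ) :
    Tendsto (fun N : ℕ => vonMises (κ * N / 2) k ^ N) atTop
      (𝓝 (Real.exp (-((k : ℝ) ^ 2 / (2 * κ))))) := by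
  have h1 : Tendsto (fun N : ℕ => κ * N / 2) atTop atTop :=
    (tendsto_natCast_atTop_atTop.const_mul_atTop hκ).atTop_div_const (by norm_num)
  have h2 := ((tendsto_mul_one_sub_vonMises k).comp h1).const_mul (-κ⁻¹)
  have h3 : Tendsto (fun N : ℕ => (N : ℝ) * (vonMises (κ * N / 2) k - 1)) atTop
      (𝓝 (-((k : ℝ) ^ 2 / (2 * κ)))) := by
    convert h2 using 1
    · funext N
      simp only [Function.comp]
      field_simp
      ring
    · congr 1
      field_simp
  refine (Real.tendsto_one_add_pow_exp_of_tendsto h3).congr fun N => ?_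
  rw [add_sub_cancel]

/-- Write the m-th power as the N-th power raised to the real exponent m/N. A limiting fraction zero
is allowed because the limit of the N-th power is positive. -/
lemma tendsto_vonMises_pow_of_tendsto {κ : ℝ} (hκ : 0 < κ) (k : ℤ) {ι : Type*} {L : Filter ι}
    {N m : ι → ℕ} (hN : Tendsto N L atTop) {α : ℝ}
    (hm : Tendsto (fun i => (m i : ℝ) / N i) L (𝓝 α)) :
    Tendsto (fun i => vonMises (κ * N i / 2) k ^ m i) L
      (𝓝 (Real.exp (-((k : ℝ) ^ 2 * α / (2 * κ))))) := by
  have h1 := ((tendsto_vonMises_pow hκ k).comp hN).rpow hm (Or.inl (Real.exp_pos _).ne')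
  rw [← Real.exp_mul, show -((k : ℝ) ^ 2 / (2 * κ)) * α = -((k : ℝ) ^ 2 * α / (2 * κ)) by ring] at h1
  refine h1.congr' ?_
  filter_upwards [hN.eventually (eventually_gt_atTop 0)] with i hi
  have hi' : (0 : ℝ) < N i := by exact_mod_cast hi
  have h0 : 0 ≤ vonMises (κ * N i / 2) k := vonMises_nonneg (by positivity) k
  simp only [Function.comp]
  rw [← Real.rpow_natCast, ← Real.rpow_natCast, ← Real.rpow_mul h0]
  congr 1
  field_simp

/-- The limit of the Fourier coefficients of an edge, with insertions at distance `δ`. -/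
def edgeLimit (κ δ : ℝ) (k : ℤ) : ℝ :=
  Real.exp (-(((k : ℝ) ^ 2 - 2 * k * δ + |δ|) / (2 * κ)))

/-- With δ = σ - τ and its positive and negative parts, the three groups of steps contribute k²(1 -
|δ|) + (k - 1)² δ₊ + (k + 1)² δ₋ = k² - 2kδ + |δ| to the exponent. -/
lemma tendsto_edgeCoeff {κ : ℝ} (hκ : 0 < κ) (k : ℤ) {ι : Type*} {L : Filter ι}
    {N j j' : ι → ℕ} (hN : Tendsto N L atTop) (hj : ∀ i, j i ≤ N i) (hj' : ∀ i, j' i ≤ N i)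
    {σ τ : ℝ} (hσ : Tendsto (fun i => (j i : ℝ) / N i) L (𝓝 σ))
    (hτ : Tendsto (fun i => (j' i : ℝ) / N i) L (𝓝 τ)) :
    Tendsto (fun i => edgeCoeff (κ * N i / 2) (N i) (j i - j' i) (j' i - j i) k) L
      (𝓝 (edgeLimit κ (σ - τ) k)) := by
  have cast_sub : ∀ u v w : ℕ, ((u - v : ℕ) : ℝ) / w = max ((u : ℝ) / w - v / w) 0 := by
    intro u v w
    rw [← sub_div]
    rcases le_total v u with h | h
    · rw [Nat.cast_sub h, max_eq_left]
      exact div_nonneg (sub_nonneg.2 (by exact_mod_cast h)) (Nat.cast_nonneg _)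
    · rw [Nat.sub_eq_zero_of_le h, max_eq_right, Nat.cast_zero, zero_div]
      exact div_nonpos_of_nonpos_of_nonneg (sub_nonpos.2 (by exact_mod_cast h)) (Nat.cast_nonneg _)
  have ha : Tendsto (fun i => ((j i - j' i : ℕ) : ℝ) / N i) L (𝓝 (max (σ - τ) 0)) :=
    ((hσ.sub hτ).max tendsto_const_nhds).congr fun i => (cast_sub _ _ _).symm
  have hb : Tendsto (fun i => ((j' i - j i : ℕ) : ℝ) / N i) L (𝓝 (max (τ - σ) 0)) :=
    ((hτ.sub hσ).max tendsto_const_nhds).congr fun i => (cast_sub _ _ _).symm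
  have hc : Tendsto (fun i => ((N i - (j i - j' i) - (j' i - j i) : ℕ) : ℝ) / N i) L
      (𝓝 (1 - max (σ - τ) 0 - max (τ - σ) 0)) := by
    refine ((tendsto_const_nhds.sub ha).sub hb).congr' ?_
    filter_upwards [hN.eventually (eventually_gt_atTop 0)] with i hi
    have hi' : (N i : ℝ) ≠ 0 := by positivity
    have h1 := hj i
    have h2 := hj' i
    have h3 : ((N i - (j i - j' i) - (j' i - j i) : ℕ) : ℝ) =
        N i - (j i - j' i : ℕ) - (j' i - j i : ℕ) := by
      have : N i - (j i - j' i) - (j' i - j i) + (j i - j' i) + (j' i - j i) = N i := by omega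
      have h4 : ((N i - (j i - j' i) - (j' i - j i) : ℕ) : ℝ) + (j i - j' i : ℕ) +
        (j' i - j i : ℕ) = N i := by exact_mod_cast this
      linarith
    rw [h3, sub_div, sub_div, div_self hi']
  have h := ((tendsto_vonMises_pow_of_tendsto hκ k hN hc).mul
    (tendsto_vonMises_pow_of_tendsto hκ (k - 1) hN ha)).mul
    (tendsto_vonMises_pow_of_tendsto hκ (k + 1) hN hb)
  have hmm : max (σ - τ) 0 - max (τ - σ) 0 = σ - τ ∧
      max (σ - τ) 0 + max (τ - σ) 0 = |σ - τ| := by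
    rcases le_total σ τ with h | h
    · rw [max_eq_right (by linarith), max_eq_left (by linarith), abs_of_nonpos (by linarith)]
      constructor <;> ring
    · rw [max_eq_left (by linarith), max_eq_right (by linarith), abs_of_nonneg (by linarith)]
      constructor <;> ring
  have hlim : edgeLimit κ (σ - τ) k = Real.exp (-((k : ℝ) ^ 2 *
      (1 - max (σ - τ) 0 - max (τ - σ) 0) / (2 * κ))) *
      Real.exp (-(((k - 1 : ℤ) : ℝ) ^ 2 * max (σ - τ) 0 / (2 * κ))) *
      Real.exp (-(((k + 1 : ℤ) : ℝ) ^ 2 * max (τ - σ) 0 / (2 * κ))) := by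
    rw [edgeLimit, ← Real.exp_add, ← Real.exp_add, ← hmm.2]
    nth_rewrite 1 [← hmm.1]
    congr 1
    push_cast
    field_simp
    ring
  rw [hlim]
  exact h

/-! ### The refined XY model on a multigraph -/

lemma spin_eq_echar (θ : ℝ) : spin θ = echar 1 θ := by simp [spin, echar]

lemma norm_spin (θ : ℝ) : ‖spin θ‖ = 1 := Complex.norm_exp_ofReal_mul_I θ

@[fun_prop]
lemma continuous_spin : Continuous spin := by unfold spin; fun_prop

lemma inner_spin (φ ψ : ℝ) : inner ℝ (spin φ) (spin ψ) = Real.cos (φ - ψ) := by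
  rw [real_inner_comm, Complex.inner, spin_eq_echar, spin_eq_echar, conj_echar, ← echar_sub, echar]
  rw [show ((1 : ℤ) : ℂ) * ((φ - ψ : ℝ) : ℂ) * Complex.I = ((φ - ψ : ℝ) : ℂ) * Complex.I by
    push_cast; ring, Complex.exp_ofReal_mul_I_re]

lemma norm_spin_sub_sq (φ ψ : ℝ) : ‖spin φ - spin ψ‖ ^ 2 = 2 - 2 * Real.cos (φ - ψ) := by
  rw [norm_sub_sq_real, norm_spin, norm_spin, inner_spin]
  ring

/-- The angles at the sites along an edge. -/
def refPath {V E : Type*} (s t : E → V) (n : ℕ) (θ : V ⊕ (E × Fin n) → ℝ) (e : E) (l : ℕ) : ℝ :=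
  chainPath n (θ (Sum.inl (s e))) (θ (Sum.inl (t e))) (fun i => θ (Sum.inr (e, i))) l

@[fun_prop]
lemma continuous_refPath {V E : Type*} (s t : E → V) (n : ℕ) (e : E) (l : ℕ) :
    Continuous fun θ : V ⊕ (E × Fin n) → ℝ => refPath s t n θ e l := by
  unfold refPath; fun_prop

/-- The Gibbs factor of the XY model with `n` new sites in each edge of a multigraph. -/
def refWeight {V E : Type*} [Fintype E] (s t : E → V) (K : E → ℝ) (n : ℕ)
    (θ : V ⊕ (E × Fin n) → ℝ) : ℝ :=
  ∏ e, Real.exp (-(K e * (n + 1 : ℕ) / 2) * ∑ l ∈ Finset.range (n + 1),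
    ‖spin (refPath s t n θ e (l + 1)) - spin (refPath s t n θ e l)‖ ^ 2)

lemma continuous_refWeight {V E : Type*} [Fintype E] (s t : E → V) (K : E → ℝ) (n : ℕ) :
    Continuous (refWeight s t K n) := by
  unfold refWeight; fun_prop

lemma refWeight_pos {V E : Type*} [Fintype E] (s t : E → V) (K : E → ℝ) (n : ℕ)
    (θ : V ⊕ (E × Fin n) → ℝ) : 0 < refWeight s t K n θ :=
  Finset.prod_pos fun _ _ => Real.exp_pos _

lemma refWeight_le_one {V E : Type*} [Fintype E] (s t : E → V) {K : E → ℝ} (hK : ∀ e, 0 ≤ K e)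
    (n : ℕ) (θ : V ⊕ (E × Fin n) → ℝ) : refWeight s t K n θ ≤ 1 := by
  refine Finset.prod_le_one (fun _ _ => (Real.exp_pos _).le) fun e _ => ?_
  have := hK e
  rw [Real.exp_le_one_iff, neg_mul, neg_nonpos]
  positivity

/-- The spin at the `j`-th site of an edge, written as a product along the edges, of which all but
one have `j = 0`. -/
def gridSpin {V E : Type*} [Fintype E] (s t : E → V) (n : ℕ) (θ : V ⊕ (E × Fin n) → ℝ) (p : V)
    (j : E → ℕ) : ℂ :=
  spin (θ (Sum.inl p)) * ∏ e, spin (refPath s t n θ e (j e) - refPath s t n θ e 0)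

lemma continuous_gridSpin {V E : Type*} [Fintype E] (s t : E → V) (n : ℕ) (p : V) (j : E → ℕ) :
    Continuous fun θ => gridSpin s t n θ p j := by
  unfold gridSpin; fun_prop

lemma norm_gridSpin {V E : Type*} [Fintype E] (s t : E → V) (n : ℕ) (θ : V ⊕ (E × Fin n) → ℝ)
    (p : V) (j : E → ℕ) : ‖gridSpin s t n θ p j‖ = 1 := by
  rw [gridSpin, norm_mul, norm_prod, norm_spin]
  simp [norm_spin]

lemma gridSpin_zero {V E : Type*} [Fintype E] (s t : E → V) (n : ℕ) (θ : V ⊕ (E × Fin n) → ℝ)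
    (p : V) : gridSpin s t n θ p (fun _ => 0) = spin (θ (Sum.inl p)) := by
  simp [gridSpin, spin]

lemma gridSpin_single {V E : Type*} [Fintype E] [DecidableEq E] (s t : E → V) (n : ℕ)
    (θ : V ⊕ (E × Fin n) → ℝ) (e : E) (j : ℕ) :
    gridSpin s t n θ (s e) (Pi.single e j) = spin (refPath s t n θ e j) := by
  rw [gridSpin, Finset.prod_eq_single e]
  · rw [Pi.single_eq_same, spin_eq_echar, spin_eq_echar, ← echar_add, spin_eq_echar]
    simp [refPath, chainPath]
  · intro e' _ he
    rw [Pi.single_eq_of_ne he, sub_self]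
    simp [spin]
  · simp

lemma prod_echar_lt (f : ℕ → ℝ) {N j : ℕ} (hj : j ≤ N) :
    ∏ l ∈ Finset.range N, echar (if l < j then 1 else 0) (f (l + 1) - f l) =
      echar 1 (f j - f 0) := by
  have h : ∀ m, ∏ l ∈ Finset.range m, echar 1 (f (l + 1) - f l) = echar 1 (f m - f 0) := fun m => by
    induction m with
    | zero => simp [echar]
    | succ m ih =>
      rw [Finset.prod_range_succ, ih, ← echar_add]
      ring_nf
  rw [← h j, ← Finset.prod_subset (Finset.range_mono hj)]
  · exact Finset.prod_congr rfl fun l hl => by rw [if_pos (Finset.mem_range.1 hl)]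
  · intro l _ hl
    rw [if_neg (by simpa using hl), echar_zero_left]

/-- Telescoping along every edge reduces the two-point function to a product of one-step characters.
Taking the product over all edges treats vertices, points of one edge and points of different edges
alike. -/
lemma gridSpin_mul_conj {V E : Type*} [Fintype E] (s t : E → V) (n : ℕ)
    (θ : V ⊕ (E × Fin n) → ℝ) (p p' : V) (j j' : E → ℕ) (hj : ∀ e, j e ≤ n + 1)
    (hj' : ∀ e, j' e ≤ n + 1) :
    gridSpin s t n θ p j * (starRingEnd ℂ) (gridSpin s t n θ p' j') =
      echar 1 (θ (Sum.inl p) - θ (Sum.inl p')) * ∏ e, ∏ l ∈ Finset.range (n + 1),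
        echar (insertion (j e) (j' e) l) (refPath s t n θ e (l + 1) - refPath s t n θ e l) := by
  have h : ∀ e, ∏ l ∈ Finset.range (n + 1),
      echar (insertion (j e) (j' e) l) (refPath s t n θ e (l + 1) - refPath s t n θ e l) =
      spin (refPath s t n θ e (j e) - refPath s t n θ e 0) *
        (starRingEnd ℂ) (spin (refPath s t n θ e (j' e) - refPath s t n θ e 0)) := fun e => by
    rw [spin_eq_echar, spin_eq_echar, ← prod_echar_lt _ (hj e), ← prod_echar_lt _ (hj' e), map_prod,
      ← Finset.prod_mul_distrib]
    refine Finset.prod_congr rfl fun l _ => ?_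
    rw [conj_echar, ← echar_add_left, insertion, sub_eq_add_neg]
  simp only [h]
  rw [gridSpin, gridSpin, map_mul, map_prod, Finset.prod_mul_distrib, echar_sub, spin_eq_echar,
    spin_eq_echar, conj_echar]
  ring

/-- The constant relating the XY Gibbs factor to normalized step weights. -/
def stepConst {E : Type*} [Fintype E] (K : E → ℝ) (n : ℕ) : ℝ :=
  ∏ e, ∏ _l ∈ Finset.range (n + 1),
    Real.exp (-(K e * (n + 1 : ℕ))) * bessel 0 (K e * (n + 1 : ℕ) / 2)

lemma stepConst_pos {E : Type*} [Fintype E] {K : E → ℝ} (hK : ∀ e, 0 ≤ K e) (n : ℕ) :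
    0 < stepConst K n := by
  refine Finset.prod_pos fun e _ => Finset.prod_pos fun _ _ => mul_pos (Real.exp_pos _) ?_
  have := hK e
  have := one_le_bessel_zero (x := K e * (n + 1 : ℕ) / 2) (by positivity)
  linarith

/-- As |σ - σ'|² = 2 - 2 cos, a step has weight e^{-KN} exp(KN cos), which is the generating
function at x = KN/2; dividing by I_0 normalizes its zeroth coefficient to one. -/
lemma refWeight_eq {V E : Type*} [Fintype E] (s t : E → V) {K : E → ℝ} (hK : ∀ e, 0 ≤ K e) (n : ℕ)
    (θ : V ⊕ (E × Fin n) → ℝ) :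
    (refWeight s t K n θ : ℂ) = stepConst K n * ∏ e, ∏ l ∈ Finset.range (n + 1),
      fser (vonMises (K e * (n + 1 : ℕ) / 2))
        (refPath s t n θ e (l + 1) - refPath s t n θ e l) := by
  have h : ∀ e l, ((Real.exp (-(K e * (n + 1 : ℕ) / 2) * ‖spin (refPath s t n θ e (l + 1)) -
      spin (refPath s t n θ e l)‖ ^ 2) : ℝ) : ℂ) =
      ((Real.exp (-(K e * (n + 1 : ℕ))) * bessel 0 (K e * (n + 1 : ℕ) / 2) : ℝ) : ℂ) *
      fser (vonMises (K e * (n + 1 : ℕ) / 2))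
        (refPath s t n θ e (l + 1) - refPath s t n θ e l) := fun e l => by
    have hb : bessel 0 (K e * (n + 1 : ℕ) / 2) ≠ 0 := by
      have := hK e
      have := one_le_bessel_zero (x := K e * (n + 1 : ℕ) / 2) (by positivity)
      linarith
    rw [fser_vonMises, norm_spin_sub_sq, ← Complex.ofReal_mul, mul_assoc, mul_inv_cancel_left₀ hb,
      ← Real.exp_add]
    congr 2
    ring
  simp only [refWeight, stepConst, Complex.ofReal_prod, Finset.mul_sum, Real.exp_sum, h]
  simp only [Finset.prod_mul_distrib, Complex.ofReal_mul]

/-- The two-point function of grid spins in terms of Fourier coefficients. -/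
lemma gibbsMean_gridSpin {V E : Type u} [Fintype V] [Fintype E] (s t : E → V) {K : E → ℝ}
    (hK : ∀ e, 0 ≤ K e) (n : ℕ) (p p' : V) (j j' : E → ℕ) (hj : ∀ e, j e ≤ n + 1)
    (hj' : ∀ e, j' e ≤ n + 1) :
    gibbsMean (refWeight s t K n)
        (fun θ => inner ℝ (gridSpin s t n θ p j) (gridSpin s t n θ p' j')) =
      (edgeMean s t (fun e => edgeCoeff (K e * (n + 1 : ℕ) / 2) (n + 1) (j e - j' e) (j' e - j e))
        p p').re /
      (edgeMean s t (fun e => edgeCoeff (K e * (n + 1 : ℕ) / 2) (n + 1) 0 0) p p).re := by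
  have key : ∀ (p p' : V) (j j' : E → ℕ), (∀ e, j e ≤ n + 1) → (∀ e, j' e ≤ n + 1) →
      ∫ θ, inner ℝ (gridSpin s t n θ p j) (gridSpin s t n θ p' j') * refWeight s t K n θ
        ∂unifPi (V ⊕ (E × Fin n)) = stepConst K n * (edgeMean s t
        (fun e => edgeCoeff (K e * (n + 1 : ℕ) / 2) (n + 1) (j e - j' e) (j' e - j e)) p p').re := by
    intro p p' j j' hj hj'
    have h1 : ∀ θ, inner ℝ (gridSpin s t n θ p j) (gridSpin s t n θ p' j') * refWeight s t K n θ =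
        RCLike.re (gridSpin s t n θ p j * (starRingEnd ℂ) (gridSpin s t n θ p' j') *
          (refWeight s t K n θ : ℂ)) := fun θ => by
      rw [real_inner_comm, Complex.inner, RCLike.re_eq_complex_re, Complex.re_mul_ofReal]
    have hint : Integrable (fun θ => gridSpin s t n θ p j *
        (starRingEnd ℂ) (gridSpin s t n θ p' j') * (refWeight s t K n θ : ℂ))
        (unifPi (V ⊕ (E × Fin n))) := by
      refine integrable_of_continuous_bounded (Continuous.mul (Continuous.mul
        (continuous_gridSpin s t n p j)
        (Complex.continuous_conj.comp (continuous_gridSpin s t n p' j')))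
        (Complex.continuous_ofReal.comp (continuous_refWeight s t K n))) 1 fun θ => ?_
      rw [norm_mul, norm_mul, RCLike.norm_conj, norm_gridSpin, norm_gridSpin, Complex.norm_real,
        Real.norm_eq_abs, abs_of_pos (refWeight_pos _ _ _ _ _), one_mul, one_mul]
      exact refWeight_le_one s t hK n θ
    simp only [h1]
    rw [integral_re hint]
    have h2 : ∀ θ, gridSpin s t n θ p j * (starRingEnd ℂ) (gridSpin s t n θ p' j') *
        (refWeight s t K n θ : ℂ) = stepConst K n * (echar 1 (θ (Sum.inl p) - θ (Sum.inl p')) *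
          ∏ e, ∏ l ∈ Finset.range (n + 1), (echar (insertion (j e) (j' e) l)
            (chainStep n (θ (Sum.inl (s e))) (θ (Sum.inl (t e))) (fun i => θ (Sum.inr (e, i))) l) *
          fser (vonMises (K e * (n + 1 : ℕ) / 2)) (chainStep n (θ (Sum.inl (s e)))
            (θ (Sum.inl (t e))) (fun i => θ (Sum.inr (e, i))) l))) := fun θ => by
      rw [gridSpin_mul_conj s t n θ p p' j j' hj hj', refWeight_eq s t hK]
      simp only [Finset.prod_mul_distrib]
      simp only [refPath, chainStep]
      ring
    simp only [h2]
    rw [integral_const_mul, integral_insertion s t n _ j j' hj hj', RCLike.re_eq_complex_re,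
      Complex.re_ofReal_mul]
  rw [gibbsMean_eq, key p p' j j' hj hj']
  have h0 := key p p (fun _ => 0) (fun _ => 0) (fun _ => Nat.zero_le _) fun _ => Nat.zero_le _
  simp only [real_inner_self_eq_norm_sq, norm_gridSpin, one_pow, one_mul, Nat.sub_self] at h0
  rw [h0]
  exact mul_div_mul_left _ _ (stepConst_pos hK n).ne'

/-! ### Limit of the grid correlations -/

/-- The limits of the Fourier coefficients: with an edge of coupling zero there is no interaction. -/
def edgeLimit₀ (κ δ : ℝ) (k : ℤ) : ℝ := if κ = 0 then (if k = 0 then 1 else 0) else edgeLimit κ δ k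

/-- A summable bound for the Fourier coefficients of the edges. -/
def edgeBound (κ : ℝ) (k : ℤ) : ℝ :=
  if κ = 0 then (if k = 0 then 1 else 0) else
    vonMisesBound (2 / (3 * κ)) k + vonMisesBound (2 / (3 * κ)) (k - 1) +
      vonMisesBound (2 / (3 * κ)) (k + 1)

lemma summable_edgeBound {κ : ℝ} (hκ : 0 ≤ κ) : Summable (edgeBound κ) := by
  unfold edgeBound
  split_ifs with h
  · exact (hasSum_ite_eq 0 1).summable
  · have hs := summable_vonMisesBound (A := 2 / (3 * κ)) (by positivity)
    exact (hs.add (summable_shift hs 1)).add (by simpa using summable_shift hs (-1))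

lemma abs_edgeCoeff_le_edgeBound {κ : ℝ} (hκ : 0 ≤ κ) {N a b : ℕ} (hN : 0 < N) (hab : a + b ≤ N)
    (h0 : κ = 0 → a = 0 ∧ b = 0) (k : ℤ) :
    |edgeCoeff (κ * N / 2) N a b k| ≤ edgeBound κ k := by
  have hN' : (0 : ℝ) < N := by exact_mod_cast hN
  rw [edgeBound]
  split_ifs with h hk
  · rw [(h0 h).1, (h0 h).2, edgeCoeff, h, zero_mul, zero_div, hk]
    simp [vonMises_zero_left]
  · rw [(h0 h).1, (h0 h).2, edgeCoeff, h, zero_mul, zero_div]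
    simp [vonMises_zero_left, hk, hN.ne']
  · have hκ' : 0 < κ := lt_of_le_of_ne hκ (Ne.symm h)
    -- The constant A = 2/(3κ) in `edgeBound` is chosen so that 3A · κN/2 = N.
    exact abs_edgeCoeff_le (by positivity) (by positivity) hab (by field_simp; rfl) k

/-- At coupling zero the step coefficients are already the indicator of k = 0, provided that nothing
is inserted on the edge. Admitting this case makes deleting an edge a special case of lowering a
coupling. -/
lemma tendsto_edgeCoeff₀ {κ : ℝ} (hκ : 0 ≤ κ) (k : ℤ) {ι : Type*} {L : Filter ι}
    {N j j' : ι → ℕ} (hN : Tendsto N L atTop) (hj : ∀ i, j i ≤ N i) (hj' : ∀ i, j' i ≤ N i)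
    (h0 : κ = 0 → ∀ i, j i = 0 ∧ j' i = 0)
    {σ τ : ℝ} (hσ : Tendsto (fun i => (j i : ℝ) / N i) L (𝓝 σ))
    (hτ : Tendsto (fun i => (j' i : ℝ) / N i) L (𝓝 τ)) :
    Tendsto (fun i => edgeCoeff (κ * N i / 2) (N i) (j i - j' i) (j' i - j i) k) L
      (𝓝 (edgeLimit₀ κ (σ - τ) k)) := by
  by_cases h : κ = 0
  · have : edgeLimit₀ κ (σ - τ) k = if k = 0 then 1 else 0 := by simp [edgeLimit₀, h]
    rw [this]
    refine Tendsto.congr' ?_ tendsto_const_nhds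
    filter_upwards [hN.eventually (eventually_gt_atTop 0)] with i hi
    rw [edgeCoeff, (h0 h i).1, (h0 h i).2, h, zero_mul, zero_div]
    split_ifs with hk <;> simp [vonMises_zero_left, hk, hi.ne']
  · have : edgeLimit₀ κ (σ - τ) k = edgeLimit κ (σ - τ) k := by simp [edgeLimit₀, h]
    rw [this]
    exact tendsto_edgeCoeff (lt_of_le_of_ne hκ (Ne.symm h)) k hN hj hj' hσ hτ

lemma tendsto_edgeMean_edgeCoeff {V E : Type*} [Fintype V] [Fintype E] (s t : E → V) {K : E → ℝ}
    (hK : ∀ e, 0 ≤ K e) {ι : Type*} {L : Filter ι} [L.IsCountablyGenerated]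
    {N : ι → ℕ} {j j' : ι → E → ℕ} (hN : Tendsto N L atTop)
    (hj : ∀ i e, j i e ≤ N i) (hj' : ∀ i e, j' i e ≤ N i)
    (h0 : ∀ e, K e = 0 → ∀ i, j i e = 0 ∧ j' i e = 0) {σ τ : E → ℝ}
    (hσ : ∀ e, Tendsto (fun i => (j i e : ℝ) / N i) L (𝓝 (σ e)))
    (hτ : ∀ e, Tendsto (fun i => (j' i e : ℝ) / N i) L (𝓝 (τ e))) (p p' : V) :
    Tendsto (fun i => (edgeMean s t (fun e => edgeCoeff (K e * N i / 2) (N i)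
        (j i e - j' i e) (j' i e - j i e)) p p').re) L
      (𝓝 (edgeMean s t (fun e => edgeLimit₀ (K e) (σ e - τ e)) p p').re) := by
  refine (Complex.continuous_re.tendsto _).comp
    (tendsto_edgeMean s t (fun e => summable_edgeBound (hK e)) (fun e => ?_)
      (fun e k => tendsto_edgeCoeff₀ (hK e) k hN (fun i => hj i e) (fun i => hj' i e) (h0 e)
        (hσ e) (hτ e)) p p')
  filter_upwards [hN.eventually (eventually_gt_atTop 0)] with i hi k
  refine abs_edgeCoeff_le_edgeBound (hK e) hi ?_ (fun h => ?_) k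
  · have := hj i e; have := hj' i e; omega
  · rw [(h0 e h i).1, (h0 e h i).2]; simp

/-- The limiting two-point function. -/
def limitCorr {V E : Type*} [Fintype V] [Fintype E] (s t : E → V) (K : E → ℝ) (p p' : V)
    (σ τ : E → ℝ) : ℝ :=
  (edgeMean s t (fun e => edgeLimit₀ (K e) (σ e - τ e)) p p').re /
    (edgeMean s t (fun e => edgeLimit₀ (K e) 0) p p).re

/-! ### The XY two-point function on the metric graph -/

/-- Positivity and linearity of the Gibbs mean. The bound has this shape because mean square spin
increments are affine in two-point functions; `a` and `b` will belong to the two points. -/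
lemma gibbsMean_abs_sub_le {ι : Type u} [Fintype ι] {w f g a b : (ι → ℝ) → ℝ} (hw : Continuous w)
    (hw0 : ∀ θ, 0 < w θ) (hw1 : ∀ θ, w θ ≤ 1) {C : ℝ}
    (hf : Measurable f) (hfC : ∀ θ, |f θ| ≤ C) (hg : Measurable g) (hgC : ∀ θ, |g θ| ≤ C)
    (ha : Measurable a) (haC : ∀ θ, |a θ| ≤ C) (hb : Measurable b) (hbC : ∀ θ, |b θ| ≤ C)
    {c₀ c₁ : ℝ} (h : ∀ θ, |f θ - g θ| ≤ c₀ - c₁ * a θ - c₁ * b θ) :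
    |gibbsMean w f - gibbsMean w g| ≤ c₀ - c₁ * gibbsMean w a - c₁ * gibbsMean w b := by
  have hi : ∀ f : (ι → ℝ) → ℝ, Measurable f → (∀ θ, |f θ| ≤ C) →
      Integrable (fun θ => f θ * w θ) (unifPi ι) := fun f hf hC => by
    refine Integrable.of_bound (hf.mul hw.measurable).aestronglyMeasurable C
      (Eventually.of_forall fun θ => ?_)
    rw [norm_mul, Real.norm_eq_abs, Real.norm_eq_abs, abs_of_pos (hw0 θ)]
    exact (mul_le_of_le_one_right (abs_nonneg _) (hw1 θ)).trans (hC θ)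
  have hwi : Integrable w (unifPi ι) := integrable_of_continuous_bounded hw 1 fun θ => by
    rw [Real.norm_eq_abs, abs_of_pos (hw0 θ)]; exact hw1 θ
  have hZ : 0 < ∫ θ, w θ ∂unifPi ι := by
    rw [integral_pos_iff_support_of_nonneg (fun θ => (hw0 θ).le) hwi]
    have : Function.support w = Set.univ := Set.eq_univ_of_forall fun θ => (hw0 θ).ne'
    rw [this]
    simp
  have hfi := hi f hf hfC
  have hgi := hi g hg hgC
  have hai := hi a ha haC
  have hbi := hi b hb hbC
  rw [gibbsMean_eq, gibbsMean_eq, gibbsMean_eq, gibbsMean_eq, ← sub_div, abs_div, abs_of_pos hZ,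
    div_le_iff₀ hZ]
  have hwa : Integrable (fun θ => c₀ * w θ - c₁ * (a θ * w θ)) (unifPi ι) :=
    (hwi.const_mul _).sub (hai.const_mul _)
  have e : (c₀ - c₁ * ((∫ θ, a θ * w θ ∂unifPi ι) / ∫ θ, w θ ∂unifPi ι) -
      c₁ * ((∫ θ, b θ * w θ ∂unifPi ι) / ∫ θ, w θ ∂unifPi ι)) * ∫ θ, w θ ∂unifPi ι =
      ∫ θ, (c₀ * w θ - c₁ * (a θ * w θ) - c₁ * (b θ * w θ)) ∂unifPi ι := by
    rw [integral_sub hwa (hbi.const_mul _),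
      integral_sub (hwi.const_mul _) (hai.const_mul _), integral_const_mul, integral_const_mul,
      integral_const_mul]
    field_simp
  rw [e, ← integral_sub hfi hgi]
  refine (abs_integral_le_integral_abs).trans (integral_mono (hfi.sub hgi).abs
    (((hwi.const_mul _).sub (hai.const_mul _)).sub (hbi.const_mul _)) fun θ => ?_)
  simp only [← sub_mul, abs_mul, abs_of_pos (hw0 θ)]
  calc |f θ - g θ| * w θ ≤ (c₀ - c₁ * a θ - c₁ * b θ) * w θ :=
        mul_le_mul_of_nonneg_right (h θ) (hw0 θ).le
    _ = _ := by ring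

/-- The vertex from which the position of a point is measured. -/
def ptBase {V E : Type*} (s : E → V) : V ⊕ (E × unitInterval) → V := Sum.elim id fun p => s p.1

/-- The coordinates of a point along all edges. -/
def ptPos {V E : Type*} [DecidableEq E] : V ⊕ (E × unitInterval) → E → ℝ :=
  Sum.elim (fun _ => 0) fun p => Pi.single p.1 (p.2 : ℝ)

/-- The last site before a point. -/
def ptGrid {V E : Type*} [DecidableEq E] (N : ℕ) : V ⊕ (E × unitInterval) → E → ℕ :=
  Sum.elim (fun _ _ => 0) fun p => Pi.single p.1 ⌊(N : ℝ) * p.2⌋₊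

/-- The first site after a point. -/
def ptNext {V E : Type*} [DecidableEq E] (N : ℕ) : V ⊕ (E × unitInterval) → E → ℕ :=
  Sum.elim (fun _ _ => 0) fun p => Pi.single p.1 (min N (⌊(N : ℝ) * p.2⌋₊ + 1))

lemma floor_mul_le (N : ℕ) (t : unitInterval) : ⌊(N : ℝ) * t⌋₊ ≤ N :=
  Nat.floor_le_of_le (mul_le_of_le_one_right (Nat.cast_nonneg _) t.2.2)

lemma ptGrid_le {V E : Type*} [DecidableEq E] (N : ℕ) (x : V ⊕ (E × unitInterval)) (e : E) :
    ptGrid N x e ≤ N := by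
  rcases x with v | ⟨e', t⟩
  · exact Nat.zero_le _
  · simp only [ptGrid, Sum.elim_inr, Pi.single_apply]
    split_ifs
    exacts [floor_mul_le N t, Nat.zero_le _]

lemma ptNext_le {V E : Type*} [DecidableEq E] (N : ℕ) (x : V ⊕ (E × unitInterval)) (e : E) :
    ptNext N x e ≤ N := by
  rcases x with v | ⟨e', t⟩
  · exact Nat.zero_le _
  · simp only [ptNext, Sum.elim_inr, Pi.single_apply]
    split_ifs
    exacts [min_le_left _ _, Nat.zero_le _]

lemma abs_ptGrid_sub_le {V E : Type*} [DecidableEq E] {N : ℕ} (hN : 0 < N)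
    (x : V ⊕ (E × unitInterval)) (e : E) : |(ptGrid N x e : ℝ) / N - ptPos x e| ≤ 1 / N := by
  have hN' : (0 : ℝ) < N := by exact_mod_cast hN
  rcases x with v | ⟨e', t⟩
  · simp [ptGrid, ptPos]
  · simp only [ptGrid, ptPos, Sum.elim_inr, Pi.single_apply]
    split_ifs
    · have h1 := Nat.floor_le (mul_nonneg hN'.le t.2.1)
      have h2 := Nat.lt_floor_add_one ((N : ℝ) * t)
      have : (⌊(N : ℝ) * t⌋₊ : ℝ) / N - t = (⌊(N : ℝ) * t⌋₊ - N * t) / N := by field_simp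
      rw [this, abs_div, abs_of_pos hN']
      gcongr
      rw [abs_le]
      constructor <;> linarith
    · simp

lemma abs_ptNext_sub_le {V E : Type*} [DecidableEq E] {N : ℕ} (hN : 0 < N)
    (x : V ⊕ (E × unitInterval)) (e : E) : |(ptNext N x e : ℝ) / N - ptPos x e| ≤ 1 / N := by
  have hN' : (0 : ℝ) < N := by exact_mod_cast hN
  rcases x with v | ⟨e', t⟩
  · simp [ptNext, ptPos]
  · simp only [ptNext, ptPos, Sum.elim_inr, Pi.single_apply]
    split_ifs
    · have h1 := Nat.floor_le (mul_nonneg hN'.le t.2.1)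
      have h2 := Nat.lt_floor_add_one ((N : ℝ) * t)
      have h3 : (N : ℝ) * t ≤ N := mul_le_of_le_one_right hN'.le t.2.2
      have : ((min N (⌊(N : ℝ) * t⌋₊ + 1) : ℕ) : ℝ) / N - t =
          (min (N : ℝ) (⌊(N : ℝ) * t⌋₊ + 1) - N * t) / N := by push_cast; field_simp
      rw [this, abs_div, abs_of_pos hN']
      gcongr
      rw [abs_le]
      constructor
      · have : (N : ℝ) * t ≤ min (N : ℝ) (⌊(N : ℝ) * t⌋₊ + 1) := le_min h3 h2.le
        linarith
      · have : min (N : ℝ) (⌊(N : ℝ) * t⌋₊ + 1) ≤ ⌊(N : ℝ) * t⌋₊ + 1 := min_le_right _ _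
        linarith
    · simp

/-- The interpolated spin of the XY model with `n` new sites per edge. -/
def refSpin {V E : Type*} (s t : E → V) (n : ℕ) (θ : V ⊕ (E × Fin n) → ℝ) :
    V ⊕ (E × unitInterval) → ℂ :=
  Sum.elim (fun v => spin (θ (Sum.inl v))) fun p =>
    spin (refPath s t n θ p.1 ⌊((n + 1 : ℕ) : ℝ) * p.2⌋₊) *
      spin ((((n + 1 : ℕ) : ℝ) * p.2 - ⌊((n + 1 : ℕ) : ℝ) * p.2⌋₊) * Complex.arg
        (spin (refPath s t n θ p.1 (⌊((n + 1 : ℕ) : ℝ) * p.2⌋₊ + 1)) /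
          spin (refPath s t n θ p.1 ⌊((n + 1 : ℕ) : ℝ) * p.2⌋₊)))

lemma measurable_refSpin {V E : Type*} (s t : E → V) (n : ℕ) (x : V ⊕ (E × unitInterval)) :
    Measurable fun θ : V ⊕ (E × Fin n) → ℝ => refSpin s t n θ x := by
  have hs : ∀ e l, Measurable fun θ : V ⊕ (E × Fin n) → ℝ => spin (refPath s t n θ e l) :=
    fun e l => continuous_spin.measurable.comp (by unfold refPath chainPath; split_ifs <;> fun_prop)
  rcases x with v | ⟨e, τ⟩
  · exact continuous_spin.measurable.comp (by fun_prop)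
  · exact (hs _ _).mul (continuous_spin.measurable.comp
      ((Complex.measurable_arg.comp ((hs _ _).div (hs _ _))).const_mul _))

lemma norm_refSpin {V E : Type*} (s t : E → V) (n : ℕ) (θ : V ⊕ (E × Fin n) → ℝ)
    (x : V ⊕ (E × unitInterval)) : ‖refSpin s t n θ x‖ = 1 := by
  rcases x with v | ⟨e, τ⟩ <;> simp [refSpin, norm_spin]

lemma norm_spin_sub_one_le (φ : ℝ) : ‖spin φ - 1‖ ≤ |φ| := by
  have := Real.norm_exp_I_mul_ofReal_sub_one_le (x := φ)
  rwa [mul_comm] at this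

/-- The interpolated spin lies on the shorter arc between its neighbors, and the length of that arc
is at most π/2 times its chord. -/
lemma norm_refSpin_sub_le {V E : Type*} [Fintype E] [DecidableEq E] (s t : E → V) (n : ℕ)
    (θ : V ⊕ (E × Fin n) → ℝ) (x : V ⊕ (E × unitInterval)) :
    ‖refSpin s t n θ x - gridSpin s t n θ (ptBase s x) (ptGrid (n + 1) x)‖ ≤
      π / 2 * ‖gridSpin s t n θ (ptBase s x) (ptNext (n + 1) x) -
        gridSpin s t n θ (ptBase s x) (ptGrid (n + 1) x)‖ := by
  rcases x with v | ⟨e, τ⟩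
  · change ‖spin _ - gridSpin s t n θ v (fun _ => 0)‖ ≤ _
    rw [gridSpin_zero, sub_self, norm_zero]
    positivity
  · simp only [refSpin, ptBase, ptGrid, ptNext, Sum.elim_inr, gridSpin_single]
    set N : ℕ := n + 1
    set m := ⌊(N : ℝ) * τ⌋₊
    have hm : m ≤ n + 1 := floor_mul_le N τ
    -- At t = 1 the last site is already the end vertex. All indices beyond N denote that vertex as
    -- well, so truncating at N does not change the spin.
    have hnext : refPath s t n θ e (min N (m + 1)) = refPath s t n θ e (m + 1) := by
      rcases le_total N (m + 1) with h | h
      · rw [min_eq_left h, refPath, refPath, chainPath, chainPath, if_neg (by omega),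
          dif_neg (by omega), if_neg (by omega), dif_neg (by omega)]
      · rw [min_eq_right h]
    rw [hnext]
    set a := spin (refPath s t n θ e m) with ha
    set b := spin (refPath s t n θ e (m + 1)) with hb
    have ha1 : ‖a‖ = 1 := norm_spin _
    have hb1 : ‖b‖ = 1 := norm_spin _
    have h1 : a * spin (((N : ℝ) * τ - m) * Complex.arg (b / a)) - a =
        a * (spin (((N : ℝ) * τ - m) * Complex.arg (b / a)) - 1) := by ring
    have h2 : 0 ≤ (N : ℝ) * τ - m :=
      sub_nonneg.2 (Nat.floor_le (mul_nonneg (Nat.cast_nonneg _) τ.2.1))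
    have h3 : (N : ℝ) * τ - m ≤ 1 := by
      have := Nat.lt_floor_add_one ((N : ℝ) * τ)
      linarith
    rw [h1, norm_mul, ha1, one_mul]
    refine (norm_spin_sub_one_le _).trans ?_
    rw [abs_mul, abs_of_nonneg h2]
    have ha0 : a ≠ 0 := fun h => by simp [h] at ha1
    have hb0 : b ≠ 0 := fun h => by simp [h] at hb1
    have h4 := Complex.angle_le_mul_norm_sub hb1 ha1
    rw [Complex.angle_eq_abs_arg hb0 ha0] at h4
    exact (mul_le_of_le_one_left (abs_nonneg _) h3).trans h4

/-- The two-point function of grid spins. -/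
def gridCorr {V E : Type u} [Fintype V] [Fintype E] (s t : E → V) (K : E → ℝ) (n : ℕ) (p p' : V)
    (j j' : E → ℕ) : ℝ :=
  gibbsMean (refWeight s t K n)
    (fun θ => inner ℝ (gridSpin s t n θ p j) (gridSpin s t n θ p' j'))

lemma tendsto_gridCorr {V E : Type u} [Fintype V] [Fintype E] (s t : E → V) {K : E → ℝ}
    (hK : ∀ e, 0 ≤ K e) {ι : Type*} {L : Filter ι} [L.IsCountablyGenerated]
    {n : ι → ℕ} {j j' : ι → E → ℕ} (hn : Tendsto n L atTop)
    (hj : ∀ i e, j i e ≤ n i + 1) (hj' : ∀ i e, j' i e ≤ n i + 1)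
    (h0 : ∀ e, K e = 0 → ∀ i, j i e = 0 ∧ j' i e = 0) {σ τ : E → ℝ}
    (hσ : ∀ e, Tendsto (fun i => (j i e : ℝ) / (n i + 1 : ℕ)) L (𝓝 (σ e)))
    (hτ : ∀ e, Tendsto (fun i => (j' i e : ℝ) / (n i + 1 : ℕ)) L (𝓝 (τ e))) (p p' : V)
    (hpos : (edgeMean s t (fun e => edgeLimit₀ (K e) 0) p p).re ≠ 0) :
    Tendsto (fun i => gridCorr s t K (n i) p p' (j i) (j' i)) L
      (𝓝 (limitCorr s t K p p' σ τ)) := by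
  simp only [gridCorr, gibbsMean_gridSpin s t hK _ p p' _ _ (hj _) (hj' _)]
  have hN : Tendsto (fun i => n i + 1) L atTop := (tendsto_add_atTop_nat 1).comp hn
  refine (tendsto_edgeMean_edgeCoeff s t hK hN hj hj' h0 hσ hτ p p').div ?_ hpos
  have h := tendsto_edgeMean_edgeCoeff s t hK hN (j := fun _ _ => 0) (j' := fun _ _ => 0)
    (fun _ _ => Nat.zero_le _) (fun _ _ => Nat.zero_le _) (fun _ _ _ => ⟨rfl, rfl⟩)
    (σ := fun _ => 0) (τ := fun _ => 0) (fun e => by simpa using tendsto_const_nhds)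
    (fun e => by simpa using tendsto_const_nhds) p p
  simpa using h

lemma limitCorr_self {V E : Type*} [Fintype V] [Fintype E] (s t : E → V) (K : E → ℝ) (p : V)
    (σ : E → ℝ) (hpos : (edgeMean s t (fun e => edgeLimit₀ (K e) 0) p p).re ≠ 0) :
    limitCorr s t K p p σ σ = 1 := by
  simp only [limitCorr, sub_self]
  exact div_self hpos

/-- The two-point function of the interpolated XY model. -/
def refCorr {V E : Type u} [Fintype V] [Fintype E] (s t : E → V) (K : E → ℝ) (n : ℕ)
    (x y : V ⊕ (E × unitInterval)) : ℝ :=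
  gibbsMean (refWeight s t K n) fun θ => inner ℝ (refSpin s t n θ x) (refSpin s t n θ y)

lemma abs_inner_sub_inner_le {a b c d : ℂ} (ha : ‖a‖ = 1) (hd : ‖d‖ = 1) :
    |inner ℝ a b - inner ℝ c d| ≤ ‖a - c‖ + ‖b - d‖ := by
  have h : inner ℝ a b - inner ℝ c d = inner ℝ a (b - d) + inner ℝ (a - c) d := by
    rw [inner_sub_right, inner_sub_left]; ring
  rw [h]
  have h1 := abs_real_inner_le_norm a (b - d)
  have h2 := abs_real_inner_le_norm (a - c) d
  rw [ha, one_mul] at h1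
  rw [hd, mul_one] at h2
  exact (abs_add_le _ _).trans (by linarith)

/-- The chord u between neighboring spins satisfies u ≤ ε + u²/ε and u² = 2 - 2 σ·σ', which makes
the interpolation bound affine in the two-point function of the neighboring sites. The two points
contribute separately. -/
lemma abs_refCorr_sub_gridCorr_le {V E : Type u} [Fintype V] [Fintype E] [DecidableEq E]
    (s t : E → V) {K : E → ℝ} (hK : ∀ e, 0 ≤ K e) (n : ℕ) (x y : V ⊕ (E × unitInterval))
    {ε : ℝ} (hε : 0 < ε) :
    |refCorr s t K n x y -
      gridCorr s t K n (ptBase s x) (ptBase s y) (ptGrid (n + 1) x) (ptGrid (n + 1) y)| ≤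
      π / 2 * (2 * ε + 4 / ε) - π / ε * gridCorr s t K n (ptBase s x) (ptBase s x)
        (ptNext (n + 1) x) (ptGrid (n + 1) x) - π / ε * gridCorr s t K n (ptBase s y) (ptBase s y)
        (ptNext (n + 1) y) (ptGrid (n + 1) y) := by
  have hgm : ∀ p p' j j', Measurable fun θ : V ⊕ (E × Fin n) → ℝ =>
      inner ℝ (gridSpin s t n θ p j) (gridSpin s t n θ p' j') := fun p p' j j' =>
    ((continuous_gridSpin s t n p j).inner (continuous_gridSpin s t n p' j')).measurable
  have hgb : ∀ p p' j j', ∀ θ : V ⊕ (E × Fin n) → ℝ,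
      |inner ℝ (gridSpin s t n θ p j) (gridSpin s t n θ p' j')| ≤ 1 := fun p p' j j' θ =>
    (abs_real_inner_le_norm _ _).trans (by rw [norm_gridSpin, norm_gridSpin, one_mul])
  refine gibbsMean_abs_sub_le (continuous_refWeight s t K n) (refWeight_pos s t K n)
    (refWeight_le_one s t hK n) (C := 1) ?_ ?_ (hgm _ _ _ _) (hgb _ _ _ _) (hgm _ _ _ _)
    (hgb _ _ _ _) (hgm _ _ _ _) (hgb _ _ _ _) fun θ => ?_
  · exact (measurable_refSpin s t n x).inner (measurable_refSpin s t n y)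
  · intro θ
    exact (abs_real_inner_le_norm _ _).trans (by rw [norm_refSpin, norm_refSpin, one_mul])
  · have hsq : ∀ z : V ⊕ (E × unitInterval), ‖refSpin s t n θ z -
        gridSpin s t n θ (ptBase s z) (ptGrid (n + 1) z)‖ ≤ π / 2 * (ε + 2 / ε) -
        π / ε * inner ℝ (gridSpin s t n θ (ptBase s z) (ptNext (n + 1) z))
          (gridSpin s t n θ (ptBase s z) (ptGrid (n + 1) z)) := by
      intro z
      refine (norm_refSpin_sub_le s t n θ z).trans ?_
      have h1 := norm_sub_sq_real (gridSpin s t n θ (ptBase s z) (ptNext (n + 1) z))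
        (gridSpin s t n θ (ptBase s z) (ptGrid (n + 1) z))
      rw [norm_gridSpin, norm_gridSpin] at h1
      set u := ‖gridSpin s t n θ (ptBase s z) (ptNext (n + 1) z) -
        gridSpin s t n θ (ptBase s z) (ptGrid (n + 1) z)‖
      have h2 : u ≤ ε + u ^ 2 / ε := by
        have : ε + u ^ 2 / ε - u = ((ε - u / 2) ^ 2 + 3 / 4 * u ^ 2) / ε := by field_simp; ring
        have : 0 ≤ ε + u ^ 2 / ε - u := by rw [this]; positivity
        linarith
      have h3 := mul_le_mul_of_nonneg_left h2 (by positivity : 0 ≤ π / 2)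
      rw [h1] at h3
      refine h3.trans (le_of_eq ?_)
      field_simp
      ring
    refine (abs_inner_sub_inner_le (norm_refSpin _ _ _ _ _) (norm_gridSpin _ _ _ _ _ _)).trans ?_
    have hx := hsq x
    have hy := hsq y
    have e : π / 2 * (2 * ε + 4 / ε) = π / 2 * (ε + 2 / ε) + π / 2 * (ε + 2 / ε) := by
      field_simp; ring
    rw [e]
    linarith

lemma continuous_ptBase {V E : Type*} [TopologicalSpace V] [TopologicalSpace E]
    [DiscreteTopology E] (s : E → V) : Continuous (ptBase s) :=
  continuous_sum_dom.2 ⟨continuous_id,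
    (continuous_of_discreteTopology (f := s)).comp (continuous_fst (X := E) (Y := unitInterval))⟩

lemma continuous_ptPos {V E : Type*} [TopologicalSpace V] [TopologicalSpace E]
    [DiscreteTopology E] [DecidableEq E] (e : E) :
    Continuous fun x : V ⊕ (E × unitInterval) => ptPos x e := by
  refine continuous_sum_dom.2 ⟨continuous_const, continuous_prod_of_discrete_left.2 fun e' => ?_⟩
  simp only [ptPos, Function.comp, Sum.elim_inr, Pi.single_apply]
  split_ifs <;> fun_prop

/-- The base vertex is locally constant in the point and the coordinates are continuous, so the
sites before and after a moving point have rescaled positions with the same limit. The grid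
correlation therefore converges, and the correlation of the two neighboring sites tends to one,
which makes the interpolation error small. -/
theorem tendsto_refCorr {V E : Type u} [Fintype V] [Fintype E] [DecidableEq E]
    [TopologicalSpace V] [DiscreteTopology V] [TopologicalSpace E] [DiscreteTopology E]
    (s t : E → V) {K : E → ℝ} (hK : ∀ e, 0 < K e)
    (hpos : ∀ p, (edgeMean s t (fun e => edgeLimit₀ (K e) 0) p p).re ≠ 0)
    (x₀ y₀ : V ⊕ (E × unitInterval)) :
    Tendsto (fun q : ℕ × (V ⊕ (E × unitInterval)) × (V ⊕ (E × unitInterval)) =>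
        refCorr s t K q.1 q.2.1 q.2.2) (atTop ×ˢ 𝓝 (x₀, y₀))
      (𝓝 (limitCorr s t K (ptBase s x₀) (ptBase s y₀) (ptPos x₀) (ptPos y₀))) := by
  have hfst : Tendsto Prod.fst ((atTop : Filter ℕ) ×ˢ 𝓝 (x₀, y₀)) atTop := tendsto_fst
  have hsnd : Tendsto (fun q : ℕ × (V ⊕ (E × unitInterval)) × (V ⊕ (E × unitInterval)) => q.2)
    ((atTop : Filter ℕ) ×ˢ 𝓝 (x₀, y₀)) (𝓝 (x₀, y₀)) := tendsto_snd
  have hx := (continuous_fst.tendsto (x₀, y₀)).comp hsnd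
  have hy := (continuous_snd.tendsto (x₀, y₀)).comp hsnd
  have hbx : ∀ᶠ q in (atTop : Filter ℕ) ×ˢ 𝓝 (x₀, y₀), ptBase s q.2.1 = ptBase s x₀ :=
    (((continuous_ptBase s).tendsto x₀).comp hx).eventually (p := fun v => v = ptBase s x₀)
      (by rw [nhds_discrete]; exact eventually_pure.2 rfl)
  have hby : ∀ᶠ q in (atTop : Filter ℕ) ×ˢ 𝓝 (x₀, y₀), ptBase s q.2.2 = ptBase s y₀ :=
    (((continuous_ptBase s).tendsto y₀).comp hy).eventually (p := fun v => v = ptBase s y₀)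
      (by rw [nhds_discrete]; exact eventually_pure.2 rfl)
  have hinv : Tendsto (fun q : ℕ × (V ⊕ (E × unitInterval)) × (V ⊕ (E × unitInterval)) =>
      1 / ((q.1 + 1 : ℕ) : ℝ)) ((atTop : Filter ℕ) ×ˢ 𝓝 (x₀, y₀)) (𝓝 0) := by
    have := tendsto_one_div_add_atTop_nhds_zero_nat (𝕜 := ℝ)
    refine (this.comp hfst).congr fun q => ?_
    simp
  have hlim : ∀ {f : ℕ × (V ⊕ (E × unitInterval)) × (V ⊕ (E × unitInterval)) → ℝ}
      {z : ℕ × (V ⊕ (E × unitInterval)) × (V ⊕ (E × unitInterval)) → V ⊕ (E × unitInterval)} {z₀}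
      (e : E), Tendsto z ((atTop : Filter ℕ) ×ˢ 𝓝 (x₀, y₀)) (𝓝 z₀) →
      (∀ q, |f q - ptPos (z q) e| ≤ 1 / ((q.1 + 1 : ℕ) : ℝ)) →
      Tendsto f ((atTop : Filter ℕ) ×ˢ 𝓝 (x₀, y₀)) (𝓝 (ptPos z₀ e)) := by
    intro f z z₀ e hz hf
    refine tendsto_of_tendsto_of_dist (((continuous_ptPos e).tendsto z₀).comp hz)
      (squeeze_zero (fun _ => dist_nonneg) (fun q => ?_) hinv)
    rw [dist_comm, Real.dist_eq]
    exact hf q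
  have h0 : ∀ (j j' : ℕ × (V ⊕ (E × unitInterval)) × (V ⊕ (E × unitInterval)) → E → ℕ) (e : E),
      K e = 0 → ∀ i, j i e = 0 ∧ j' i e = 0 := fun _ _ e he => absurd he (hK e).ne'
  have T1 := tendsto_gridCorr s t (fun e => (hK e).le) hfst (fun q => ptGrid_le (q.1 + 1) q.2.1)
    (fun q => ptGrid_le (q.1 + 1) q.2.2) (h0 _ _)
    (fun e => hlim e hx fun q => abs_ptGrid_sub_le (Nat.succ_pos _) _ _)
    (fun e => hlim e hy fun q => abs_ptGrid_sub_le (Nat.succ_pos _) _ _)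
    (ptBase s x₀) (ptBase s y₀) (hpos _)
  have T2 := tendsto_gridCorr s t (fun e => (hK e).le) hfst (fun q => ptNext_le (q.1 + 1) q.2.1)
    (fun q => ptGrid_le (q.1 + 1) q.2.1) (h0 _ _)
    (fun e => hlim e hx fun q => abs_ptNext_sub_le (Nat.succ_pos _) _ _)
    (fun e => hlim e hx fun q => abs_ptGrid_sub_le (Nat.succ_pos _) _ _)
    (ptBase s x₀) (ptBase s x₀) (hpos _)
  have T3 := tendsto_gridCorr s t (fun e => (hK e).le) hfst (fun q => ptNext_le (q.1 + 1) q.2.2)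
    (fun q => ptGrid_le (q.1 + 1) q.2.2) (h0 _ _)
    (fun e => hlim e hy fun q => abs_ptNext_sub_le (Nat.succ_pos _) _ _)
    (fun e => hlim e hy fun q => abs_ptGrid_sub_le (Nat.succ_pos _) _ _)
    (ptBase s y₀) (ptBase s y₀) (hpos _)
  rw [limitCorr_self s t K _ _ (hpos _)] at T2 T3
  refine tendsto_of_tendsto_of_dist T1 (Metric.tendsto_nhds.2 fun δ hδ => ?_)
  -- When both neighbor correlations tend to one, the error bound tends to πε, which is δ/2 for this
  -- choice.
  set ε : ℝ := δ / (2 * π) with hε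
  have hε0 : 0 < ε := by positivity
  have hB := (((T2.const_mul (π / ε)).const_sub (π / 2 * (2 * ε + 4 / ε))).sub
    (T3.const_mul (π / ε))).eventually_lt_const (u := δ) (by
      have : π / 2 * (2 * ε + 4 / ε) - π / ε * 1 - π / ε * 1 = π * ε := by field_simp; ring
      rw [this, hε]
      field_simp
      norm_num)
  filter_upwards [hB, hbx, hby] with q hq hqx hqy
  rw [dist_zero_right, Real.norm_eq_abs, abs_of_nonneg dist_nonneg, dist_comm, Real.dist_eq]
  have h := abs_refCorr_sub_gridCorr_le s t (fun e => (hK e).le) q.1 q.2.1 q.2.2 hε0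
  rw [hqx, hqy] at h
  exact h.trans_lt hq

/-! ### Poisson summation for one edge -/

/-- Poisson summation for a Gaussian with the linear term (δ/κ + iφ)k. The imaginary part moves the
dual lattice to φ + 2πn (after n ↦ -n). The real part makes the square complex, and expanding it
yields the phase exp(iδ(φ + 2πn)) and a factor exp(δ²/(2κ)), which joins exp(-|δ|/(2κ)). -/
lemma fser_edgeLimit {κ : ℝ} (hκ : 0 < κ) (δ φ : ℝ) :
    fser (edgeLimit κ δ) φ = (√(2 * π * κ) * Real.exp (-((|δ| - δ ^ 2) / (2 * κ))) : ℝ) *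
      ∑' n : ℤ, ((Real.exp (-(κ / 2) * (φ + 2 * π * n) ^ 2) : ℝ) : ℂ) *
        spin (δ * (φ + 2 * π * n)) := by
  have hκ' : (κ : ℂ) ≠ 0 := by exact_mod_cast hκ.ne'
  have hπ : (π : ℂ) ≠ 0 := by exact_mod_cast Real.pi_pos.ne'
  set a : ℂ := ((1 / (2 * π * κ) : ℝ) : ℂ) with ha
  have hare : 0 < a.re := by rw [ha, Complex.ofReal_re]; positivity
  have h := Complex.tsum_exp_neg_quadratic hare ((δ / κ + Complex.I * φ) / (2 * π))
  have hl : ∀ k : ℤ, (edgeLimit κ δ k : ℂ) * echar k φ = Complex.exp (-(|δ| / (2 * κ) : ℝ)) *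
      Complex.exp (-π * a * k ^ 2 + 2 * π * ((δ / κ + Complex.I * φ) / (2 * π)) * k) := fun k => by
    rw [edgeLimit, echar, Complex.ofReal_exp, ← Complex.exp_add, ← Complex.exp_add, ha]
    congr 1
    push_cast
    field_simp
    ring
  have hsq : (1 : ℂ) / a ^ (1 / 2 : ℂ) = (√(2 * π * κ) : ℝ) := by
    have : (1 / 2 : ℂ) = ((1 / 2 : ℝ) : ℂ) := by push_cast; ring
    rw [this, ha, ← Complex.ofReal_cpow (by positivity), Real.sqrt_eq_rpow, one_div (2 * π * κ),
      Real.inv_rpow (by positivity)]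
    push_cast
    rw [one_div, inv_inv]
  have hr : ∀ n : ℤ, Complex.exp (-π / a * ((-n : ℤ) + Complex.I *
      ((δ / κ + Complex.I * φ) / (2 * π))) ^ 2) = Complex.exp ((δ ^ 2 / (2 * κ) : ℝ)) *
      (((Real.exp (-(κ / 2) * (φ + 2 * π * n) ^ 2) : ℝ) : ℂ) * spin (δ * (φ + 2 * π * n))) := by
    intro n
    rw [spin, Complex.ofReal_exp, ← Complex.exp_add, ← Complex.exp_add, ha]
    congr 1
    have e : ((-n : ℤ) : ℂ) + Complex.I * ((δ / κ + Complex.I * φ) / (2 * π)) =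
        -(φ + 2 * π * n - Complex.I * (δ / κ)) / (2 * π) := by
      field_simp
      push_cast
      linear_combination (φ : ℂ) * κ * Complex.I_sq
    rw [e]
    push_cast
    field_simp
    linear_combination (-(δ : ℂ) ^ 2) * Complex.I_sq
  rw [fser]
  simp only [hl]
  rw [tsum_mul_left, h, hsq, ← (Equiv.neg ℤ).tsum_eq]
  simp only [Equiv.neg_apply, hr]
  rw [tsum_mul_left, ← mul_assoc, ← mul_assoc]
  congr 1
  have : Real.exp (-((|δ| - δ ^ 2) / (2 * κ))) =
      Real.exp (-(|δ| / (2 * κ))) * Real.exp (δ ^ 2 / (2 * κ)) := by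
    rw [← Real.exp_add]; congr 1; ring
  rw [this]
  push_cast
  ring

/-! ### The covariance of the Schauder series -/

/-- The contribution of one level to the covariance of the bridge. -/
def levelCov (n : ℕ) (s t : ℝ) : ℝ := ∑ k ∈ Finset.range (2 ^ n), schauder n k s * schauder n k t

/-- The covariance of the bridge, extended by zero. -/
def bridgeCov (s t : ℝ) : ℝ :=
  min (max 0 (min 1 s)) (max 0 (min 1 t)) - max 0 (min 1 s) * max 0 (min 1 t)

lemma schauder_succ_left (n k : ℕ) (t : ℝ) :
    schauder (n + 1) k t = (√2)⁻¹ * schauder n k (2 * t) := by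
  rw [schauder, schauder, pow_succ, pow_succ, mul_inv]
  ring_nf

lemma schauder_succ_right (n k : ℕ) (t : ℝ) :
    schauder (n + 1) (2 ^ n + k) t = (√2)⁻¹ * schauder n k (2 * t - 1) := by
  rw [schauder, schauder, pow_succ, pow_succ, mul_inv]
  push_cast
  ring_nf

/-- Self-similarity: the tents of level n + 1 on either half of the interval are those of level n
compressed by two and scaled by 1/√2. -/
lemma levelCov_succ (n : ℕ) (s t : ℝ) :
    levelCov (n + 1) s t = (levelCov n (2 * s) (2 * t) + levelCov n (2 * s - 1) (2 * t - 1)) / 2 := by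
  have h2 : (√2)⁻¹ * (√2)⁻¹ = (1 / 2 : ℝ) := by
    rw [← mul_inv, Real.mul_self_sqrt (by norm_num)]; norm_num
  rw [levelCov, pow_succ, mul_two, Finset.sum_range_add, levelCov, levelCov, add_div,
    Finset.sum_div, Finset.sum_div]
  congr 1
  · refine Finset.sum_congr rfl fun k _ => ?_
    rw [schauder_succ_left, schauder_succ_left]
    linear_combination (schauder n k (2 * s) * schauder n k (2 * t)) * h2
  · refine Finset.sum_congr rfl fun k _ => ?_
    rw [schauder_succ_right, schauder_succ_right]
    linear_combination (schauder n k (2 * s - 1) * schauder n k (2 * t - 1)) * h2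

/-- The values, in the four ranges of `s`, of the clamped coordinates and the tent function. -/
lemma clamp_cases (s : ℝ) :
    (s ≤ 0 ∧ max 0 (min 1 s) = 0 ∧ max 0 (min 1 (2 * s)) = 0 ∧ max 0 (min 1 (2 * s - 1)) = 0 ∧
      max 0 (1 / 2 - |s - 1 / 2|) = 0) ∨
    ((0 ≤ s ∧ s ≤ 1 / 2) ∧ max 0 (min 1 s) = s ∧ max 0 (min 1 (2 * s)) = 2 * s ∧
      max 0 (min 1 (2 * s - 1)) = 0 ∧ max 0 (1 / 2 - |s - 1 / 2|) = s) ∨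
    ((1 / 2 ≤ s ∧ s ≤ 1) ∧ max 0 (min 1 s) = s ∧ max 0 (min 1 (2 * s)) = 1 ∧
      max 0 (min 1 (2 * s - 1)) = 2 * s - 1 ∧ max 0 (1 / 2 - |s - 1 / 2|) = 1 - s) ∨
    (1 ≤ s ∧ max 0 (min 1 s) = 1 ∧ max 0 (min 1 (2 * s)) = 1 ∧ max 0 (min 1 (2 * s - 1)) = 1 ∧
      max 0 (1 / 2 - |s - 1 / 2|) = 0) := by
  have c0 : ∀ x : ℝ, x ≤ 0 → max 0 (min 1 x) = 0 := fun x hx =>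
    max_eq_left ((min_le_right _ _).trans hx)
  have c1 : ∀ x : ℝ, 1 ≤ x → max 0 (min 1 x) = 1 := fun x hx => by
    rw [min_eq_left hx, max_eq_right zero_le_one]
  have c2 : ∀ x : ℝ, 0 ≤ x → x ≤ 1 → max 0 (min 1 x) = x := fun x h0 h1 => by
    rw [min_eq_right h1, max_eq_right h0]
  rcases le_total s 0 with h | h
  · refine Or.inl ⟨h, c0 _ h, c0 _ (by linarith), c0 _ (by linarith), max_eq_left ?_⟩
    rw [abs_of_nonpos (by linarith)]; linarith
  rcases le_total s (1 / 2) with h' | h'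
  · refine Or.inr (Or.inl ⟨⟨h, h'⟩, c2 _ h (by linarith), c2 _ (by linarith) (by linarith),
      c0 _ (by linarith), ?_⟩)
    rw [abs_of_nonpos (by linarith), max_eq_right (by linarith)]; ring
  rcases le_total s 1 with h1 | h1
  · refine Or.inr (Or.inr (Or.inl ⟨⟨h', h1⟩, c2 _ h h1, c1 _ (by linarith),
      c2 _ (by linarith) (by linarith), ?_⟩))
    rw [abs_of_nonneg (by linarith), max_eq_right (by linarith)]; ring
  · refine Or.inr (Or.inr (Or.inr ⟨h1, c1 _ h1, c1 _ (by linarith), c1 _ (by linarith),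
      max_eq_left ?_⟩))
    rw [abs_of_nonneg (by linarith)]; linarith

lemma levelCov_zero (s t : ℝ) :
    levelCov 0 s t = max 0 (1 / 2 - |s - 1 / 2|) * max 0 (1 / 2 - |t - 1 / 2|) := by
  simp [levelCov, schauder]

/-- A bridge is the tent interpolation of its midpoint value plus two independent bridges on the
halves, scaled by 1/√2. Clamping removes the half that does not contain the points, and both halves
when the points lie on opposite sides. -/
lemma bridgeCov_eq (s t : ℝ) :
    bridgeCov s t = levelCov 0 s t +
      (bridgeCov (2 * s) (2 * t) + bridgeCov (2 * s - 1) (2 * t - 1)) / 2 := by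
  rw [levelCov_zero, bridgeCov, bridgeCov, bridgeCov]
  rcases clamp_cases s with ⟨hs, e1, e2, e3, e4⟩ | ⟨hs, e1, e2, e3, e4⟩ | ⟨hs, e1, e2, e3, e4⟩ |
    ⟨hs, e1, e2, e3, e4⟩ <;>
  rcases clamp_cases t with ⟨ht, f1, f2, f3, f4⟩ | ⟨ht, f1, f2, f3, f4⟩ | ⟨ht, f1, f2, f3, f4⟩ |
    ⟨ht, f1, f2, f3, f4⟩ <;>
  rw [e1, e2, e3, e4, f1, f2, f3, f4] <;> simp only [min_def] <;> split_ifs <;> linarith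

lemma abs_bridgeCov_le (s t : ℝ) : |bridgeCov s t| ≤ if 0 < s ∧ s < 1 then 1 else 0 := by
  rw [bridgeCov]
  have ht0 : 0 ≤ max 0 (min 1 t) := le_max_left _ _
  have ht1 : max 0 (min 1 t) ≤ 1 := max_le zero_le_one (min_le_left _ _)
  split_ifs with h
  · rw [min_eq_right h.2.le, max_eq_right h.1.le, abs_le]
    constructor
    · have : 0 ≤ min s (max 0 (min 1 t)) := le_min h.1.le ht0
      nlinarith
    · have : min s (max 0 (min 1 t)) ≤ s := min_le_left _ _
      nlinarith [mul_nonneg h.1.le ht0]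
  · rcases le_or_gt s 0 with h0 | h0
    · rw [max_eq_left ((min_le_right _ _).trans h0), min_eq_left ht0]; simp
    · have h1 : 1 ≤ s := by by_contra hc; exact h ⟨h0, not_le.1 hc⟩
      rw [min_eq_left h1, max_eq_right zero_le_one, min_eq_right ht1]; simp

/-- The covariance and the partial sums obey the same doubling recursion, so the remainder at one
scale is half the sum of two remainders at the next. At most one of them is nonzero, since s is
interior to at most one half: hence the factor 1/2 per level. -/
lemma abs_bridgeCov_sub_le (M : ℕ) (s t : ℝ) :
    |bridgeCov s t - ∑ n ∈ Finset.range M, levelCov n s t| ≤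
      (1 / 2) ^ M * if 0 < s ∧ s < 1 then 1 else 0 := by
  induction M generalizing s t with
  | zero => simpa using abs_bridgeCov_le s t
  | succ M ih =>
    have e : bridgeCov s t - ∑ n ∈ Finset.range (M + 1), levelCov n s t =
        ((bridgeCov (2 * s) (2 * t) - ∑ n ∈ Finset.range M, levelCov n (2 * s) (2 * t)) +
        (bridgeCov (2 * s - 1) (2 * t - 1) -
          ∑ n ∈ Finset.range M, levelCov n (2 * s - 1) (2 * t - 1))) / 2 := by
      rw [Finset.sum_range_succ', bridgeCov_eq]
      simp only [levelCov_succ]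
      rw [← Finset.sum_div, Finset.sum_add_distrib]
      ring
    have h1 := ih (2 * s) (2 * t)
    have h2 := ih (2 * s - 1) (2 * t - 1)
    rw [e, abs_div, abs_two, div_le_iff₀ (by norm_num)]
    refine (abs_add_le _ _).trans ((add_le_add h1 h2).trans ?_)
    rw [pow_succ, ← mul_add]
    have hp : (0 : ℝ) < (1 / 2) ^ M := by positivity
    have : ((if 0 < 2 * s ∧ 2 * s < 1 then 1 else 0) +
        if 0 < 2 * s - 1 ∧ 2 * s - 1 < 1 then 1 else 0 : ℝ) ≤ if 0 < s ∧ s < 1 then 1 else 0 := by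
      split_ifs <;> first | (exfalso; grind) | norm_num
    calc (1 / 2 : ℝ) ^ M * _ ≤ (1 / 2) ^ M * if 0 < s ∧ s < 1 then 1 else 0 := by gcongr
      _ = _ := by ring

lemma tendsto_sum_levelCov (s t : ℝ) :
    Tendsto (fun M => ∑ n ∈ Finset.range M, levelCov n s t) atTop (𝓝 (bridgeCov s t)) := by
  have h : Tendsto (fun M : ℕ => (1 / 2 : ℝ) ^ M * if 0 < s ∧ s < 1 then 1 else 0) atTop (𝓝 0) := by
    simpa using (tendsto_pow_atTop_nhds_zero_of_lt_one (by norm_num : (0 : ℝ) ≤ 1 / 2)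
      (by norm_num)).mul_const (if 0 < s ∧ s < 1 then (1 : ℝ) else 0)
  refine tendsto_of_tendsto_of_dist tendsto_const_nhds
    (squeeze_zero (fun _ => dist_nonneg) (fun M => ?_) h)
  rw [Real.dist_eq]
  exact abs_bridgeCov_sub_le M s t

/-- The variance of the increments of the bridge. -/
lemma tendsto_sum_sq_schauder {s t : ℝ} (hs : s ∈ Set.Icc (0 : ℝ) 1) (ht : t ∈ Set.Icc (0 : ℝ) 1) :
    Tendsto (fun M => ∑ n ∈ Finset.range M, ∑ k ∈ Finset.range (2 ^ n),
      (schauder n k s - schauder n k t) ^ 2) atTop (𝓝 (|s - t| - (s - t) ^ 2)) := by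
  have h := ((tendsto_sum_levelCov s s).add (tendsto_sum_levelCov t t)).sub
    ((tendsto_sum_levelCov s t).const_mul 2)
  have e : bridgeCov s s + bridgeCov t t - 2 * bridgeCov s t = |s - t| - (s - t) ^ 2 := by
    simp only [bridgeCov, min_eq_right hs.2, min_eq_right ht.2, max_eq_right hs.1,
      max_eq_right ht.1, min_self]
    rcases le_total s t with h | h
    · rw [min_eq_left h, abs_of_nonpos (by linarith)]; ring
    · rw [min_eq_right h, abs_of_nonneg (by linarith)]; ring
  rw [e] at h
  refine h.congr fun M => ?_
  rw [← Finset.sum_add_distrib, Finset.mul_sum, ← Finset.sum_sub_distrib]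
  refine Finset.sum_congr rfl fun n _ => ?_
  rw [levelCov, levelCov, levelCov, ← Finset.sum_add_distrib, Finset.mul_sum,
    ← Finset.sum_sub_distrib]
  exact Finset.sum_congr rfl fun k _ => by ring

/-! ### The law of the bridge -/

/-- Independent standard normal variables. -/
abbrev normals (ι : Type*) : Measure (ι → ℝ) := Measure.infinitePi fun _ => gaussianReal 0 1

lemma integral_spin_normals {ι : Type*} (F : Finset ι) (w : ι → ℝ) :
    ∫ ξ, spin (∑ i ∈ F, w i * ξ i) ∂normals ι =
      (Real.exp (-(∑ i ∈ F, w i ^ 2) / 2) : ℝ) := by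
  have h1 : ∀ x : ι → ℝ, spin (∑ i ∈ F, w i * x i) =
      (fun y : (i : F) → ℝ => ∏ i : F, Complex.exp (w i * y i * Complex.I)) (F.restrict x) := by
    intro x
    rw [spin, ← Finset.sum_coe_sort, Complex.ofReal_sum, Finset.sum_mul, Complex.exp_sum]
    simp
  simp only [h1]
  rw [integral_restrict_infinitePi (X := fun _ : ι => ℝ) (fun _ => gaussianReal 0 1)
    (f := fun y : (i : F) → ℝ => ∏ i : F, Complex.exp (w i * y i * Complex.I))
    (Continuous.aestronglyMeasurable (by fun_prop)),
    integral_fintype_prod_eq_prod (fun (i : F) (y : ℝ) => Complex.exp (w i * y * Complex.I))]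
  have h2 : ∀ i : F, ∫ y : ℝ, Complex.exp (w i * y * Complex.I) ∂gaussianReal 0 1 =
      Complex.exp (-(w i : ℂ) ^ 2 / 2) := fun i => by
    rw [← charFun_apply_real, charFun_gaussianReal]
    congr 1
    push_cast
    simp
    ring
  simp only [h2]
  rw [← Complex.exp_sum, Complex.ofReal_exp]
  congr 1
  push_cast
  rw [Finset.sum_coe_sort F fun i => -(w i : ℂ) ^ 2 / 2, ← Finset.sum_div, Finset.sum_neg_distrib]

lemma schauder_eq_zero {n k : ℕ} {t : ℝ} (h : k ≠ ⌊2 ^ n * t⌋₊) : schauder n k t = 0 := by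
  rw [schauder, max_eq_left, mul_zero]
  by_contra hc
  rw [not_le, sub_pos, abs_lt] at hc
  refine h (Eq.symm ((Nat.floor_eq_iff ?_).2 ⟨by linarith, by linarith⟩))
  have := Nat.cast_nonneg (α := ℝ) k
  linarith

lemma schauder_nonneg (n k : ℕ) (t : ℝ) : 0 ≤ schauder n k t :=
  mul_nonneg (by positivity) (le_max_left _ _)

lemma schauder_le (n k : ℕ) (t : ℝ) : schauder n k t ≤ (√2)⁻¹ ^ n := by
  rw [schauder, inv_pow]
  refine mul_le_of_le_one_right (by positivity) (max_le zero_le_one ?_)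
  have := abs_nonneg ((2 : ℝ) ^ n * t - k - 1 / 2)
  linarith

/-- The tents of one level have disjoint supports, so at most one is nonzero at t. -/
lemma abs_level_le (ξ : ℕ × ℕ → ℝ) (n : ℕ) (t : ℝ) :
    |∑ k ∈ Finset.range (2 ^ n), ξ (n, k) * schauder n k t| ≤
      |ξ (n, ⌊2 ^ n * t⌋₊)| * (√2)⁻¹ ^ n := by
  set m := ⌊2 ^ n * t⌋₊
  have h : |ξ (n, m) * schauder n m t| ≤ |ξ (n, m)| * (√2)⁻¹ ^ n := by
    rw [abs_mul, abs_of_nonneg (schauder_nonneg _ _ _)]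
    exact mul_le_mul_of_nonneg_left (schauder_le _ _ _) (abs_nonneg _)
  by_cases hm : m ∈ Finset.range (2 ^ n)
  · rwa [Finset.sum_eq_single_of_mem m hm fun k _ hk => by rw [schauder_eq_zero hk, mul_zero]]
  · rw [Finset.sum_eq_zero fun k hk => by
      have hk' : k ≠ m := by rintro rfl; exact hm hk
      rw [schauder_eq_zero hk', mul_zero], abs_zero]
    positivity

lemma integral_abs_gaussian_le : ∫ x, |x| ∂gaussianReal 0 1 ≤ 1 := by
  have h2 : Integrable (fun x : ℝ => x ^ 2) (gaussianReal 0 1) := by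
    simpa using (memLp_id_gaussianReal (μ := 0) (v := 1) 2).integrable_sq
  have hv : ∫ x : ℝ, x ^ 2 ∂gaussianReal 0 1 = 1 := by
    have := variance_id_gaussianReal (μ := 0) (v := 1)
    rw [variance_of_integral_eq_zero aemeasurable_id (by simp)] at this
    simpa using this
  have h1 : Integrable (fun x : ℝ => |x|) (gaussianReal 0 1) := by
    have := (memLp_id_gaussianReal (μ := 0) (v := 1) 1).integrable le_rfl
    exact this.abs
  calc ∫ x, |x| ∂gaussianReal 0 1 ≤ ∫ x : ℝ, (1 + x ^ 2) / 2 ∂gaussianReal 0 1 := by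
        refine integral_mono h1 (((integrable_const _).add h2).div_const 2) fun x => ?_
        have := sq_nonneg (|x| - 1)
        simp only
        nlinarith [sq_abs x]
    _ = 1 := by
        rw [integral_div, integral_add (integrable_const _) h2, hv]
        simp

/-- The level sums have L¹ norms at most 2^{-n/2}, which are summable. Without summability `bridge`
would take the default value of `tsum`. Only fixed times are needed, not the continuity of paths. -/
lemma ae_summable_level {E : Type*} (e : E) (t : ℝ) :
    ∀ᵐ ξ ∂normals (E × ℕ × ℕ),
      Summable fun n => ∑ k ∈ Finset.range (2 ^ n), ξ (e, n, k) * schauder n k t := by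
  have hr : (1 : ℝ) < √2 := by rw [Real.lt_sqrt] <;> norm_num
  have hi : ∀ i : E × ℕ × ℕ, Integrable (fun ξ : E × ℕ × ℕ → ℝ => ξ i) (normals _) := fun i =>
    (measurePreserving_eval_infinitePi (fun _ : E × ℕ × ℕ => gaussianReal 0 1) i).integrable_comp_of_integrable
      ((memLp_id_gaussianReal (μ := 0) (v := 1) 1).integrable le_rfl)
  have hn : ∀ i : E × ℕ × ℕ, eLpNorm (fun ξ : E × ℕ × ℕ → ℝ => ξ i) 1 (normals _) ≤ 1 := by
    intro i
    have h1 : eLpNorm (fun ξ : E × ℕ × ℕ → ℝ => ξ i) 1 (normals _) =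
        eLpNorm (id : ℝ → ℝ) 1 (gaussianReal 0 1) :=
      eLpNorm_comp_measurePreserving (g := id) aestronglyMeasurable_id
        (measurePreserving_eval_infinitePi (fun _ : E × ℕ × ℕ => gaussianReal 0 1) i)
    rw [h1, eLpNorm_one_eq_lintegral_enorm, ← ofReal_integral_norm_eq_lintegral_enorm
      ((memLp_id_gaussianReal (μ := 0) (v := 1) 1).integrable le_rfl)]
    simpa using ENNReal.ofReal_le_ofReal integral_abs_gaussian_le
  have h := summable_norm_of_tsum_eLpNorm_ne_top (μ := normals (E × ℕ × ℕ)) (p := 1) le_rfl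
    (f := fun n ξ => (√2)⁻¹ ^ n • ξ (e, n, ⌊2 ^ n * t⌋₊))
    (fun n => ((hi (e, n, ⌊2 ^ n * t⌋₊)).smul ((√2)⁻¹ ^ n)).aestronglyMeasurable) (by
      refine ne_top_of_le_ne_top (b := ∑' n : ℕ, ENNReal.ofReal ((√2)⁻¹) ^ n) ?_
        (ENNReal.tsum_le_tsum fun n => ?_)
      · rw [ENNReal.tsum_geometric, ENNReal.inv_ne_top]
        exact (tsub_pos_of_lt (by simpa using hr)).ne'
      · have h2 := eLpNorm_const_smul (μ := normals (E × ℕ × ℕ)) (p := 1) ((√2)⁻¹ ^ n)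
          fun ξ : E × ℕ × ℕ → ℝ => ξ (e, n, ⌊2 ^ n * t⌋₊)
        refine h2.trans_le ?_
        rw [Real.enorm_of_nonneg (by positivity), ENNReal.ofReal_pow (by positivity)]
        exact mul_le_of_le_one_right' (hn _))
  filter_upwards [h] with ξ hξ
  refine Summable.of_norm_bounded hξ fun n => ?_
  have := abs_level_le (fun i => ξ (e, i)) n t
  rw [norm_smul, mul_comm, Real.norm_eq_abs, Real.norm_eq_abs, Real.norm_eq_abs,
    abs_of_nonneg (by positivity : 0 ≤ (√2)⁻¹ ^ n)]
  exact this

/-- The partial sums of a linear combination of bridge increments. -/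
def bridgeSum {E : Type*} [Fintype E] (c s t : E → ℝ) (M : ℕ) (ξ : E × ℕ × ℕ → ℝ) : ℝ :=
  ∑ e, c e * (∑ n ∈ Finset.range M, ∑ k ∈ Finset.range (2 ^ n), ξ (e, n, k) * schauder n k (s e) -
    ∑ n ∈ Finset.range M, ∑ k ∈ Finset.range (2 ^ n), ξ (e, n, k) * schauder n k (t e))

lemma ae_tendsto_bridgeSum {E : Type*} [Fintype E] (c s t : E → ℝ) :
    ∀ᵐ ξ ∂normals (E × ℕ × ℕ), Tendsto (fun M => bridgeSum c s t M ξ) atTop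
      (𝓝 (∑ e, c e * (bridge (fun i => ξ (e, i)) (s e) - bridge (fun i => ξ (e, i)) (t e)))) := by
  have h1 := ae_all_iff.2 fun e : E => ae_summable_level e (s e)
  have h2 := ae_all_iff.2 fun e : E => ae_summable_level e (t e)
  filter_upwards [h1, h2] with ξ h1 h2
  exact tendsto_finsetSum _ fun e _ =>
    ((h1 e).hasSum.tendsto_sum_nat.sub (h2 e).hasSum.tendsto_sum_nat).const_mul (c e)

lemma integral_spin_bridgeSum {E : Type*} [Fintype E] (c s t : E → ℝ) (M : ℕ) :
    ∫ ξ, spin (bridgeSum c s t M ξ) ∂normals (E × ℕ × ℕ) =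
      (Real.exp (-(∑ e, c e ^ 2 * ∑ n ∈ Finset.range M, ∑ k ∈ Finset.range (2 ^ n),
        (schauder n k (s e) - schauder n k (t e)) ^ 2) / 2) : ℝ) := by
  -- The triangular array of indices is padded by zeros to a rectangle, so that the Gaussian formula
  -- for one finite index set applies.
  have hsub : ∀ (f : ℕ → ℕ → ℝ), ∑ n ∈ Finset.range M, ∑ k ∈ Finset.range (2 ^ M),
      (if k < 2 ^ n then f n k else 0) =
      ∑ n ∈ Finset.range M, ∑ k ∈ Finset.range (2 ^ n), f n k := fun f => by
    refine Finset.sum_congr rfl fun n hn => ?_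
    rw [← Finset.sum_filter]
    refine Finset.sum_congr ?_ fun _ _ => rfl
    ext k
    simp only [Finset.mem_filter, Finset.mem_range, and_iff_right_iff_imp]
    exact fun h => h.trans (Nat.pow_lt_pow_right one_lt_two (Finset.mem_range.1 hn))
  have h := integral_spin_normals
    (Finset.univ ×ˢ (Finset.range M ×ˢ Finset.range (2 ^ M)) : Finset (E × ℕ × ℕ))
    (fun i => if i.2.2 < 2 ^ i.2.1 then
      c i.1 * (schauder i.2.1 i.2.2 (s i.1) - schauder i.2.1 i.2.2 (t i.1)) else 0)
  simp only [Finset.sum_product, ite_pow, ite_mul, zero_mul, ne_eq, OfNat.ofNat_ne_zero,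
    not_false_eq_true, zero_pow, hsub] at h
  have e1 : ∀ ξ : E × ℕ × ℕ → ℝ, bridgeSum c s t M ξ = ∑ e, ∑ n ∈ Finset.range M,
      ∑ k ∈ Finset.range (2 ^ n), c e * (schauder n k (s e) - schauder n k (t e)) * ξ (e, n, k) := by
    intro ξ
    refine Finset.sum_congr rfl fun e _ => ?_
    rw [← Finset.sum_sub_distrib, Finset.mul_sum]
    refine Finset.sum_congr rfl fun n _ => ?_
    rw [← Finset.sum_sub_distrib, Finset.mul_sum]
    exact Finset.sum_congr rfl fun k _ => by ring
  simp only [e1, h, mul_pow, Finset.mul_sum]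

lemma aestronglyMeasurable_spin_bridge {E : Type*} [Fintype E] (c s t : E → ℝ) :
    AEStronglyMeasurable (fun ξ : E × ℕ × ℕ → ℝ => spin (∑ e, c e *
      (bridge (fun i => ξ (e, i)) (s e) - bridge (fun i => ξ (e, i)) (t e)))) (normals _) := by
  refine aestronglyMeasurable_of_tendsto_ae atTop
    (f := fun M ξ => spin (bridgeSum c s t M ξ)) (fun M => ?_) ?_
  · have : Measurable fun ξ : E × ℕ × ℕ → ℝ => spin (bridgeSum c s t M ξ) :=
      continuous_spin.measurable.comp (by unfold bridgeSum; fun_prop)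
    exact this.aestronglyMeasurable
  · filter_upwards [ae_tendsto_bridgeSum c s t] with ξ hξ
    exact (continuous_spin.tendsto _).comp hξ

/-- The partial sums are centered Gaussian, independent from edge to edge, and their variances
converge to those of bridge increments; dominated convergence passes to the limit. -/
lemma integral_spin_bridge {E : Type*} [Fintype E] (c : E → ℝ) {s t : E → ℝ}
    (hs : ∀ e, s e ∈ Set.Icc (0 : ℝ) 1) (ht : ∀ e, t e ∈ Set.Icc (0 : ℝ) 1) :
    ∫ ξ, spin (∑ e, c e * (bridge (fun i => ξ (e, i)) (s e) - bridge (fun i => ξ (e, i)) (t e)))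
      ∂normals (E × ℕ × ℕ) =
      (Real.exp (-(∑ e, c e ^ 2 * (|s e - t e| - (s e - t e) ^ 2)) / 2) : ℝ) := by
  have h1 := tendsto_integral_of_dominated_convergence (μ := normals (E × ℕ × ℕ))
    (F := fun M ξ => spin (bridgeSum c s t M ξ)) (fun _ => (1 : ℝ)) (fun M => by
      have : Measurable fun ξ : E × ℕ × ℕ → ℝ => spin (bridgeSum c s t M ξ) :=
        continuous_spin.measurable.comp (by unfold bridgeSum; fun_prop)
      exact this.aestronglyMeasurable) (integrable_const _)
    (fun M => Eventually.of_forall fun ξ => (norm_spin _).le)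
    (by filter_upwards [ae_tendsto_bridgeSum c s t] with ξ hξ
        exact (continuous_spin.tendsto _).comp hξ)
  simp only [integral_spin_bridgeSum] at h1
  refine tendsto_nhds_unique h1 ((Complex.continuous_ofReal.tendsto _).comp
    ((Real.continuous_exp.tendsto _).comp (Tendsto.div_const (Tendsto.neg ?_) 2)))
  exact tendsto_finsetSum _ fun e _ => (tendsto_sum_sq_schauder (hs e) (ht e)).const_mul _

/-! ### The law of the angles and winding numbers -/

lemma summable_exp_neg_mul_sq {c : ℝ} (hc : 0 < c) :
    Summable fun n : ℤ => Real.exp (-(c * (n : ℝ) ^ 2)) := by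
  refine (summable_pow_mul_jacobiTheta₂_term_bound 0 (T := c / π) (by positivity) 0).congr
    fun n => ?_
  rw [pow_zero, one_mul]
  congr 1
  field_simp
  ring

/-- A summable bound for the terms of the Villain weight. -/
def windBound (κ : ℝ) (n : ℤ) : ℝ :=
  Real.exp (κ / 2 * (2 * π) ^ 2) * Real.exp (-(κ * π ^ 2 * (n : ℝ) ^ 2))

lemma summable_windBound {κ : ℝ} (hκ : 0 < κ) : Summable (windBound κ) :=
  (summable_exp_neg_mul_sq (by positivity)).mul_left _

lemma exp_wind_le {κ : ℝ} (hκ : 0 < κ) {φ : ℝ} (hφ : |φ| ≤ 2 * π) (n : ℤ) :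
    Real.exp (-(κ / 2) * (φ + 2 * π * n) ^ 2) ≤ windBound κ n := by
  rw [windBound, ← Real.exp_add, Real.exp_le_exp]
  have h1 : φ ^ 2 ≤ (2 * π) ^ 2 := by rw [← sq_abs φ]; gcongr
  -- The identity behind this is (φ + 2πn)² + φ² - 2π²n² = 2(φ + πn)².
  nlinarith [mul_nonneg hκ.le (sq_nonneg (φ + π * n)), mul_le_mul_of_nonneg_left h1 hκ.le]

/-- Lets the sum over winding configurations factor into sums over the edges. -/
lemma pi_count {E : Type*} [Fintype E] :
    Measure.pi (fun _ : E => (Measure.count : Measure ℤ)) = Measure.count := by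
  refine Measure.ext_of_singleton fun n => ?_
  rw [Measure.count_singleton, ← Set.univ_pi_singleton, Measure.pi_pi]
  simp

/-- The spin factor and Gibbs factor of the winding numbers. -/
def windTerm (κ δ φ : ℝ) (n : ℤ) : ℂ :=
  ((Real.exp (-(κ / 2) * (φ + 2 * π * n) ^ 2) : ℝ) : ℂ) * spin (δ * (φ + 2 * π * n))

lemma norm_windTerm (κ δ φ : ℝ) (n : ℤ) :
    ‖windTerm κ δ φ n‖ = Real.exp (-(κ / 2) * (φ + 2 * π * n) ^ 2) := by
  rw [windTerm, norm_mul, norm_spin, mul_one, Complex.norm_real, Real.norm_of_nonneg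
    (Real.exp_pos _).le]

lemma tsum_windTerm {κ : ℝ} (hκ : 0 < κ) (δ φ : ℝ) :
    fser (edgeLimit κ δ) φ = (√(2 * π * κ) * Real.exp (-((|δ| - δ ^ 2) / (2 * κ))) : ℝ) *
      ∑' n : ℤ, windTerm κ δ φ n := fser_edgeLimit hκ δ φ

lemma measurable_prod_windTerm {V E : Type*} [Fintype E] (s t : E → V) (K δ : E → ℝ) (p p' : V) :
    Measurable fun x : (V → ℝ) × (E → ℤ) => echar 1 (x.1 p - x.1 p') *
      ∏ e, windTerm (K e) (δ e) (x.1 (t e) - x.1 (s e)) (x.2 e) := by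
  have hc : ∀ e, Measurable fun x : (V → ℝ) × (E → ℤ) => ((x.2 e : ℤ) : ℝ) := fun e =>
    (Measurable.of_discrete (f := fun n : ℤ => (n : ℝ))).comp
      ((measurable_pi_apply e).comp measurable_snd)
  have hw : ∀ e, Measurable fun x : (V → ℝ) × (E → ℤ) =>
      windTerm (K e) (δ e) (x.1 (t e) - x.1 (s e)) (x.2 e) := fun e => by
    have h1 : Measurable fun x : (V → ℝ) × (E → ℤ) =>
        x.1 (t e) - x.1 (s e) + 2 * π * (x.2 e : ℝ) := by
      have := hc e
      fun_prop
    have h2 : Continuous fun φ : ℝ =>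
        ((Real.exp (-(K e / 2) * φ ^ 2) : ℝ) : ℂ) * spin (δ e * φ) := by fun_prop
    exact h2.measurable.comp h1
  refine Measurable.mul ((continuous_echar 1).measurable.comp (by fun_prop)) ?_
  exact Finset.measurable_fun_prod _ fun e _ => hw e

lemma ae_abs_sub_le {V : Type u} [Fintype V] (v w : V) :
    ∀ᵐ θ ∂(volume : Measure (V → ℝ)).restrict (angleBox V), |θ v - θ w| ≤ 2 * π := by
  refine ae_restrict_of_forall_mem (MeasurableSet.univ_pi fun _ => measurableSet_Ico)
    fun θ hθ => ?_
  have h1 := hθ v (Set.mem_univ v)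
  have h2 := hθ w (Set.mem_univ w)
  rw [abs_le]
  constructor <;> linarith [h1.1, h1.2, h2.1, h2.2]

lemma integrable_prod_windTerm {V : Type u} {E : Type*} [Fintype V] [Fintype E] (s t : E → V)
    {K : E → ℝ} (hK : ∀ e, 0 < K e) (δ : E → ℝ) (p p' : V) :
    Integrable (fun x : (V → ℝ) × (E → ℤ) => echar 1 (x.1 p - x.1 p') *
      ∏ e, windTerm (K e) (δ e) (x.1 (t e) - x.1 (s e)) (x.2 e))
      (((volume : Measure (V → ℝ)).restrict (angleBox V)).prod Measure.count) := by
  have hfin : IsFiniteMeasure ((volume : Measure (V → ℝ)).restrict (angleBox V)) := by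
    rw [restrict_angleBox]
    exact Measure.smul_finite _ (ENNReal.pow_ne_top ENNReal.ofReal_ne_top)
  have hi : Integrable (fun n : E → ℤ => ∏ e, windBound (K e) (n e)) Measure.count := by
    rw [← pi_count]
    exact Integrable.fintype_prod fun e =>
      integrable_count_iff.2 (summable_windBound (hK e)).abs
  have hg := (integrable_const (μ := (volume : Measure (V → ℝ)).restrict (angleBox V))
    (1 : ℝ)).mul_prod hi
  refine hg.mono' (measurable_prod_windTerm s t K δ p p').aestronglyMeasurable ?_
  have hae : ∀ᵐ x ∂(((volume : Measure (V → ℝ)).restrict (angleBox V)).prod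
      (Measure.count : Measure (E → ℤ))), ∀ e, |x.1 (t e) - x.1 (s e)| ≤ 2 * π :=
    Measure.quasiMeasurePreserving_fst.ae (ae_all_iff.2 fun e => ae_abs_sub_le (t e) (s e))
  filter_upwards [hae] with x hx
  rw [norm_mul, norm_echar, norm_prod]
  refine mul_le_mul_of_nonneg_left (Finset.prod_le_prod (fun _ _ => norm_nonneg _)
    fun e _ => ?_) zero_le_one
  rw [norm_windTerm]
  exact exp_wind_le (hK e) (hx e) _

/-- For fixed angles the winding numbers are summed edge by edge, and Poisson summation identifies
each sum. The exponentials on the left are put there by hand; the bridges will supply them. The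
power of 2π is the volume of the angle box. -/
lemma integral_prod_windTerm {V : Type u} {E : Type*} [Fintype V] [Fintype E] (s t : E → V)
    {K : E → ℝ} (hK : ∀ e, 0 < K e) (δ : E → ℝ) (p p' : V) :
    (((∏ e, √(2 * π * K e)) * ∏ e, Real.exp (-((|δ e| - δ e ^ 2) / (2 * K e))) : ℝ) : ℂ) *
    ∫ x : (V → ℝ) × (E → ℤ), echar 1 (x.1 p - x.1 p') *
      ∏ e, windTerm (K e) (δ e) (x.1 (t e) - x.1 (s e)) (x.2 e)
      ∂(((volume : Measure (V → ℝ)).restrict (angleBox V)).prod Measure.count) =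
    ((2 * π) ^ Fintype.card V : ℝ) * edgeMean s t (fun e => edgeLimit (K e) (δ e)) p p' := by
  rw [integral_prod _ (integrable_prod_windTerm s t hK δ p p'), restrict_angleBox,
    integral_smul_measure, ENNReal.toReal_pow, ENNReal.toReal_ofReal (by positivity), edgeMean,
    Complex.real_smul, mul_left_comm]
  congr 1
  rw [← integral_const_mul]
  refine integral_congr_ae (Eventually.of_forall fun θ => ?_)
  have hs : ∀ e, Summable fun n => ‖windTerm (K e) (δ e) (θ (t e) - θ (s e)) n‖ := fun e => by
    simp only [norm_windTerm]
    have h := (summable_exp_neg_mul_sq (c := K e * π ^ 2) (by have := hK e; positivity)).mul_left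
      (Real.exp (K e / 2 * (θ (t e) - θ (s e)) ^ 2))
    refine Summable.of_nonneg_of_le (fun _ => (Real.exp_pos _).le) (fun n => ?_) h
    rw [← Real.exp_add, Real.exp_le_exp]
    nlinarith [mul_nonneg (hK e).le (sq_nonneg ((θ (t e) - θ (s e)) + π * n))]
  have hc : ∀ e, ∫ n, windTerm (K e) (δ e) (θ (t e) - θ (s e)) n ∂Measure.count =
      ∑' n, windTerm (K e) (δ e) (θ (t e) - θ (s e)) n := fun e => by
    rw [integral_countable (integrable_count_iff.2 (hs e))]
    simp [Measure.real]
  simp only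
  rw [integral_const_mul, ← pi_count, integral_fintype_prod_eq_prod
    (fun e n => windTerm (K e) (δ e) (θ (t e) - θ (s e)) n)]
  simp only [hc, tsum_windTerm (hK _), Finset.prod_mul_distrib]
  push_cast
  rw [Finset.prod_mul_distrib]
  ring

/-! ### The Villain interaction of an edge -/

/-- The Villain interaction of an edge, which is constant when the coupling vanishes. -/
def villainEdge (κ φ : ℝ) : ℝ :=
  if κ = 0 then 1 else
    √(2 * π * κ) * ∑' n : ℤ, Real.exp (-(κ / 2) * (φ + 2 * π * n) ^ 2)

lemma summable_exp_wind {κ : ℝ} (hκ : 0 < κ) (φ : ℝ) :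
    Summable fun n : ℤ => Real.exp (-(κ / 2) * (φ + 2 * π * n) ^ 2) := by
  have h := (summable_exp_neg_mul_sq (c := κ * π ^ 2) (by positivity)).mul_left
    (Real.exp (κ / 2 * φ ^ 2))
  refine Summable.of_nonneg_of_le (fun _ => (Real.exp_pos _).le) (fun n => ?_) h
  rw [← Real.exp_add, Real.exp_le_exp]
  nlinarith [mul_nonneg hκ.le (sq_nonneg (φ + π * n))]

lemma villainEdge_pos {κ : ℝ} (hκ : 0 ≤ κ) (φ : ℝ) : 0 < villainEdge κ φ := by
  rw [villainEdge]
  split_ifs with h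
  · exact one_pos
  · have hκ' : 0 < κ := lt_of_le_of_ne hκ (Ne.symm h)
    exact mul_pos (by positivity) ((summable_exp_wind hκ' φ).tsum_pos
      (fun _ => (Real.exp_pos _).le) 0 (Real.exp_pos _))

/-- The factor √(2πκ) in `villainEdge` is the Poisson constant. With it, positive and zero couplings
have the common description by `edgeLimit₀`; it cancels in two-point functions. -/
lemma fser_edgeLimit₀ {κ : ℝ} (hκ : 0 ≤ κ) (φ : ℝ) :
    fser (edgeLimit₀ κ 0) φ = villainEdge κ φ := by
  rw [villainEdge]
  split_ifs with h
  · rw [fser, tsum_eq_single 0]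
    · simp [edgeLimit₀, h, echar_zero_left]
    · intro k hk
      simp [edgeLimit₀, h, hk]
  · have hκ' : 0 < κ := lt_of_le_of_ne hκ (Ne.symm h)
    have e : edgeLimit₀ κ 0 = edgeLimit κ 0 := by
      funext k; simp [edgeLimit₀, h]
    rw [e, fser_edgeLimit hκ', Complex.ofReal_mul, Complex.ofReal_mul, Complex.ofReal_tsum]
    simp [spin]

lemma summable_edgeLimit₀ {κ : ℝ} (hκ : 0 ≤ κ) : Summable (edgeLimit₀ κ 0) := by
  by_cases h : κ = 0
  · have e : edgeLimit₀ κ 0 = fun k => if k = 0 then 1 else 0 := by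
      funext k; simp [edgeLimit₀, h]
    rw [e]
    exact (hasSum_ite_eq 0 1).summable
  · have hκ' : 0 < κ := lt_of_le_of_ne hκ (Ne.symm h)
    refine (summable_exp_neg_mul_sq (c := 1 / (2 * κ)) (by positivity)).congr fun k => ?_
    simp only [edgeLimit₀, h, if_false, edgeLimit]
    congr 1
    simp
    ring

/-- Read off on the Fourier side, where convergence is uniform in the angle. -/
lemma continuous_villainEdge {κ : ℝ} (hκ : 0 ≤ κ) : Continuous (villainEdge κ) := by
  have h := Complex.continuous_re.comp (continuous_fser (summable_edgeLimit₀ hκ))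
  refine h.congr fun φ => ?_
  simp [fser_edgeLimit₀ hκ]

lemma villainEdge_le {κ : ℝ} (hκ : 0 ≤ κ) (φ : ℝ) :
    |villainEdge κ φ| ≤ ∑' k, |edgeLimit₀ κ 0 k| := by
  have h := norm_fser_le (summable_edgeLimit₀ hκ) φ
  rwa [fser_edgeLimit₀ hκ, Complex.norm_real] at h

/-- The unnormalized two-point function of the Villain model on a multigraph. -/
def villainMean {V E : Type*} [Fintype V] [Fintype E] (s t : E → V) (K : E → ℝ) (p p' : V) : ℝ :=
  ∫ θ, Real.cos (θ p - θ p') * ∏ e, villainEdge (K e) (θ (t e) - θ (s e)) ∂unifPi V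

lemma integrable_villainMean {V E : Type*} [Fintype V] [Fintype E] (s t : E → V) {K : E → ℝ}
    (hK : ∀ e, 0 ≤ K e) (p p' : V) :
    Integrable (fun θ => Real.cos (θ p - θ p') *
      ∏ e, villainEdge (K e) (θ (t e) - θ (s e))) (unifPi V) := by
  have hc := fun e => continuous_villainEdge (hK e)
  refine integrable_of_continuous_bounded (Continuous.mul (by fun_prop)
    (continuous_finsetProd _ fun e _ => (hc e).comp (by fun_prop)))
    (1 * ∏ e, ∑' k, |edgeLimit₀ (K e) 0 k|) fun θ => ?_
  rw [norm_mul, norm_prod]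
  refine mul_le_mul (Real.abs_cos_le_one _) (Finset.prod_le_prod (fun _ _ => norm_nonneg _)
    fun e _ => villainEdge_le (hK e) _) (Finset.prod_nonneg fun _ _ => norm_nonneg _) zero_le_one

lemma edgeMean_edgeLimit₀ {V E : Type*} [Fintype V] [Fintype E] (s t : E → V) {K : E → ℝ}
    (hK : ∀ e, 0 ≤ K e) (p p' : V) :
    (edgeMean s t (fun e => edgeLimit₀ (K e) 0) p p').re = villainMean s t K p p' := by
  have hc := fun e => continuous_villainEdge (hK e)
  have hi : Integrable (fun θ => echar 1 (θ p - θ p') *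
      ∏ e, fser (edgeLimit₀ (K e) 0) (θ (t e) - θ (s e))) (unifPi V) := by
    have hf := fun e => continuous_fser (summable_edgeLimit₀ (hK e))
    refine integrable_of_continuous_bounded (Continuous.mul (by fun_prop)
      (continuous_finsetProd _ fun e _ => (hf e).comp (by fun_prop)))
      (1 * ∏ e, ∑' k, |edgeLimit₀ (K e) 0 k|) fun θ => ?_
    rw [norm_mul, norm_echar]
    exact mul_le_mul_of_nonneg_left (norm_prod_fser_le _ (fun e => summable_edgeLimit₀ (hK e)) _)
      zero_le_one
  have h := integral_re hi
  simp only [RCLike.re_eq_complex_re] at h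
  rw [edgeMean, ← h, villainMean]
  refine integral_congr_ae (Eventually.of_forall fun θ => ?_)
  simp only [fser_edgeLimit₀ (hK _)]
  rw [← Complex.ofReal_prod, Complex.re_mul_ofReal, ← spin_eq_echar, spin,
    Complex.exp_ofReal_mul_I_re]

lemma villainMean_self_pos {V E : Type*} [Fintype V] [Fintype E] (s t : E → V) {K : E → ℝ}
    (hK : ∀ e, 0 ≤ K e) (p : V) : 0 < villainMean s t K p p := by
  have hi := integrable_villainMean s t hK p p
  have hp : ∀ θ : V → ℝ, 0 < Real.cos (θ p - θ p) *
      ∏ e, villainEdge (K e) (θ (t e) - θ (s e)) := fun θ => by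
    rw [sub_self, Real.cos_zero, one_mul]
    exact Finset.prod_pos fun e _ => villainEdge_pos (hK e) _
  rw [villainMean, integral_pos_iff_support_of_nonneg (fun θ => (hp θ).le) hi,
    Set.eq_univ_of_forall fun θ => Function.mem_support.2 (hp θ).ne', measure_univ]
  exact one_pos

lemma limitCorr_zero {V E : Type*} [Fintype V] [Fintype E] (s t : E → V) {K : E → ℝ}
    (hK : ∀ e, 0 ≤ K e) (p p' : V) :
    limitCorr s t K p p' 0 0 = villainMean s t K p p' / villainMean s t K p p := by
  simp [limitCorr, ← edgeMean_edgeLimit₀ s t hK]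

open Classical in
/-- The two-point function of the Villain model in terms of the unnormalized one. -/
lemma villainCorr_eq {V : Type u} [Fintype V] (G : SimpleGraph V) (J : Sym2 V → ℝ) {β : ℝ}
    (hJ : ∀ e ∈ G.edgeSet, 0 < β * J e) (x y : V) :
    villainCorr G J β x y = villainMean src tgt (fun e : G.edgeSet => β * J e) x y /
      villainMean src tgt (fun e : G.edgeSet => β * J e) x x := by
  have hw : ∀ θ : V → ℝ, ∏ e : G.edgeSet, villainEdge (β * J e) (θ (tgt e) - θ (src e)) =
      (∏ e : G.edgeSet, √(2 * π * (β * J e))) * villainWeight G J β θ := fun θ => by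
    rw [villainWeight, ← Finset.prod_mul_distrib]
    exact Finset.prod_congr rfl fun e _ => by rw [villainEdge, if_neg (hJ e e.2).ne']
  have hc : (∏ e : G.edgeSet, √(2 * π * (β * J e))) ≠ 0 := by
    refine Finset.prod_ne_zero_iff.2 fun e _ => ?_
    have := hJ e e.2
    positivity
  have e1 : ∀ p p' : V, villainMean src tgt (fun e : G.edgeSet => β * J e) p p' =
      (∏ e : G.edgeSet, √(2 * π * (β * J e))) *
        ∫ θ, Real.cos (θ p - θ p') * villainWeight G J β θ ∂unifPi V := fun p p' => by
    rw [← integral_const_mul, villainMean]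
    refine integral_congr_ae (Eventually.of_forall fun θ => ?_)
    simp only [hw]
    ring
  rw [e1, e1, mul_div_mul_left _ _ hc, villainCorr, gibbsMean_eq]
  simp only [inner_spin, sub_self, Real.cos_zero, one_mul]

/-! ### The Villain model on the metric graph -/

/-- The Villain spin at a point, as a product along the edges. -/
lemma villainSpin_mk {V : Type u} {G : SimpleGraph V} [Fintype G.edgeSet] [DecidableEq G.edgeSet]
    (J : Sym2 V → ℝ) (β : ℝ) (ω : Sample G) (x : V ⊕ (G.edgeSet × unitInterval)) :
    villainSpin J β ω (Quot.mk _ x) = spin (ω.1.1 (ptBase src x)) *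
      (∏ e : G.edgeSet, spin (ptPos x e * (ω.1.1 (tgt e) - ω.1.1 (src e) + 2 * π * ω.1.2 e))) *
      spin (∑ e : G.edgeSet, (√(β * J e))⁻¹ * bridge (fun i => ω.2 (e, i)) (ptPos x e)) := by
  rcases x with v | ⟨e, τ⟩
  · simp [villainSpin, ptBase, ptPos, bridge_zero, spin]
  · have h1 : ∏ e' : G.edgeSet, spin ((Pi.single e (τ : ℝ) : G.edgeSet → ℝ) e' *
        (ω.1.1 (tgt e') - ω.1.1 (src e') + 2 * π * ω.1.2 e')) =
        spin (τ * (ω.1.1 (tgt e) - ω.1.1 (src e) + 2 * π * ω.1.2 e)) := by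
      rw [Finset.prod_eq_single e _ (by simp), Pi.single_eq_same]
      intro e' _ he
      rw [Pi.single_eq_of_ne he]
      simp [spin]
    have h2 : ∑ e' : G.edgeSet, (√(β * J e'))⁻¹ * bridge (fun i => ω.2 (e', i))
        ((Pi.single e (τ : ℝ) : G.edgeSet → ℝ) e') =
        (√(β * J e))⁻¹ * bridge (fun i => ω.2 (e, i)) τ := by
      rw [Finset.sum_eq_single e _ (by simp), Pi.single_eq_same]
      intro e' _ he
      rw [Pi.single_eq_of_ne he, bridge_zero, mul_zero]
    simp only [villainSpin, ptBase, ptPos, Sum.elim_inr, h1, h2]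
    simp only [spin_eq_echar, ← echar_add]
    rw [div_eq_inv_mul]

lemma spin_mul_conj (φ ψ : ℝ) : spin φ * (starRingEnd ℂ) (spin ψ) = spin (φ - ψ) := by
  rw [spin_eq_echar, spin_eq_echar, conj_echar, ← echar_sub, spin_eq_echar]

lemma villainSpin_mul_conj {V : Type u} {G : SimpleGraph V} [Fintype G.edgeSet]
    [DecidableEq G.edgeSet] (J : Sym2 V → ℝ) (β : ℝ) (ω : Sample G)
    (x y : V ⊕ (G.edgeSet × unitInterval)) :
    villainSpin J β ω (Quot.mk _ x) * (starRingEnd ℂ) (villainSpin J β ω (Quot.mk _ y)) =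
      (spin (ω.1.1 (ptBase src x) - ω.1.1 (ptBase src y)) *
      ∏ e : G.edgeSet, spin ((ptPos x e - ptPos y e) *
        (ω.1.1 (tgt e) - ω.1.1 (src e) + 2 * π * ω.1.2 e))) *
      spin (∑ e : G.edgeSet, (√(β * J e))⁻¹ * (bridge (fun i => ω.2 (e, i)) (ptPos x e) -
        bridge (fun i => ω.2 (e, i)) (ptPos y e))) := by
  have h1 : ∏ e : G.edgeSet, spin ((ptPos x e - ptPos y e) *
        (ω.1.1 (tgt e) - ω.1.1 (src e) + 2 * π * ω.1.2 e)) =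
      (∏ e : G.edgeSet, spin (ptPos x e * (ω.1.1 (tgt e) - ω.1.1 (src e) + 2 * π * ω.1.2 e))) *
      (starRingEnd ℂ) (∏ e : G.edgeSet,
        spin (ptPos y e * (ω.1.1 (tgt e) - ω.1.1 (src e) + 2 * π * ω.1.2 e))) := by
    rw [map_prod, ← Finset.prod_mul_distrib]
    exact Finset.prod_congr rfl fun e _ => by rw [spin_mul_conj]; ring_nf
  rw [villainSpin_mk, villainSpin_mk, h1]
  simp only [mul_sub, Finset.sum_sub_distrib, ← spin_mul_conj, map_mul]
  ring

lemma ptPos_mem {V E : Type*} [DecidableEq E] (x : V ⊕ (E × unitInterval)) (e : E) :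
    ptPos x e ∈ Set.Icc (0 : ℝ) 1 := by
  rcases x with v | ⟨e', τ⟩
  · simp [ptPos]
  · simp only [ptPos, Sum.elim_inr, Pi.single_apply]
    split_ifs
    exacts [τ.2, ⟨le_rfl, zero_le_one⟩]

open Classical in
/-- The density of the angles and winding numbers. -/
lemma measurable_villainDensity {V : Type u} [Fintype V] (G : SimpleGraph V) (J : Sym2 V → ℝ)
    (β : ℝ) : Measurable fun p : (V → ℝ) × (G.edgeSet → ℤ) => (∏ e : G.edgeSet,
      Real.exp (-(β * J e / 2) * (p.1 (tgt e) - p.1 (src e) + 2 * π * p.2 e) ^ 2)) := by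
  refine Finset.measurable_fun_prod _ fun e _ => ?_
  have hc : Measurable fun x : (V → ℝ) × (G.edgeSet → ℤ) => ((x.2 e : ℤ) : ℝ) :=
    (Measurable.of_discrete (f := fun n : ℤ => (n : ℝ))).comp
      ((measurable_pi_apply e).comp measurable_snd)
  fun_prop

open Classical in
-- The vertex and winding variables are independent of the bridges, so the integral factors. The
-- bridge factor has variance (|δ| - δ²)/(βJ) per edge and is exactly what `integral_prod_windTerm`
-- needs to produce `edgeLimit`.
lemma integral_villainSpin {V : Type u} [Fintype V] (G : SimpleGraph V) (J : Sym2 V → ℝ) {β : ℝ}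
    (hJ : ∀ e ∈ G.edgeSet, 0 < β * J e) (x y : V ⊕ (G.edgeSet × unitInterval)) :
    Integrable (fun ω => villainSpin J β ω (Quot.mk _ x) *
      (starRingEnd ℂ) (villainSpin J β ω (Quot.mk _ y))) (villainMeasure G J β) ∧
    ((∏ e : G.edgeSet, √(2 * π * (β * J e)) : ℝ) : ℂ) *
      ∫ ω, villainSpin J β ω (Quot.mk _ x) * (starRingEnd ℂ) (villainSpin J β ω (Quot.mk _ y))
        ∂villainMeasure G J β = ((2 * π) ^ Fintype.card V : ℝ) *
      edgeMean src tgt (fun e : G.edgeSet => edgeLimit (β * J e) (ptPos x e - ptPos y e))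
        (ptBase src x) (ptBase src y) := by
  simp only [villainSpin_mul_conj]
  set δ : G.edgeSet → ℝ := fun e => ptPos x e - ptPos y e with hδ
  have hK : ∀ e : G.edgeSet, 0 < β * J e := fun e => hJ e e.2
  have hfac : ∀ p : (V → ℝ) × (G.edgeSet → ℤ), (ENNReal.ofReal (∏ e : G.edgeSet,
      Real.exp (-(β * J e / 2) * (p.1 (tgt e) - p.1 (src e) + 2 * π * p.2 e) ^ 2))).toReal •
      (spin (p.1 (ptBase src x) - p.1 (ptBase src y)) * ∏ e : G.edgeSet, spin (δ e *
        (p.1 (tgt e) - p.1 (src e) + 2 * π * p.2 e))) =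
      echar 1 (p.1 (ptBase src x) - p.1 (ptBase src y)) * ∏ e : G.edgeSet,
        windTerm (β * J e) (δ e) (p.1 (tgt e) - p.1 (src e)) (p.2 e) := fun p => by
    rw [ENNReal.toReal_ofReal (Finset.prod_nonneg fun _ _ => (Real.exp_pos _).le),
      Complex.real_smul, spin_eq_echar, mul_left_comm, Complex.ofReal_prod,
      ← Finset.prod_mul_distrib]
    rfl
  have hD := (measurable_villainDensity G J β).ennreal_ofReal
  have hfin : ∀ᵐ p ∂(((volume : Measure (V → ℝ)).restrict (angleBox V)).prod
      (Measure.count : Measure (G.edgeSet → ℤ))), ENNReal.ofReal (∏ e : G.edgeSet,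
      Real.exp (-(β * J e / 2) * (p.1 (tgt e) - p.1 (src e) + 2 * π * p.2 e) ^ 2)) < ⊤ :=
    Eventually.of_forall fun _ => ENNReal.ofReal_lt_top
  have hA := integrable_prod_windTerm src tgt hK δ (ptBase src x) (ptBase src y)
  simp only [← hfac] at hA
  have hA' := (integrable_withDensity_iff_integrable_smul' hD hfin).2 hA
  have hB : Integrable (fun ξ : G.edgeSet × ℕ × ℕ → ℝ => spin (∑ e : G.edgeSet,
      (√(β * J e))⁻¹ * (bridge (fun i => ξ (e, i)) (ptPos x e) -
        bridge (fun i => ξ (e, i)) (ptPos y e)))) (normals _) :=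
    Integrable.of_bound (aestronglyMeasurable_spin_bridge _ _ _) 1
      (Eventually.of_forall fun _ => (norm_spin _).le)
  refine ⟨hA'.mul_prod hB, ?_⟩
  have hprod := integral_prod_mul (μ := (((volume : Measure (V → ℝ)).restrict (angleBox V)).prod
      (Measure.count : Measure (G.edgeSet → ℤ))).withDensity fun p =>
      ENNReal.ofReal (∏ e : G.edgeSet,
      Real.exp (-(β * J e / 2) * (p.1 (tgt e) - p.1 (src e) + 2 * π * p.2 e) ^ 2)))
    (ν := normals (G.edgeSet × ℕ × ℕ))
    (fun p => spin (p.1 (ptBase src x) - p.1 (ptBase src y)) * ∏ e : G.edgeSet, spin (δ e *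
        (p.1 (tgt e) - p.1 (src e) + 2 * π * p.2 e)))
    (fun ξ => spin (∑ e : G.edgeSet, (√(β * J e))⁻¹ * (bridge (fun i => ξ (e, i)) (ptPos x e) -
        bridge (fun i => ξ (e, i)) (ptPos y e))))
  rw [villainMeasure]
  refine (congrArg _ hprod).trans ?_
  rw [integral_withDensity_eq_integral_toReal_smul hD hfin]
  simp only [hfac]
  have h := integral_prod_windTerm src tgt hK δ (ptBase src x) (ptBase src y)
  rw [integral_spin_bridge _ (ptPos_mem x) (ptPos_mem y), ← h]
  have hexp : Real.exp (-(∑ e : G.edgeSet, (√(β * J e))⁻¹ ^ 2 *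
      (|ptPos x e - ptPos y e| - (ptPos x e - ptPos y e) ^ 2)) / 2) =
      ∏ e : G.edgeSet, Real.exp (-((|δ e| - δ e ^ 2) / (2 * (β * J e)))) := by
    rw [← Real.exp_sum]
    congr 1
    rw [neg_div, Finset.sum_div, ← Finset.sum_neg_distrib]
    refine Finset.sum_congr rfl fun e _ => ?_
    rw [inv_pow, Real.sq_sqrt (hK e).le]
    have := (hK e).ne'
    simp only [δ]
    field_simp
  rw [hexp]
  push_cast
  ring

open Classical in
theorem villainMetricCorr_eq {V : Type u} [Fintype V] (G : SimpleGraph V) (J : Sym2 V → ℝ) {β : ℝ}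
    (hJ : ∀ e ∈ G.edgeSet, 0 < β * J e) (x y : V ⊕ (G.edgeSet × unitInterval)) :
    villainMetricCorr G J β (Quot.mk _ x) (Quot.mk _ y) =
      limitCorr src tgt (fun e : G.edgeSet => β * J e) (ptBase src x) (ptBase src y)
        (ptPos x) (ptPos y) := by
  have hK : ∀ e : G.edgeSet, 0 < β * J e := fun e => hJ e e.2
  have hc : (0 : ℝ) < ∏ e : G.edgeSet, √(2 * π * (β * J e)) := Finset.prod_pos fun e _ => by
    have := hK e
    positivity
  have key : ∀ x y : V ⊕ (G.edgeSet × unitInterval),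
      (∏ e : G.edgeSet, √(2 * π * (β * J e))) * ∫ ω, inner ℝ (villainSpin J β ω (Quot.mk _ x))
        (villainSpin J β ω (Quot.mk _ y)) ∂villainMeasure G J β = (2 * π) ^ Fintype.card V *
      (edgeMean src tgt (fun e : G.edgeSet => edgeLimit₀ (β * J e) (ptPos x e - ptPos y e))
        (ptBase src x) (ptBase src y)).re := fun x y => by
    obtain ⟨h1, h2⟩ := integral_villainSpin G J hJ x y
    have h3 := congrArg Complex.re h2
    rw [Complex.re_ofReal_mul, Complex.re_ofReal_mul] at h3
    have h4 := integral_re h1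
    simp only [RCLike.re_eq_complex_re] at h4
    rw [← h4] at h3
    have e0 : ∀ e : G.edgeSet, edgeLimit₀ (β * J e) (ptPos x e - ptPos y e) =
        edgeLimit (β * J e) (ptPos x e - ptPos y e) := fun e => by
      funext k; rw [edgeLimit₀, if_neg (hK e).ne']
    simp only [e0, ← h3]
    congr 1
    refine integral_congr_ae (Eventually.of_forall fun ω => ?_)
    simp only
    rw [real_inner_comm, Complex.inner]
  -- The total mass is the unnormalized two-point function at coinciding points, because spins have
  -- norm one.
  have hmass : (∏ e : G.edgeSet, √(2 * π * (β * J e))) *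
      (villainMeasure G J β Set.univ).toReal = (2 * π) ^ Fintype.card V *
      (edgeMean src tgt (fun e : G.edgeSet => edgeLimit₀ (β * J e) 0)
        (ptBase src x) (ptBase src x)).re := by
    have h := key x x
    have hn : ∀ ω, ‖villainSpin J β ω (Quot.mk (Glue G) x)‖ = 1 := fun ω => by
      rw [villainSpin_mk, norm_mul, norm_mul, norm_prod, norm_spin, norm_spin]
      have : ∀ e : G.edgeSet, ‖spin (ptPos x e * (ω.1.1 (tgt e) - ω.1.1 (src e) +
        2 * π * ω.1.2 e))‖ = 1 := fun e => norm_spin _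
      simp [this]
    simp only [real_inner_self_eq_norm_sq, hn, sub_self, one_pow] at h
    rw [integral_const, smul_eq_mul, mul_one] at h
    exact h
  have hpi : ((2 : ℝ) * π) ^ Fintype.card V ≠ 0 := by positivity
  unfold villainMetricCorr villainLaw
  rw [integral_smul_measure, ENNReal.toReal_inv, smul_eq_mul,
    limitCorr, ← div_eq_inv_mul, ← mul_div_mul_left _ _ hc.ne', key, hmass,
    mul_div_mul_left _ _ hpi]

/-! ### Uniform convergence on the metric graph -/

lemma site_eq {V : Type u} {G : SimpleGraph V} (n : ℕ) (θ : RefinedSite G (n + 1) → ℝ)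
    (e : G.edgeSet) (j : ℕ) : θ (site (n + 1) e j) = refPath src tgt n θ e j := by
  unfold site refPath chainPath
  split_ifs <;> first | rfl | (exfalso; omega)

lemma xySpin_mk {V : Type u} {G : SimpleGraph V} (n : ℕ) (θ : RefinedSite G (n + 1) → ℝ)
    (x : V ⊕ (G.edgeSet × unitInterval)) :
    xySpin (n + 1) θ (Quot.mk _ x) = refSpin src tgt n θ x := by
  rcases x with v | ⟨e, τ⟩
  · rfl
  · change xyEdgeSpin (n + 1) θ e τ = _
    simp only [xyEdgeSpin, site_eq]
    rfl

open Classical in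
lemma xyCorr_mk {V : Type u} [Fintype V] (G : SimpleGraph V) (J : Sym2 V → ℝ) (β : ℝ) (n : ℕ)
    (x y : V ⊕ (G.edgeSet × unitInterval)) :
    xyCorr G J β (n + 1) (Quot.mk _ x) (Quot.mk _ y) =
      refCorr src tgt (fun e : G.edgeSet => β * J e) n x y := by
  have hw : xyWeight G J β (n + 1) = refWeight src tgt (fun e : G.edgeSet => β * J e) n := by
    funext θ
    simp only [xyWeight, site_eq]
    rfl
  unfold xyCorr
  simp only [hw, xySpin_mk]
  rfl

/-- Continuous convergence on a compact space is uniform convergence. -/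
lemma tendstoUniformly_of_continuous_convergence {X : Type*} [TopologicalSpace X] [CompactSpace X]
    {F : ℕ → X → ℝ} {f : X → ℝ}
    (h : ∀ x, Tendsto (fun q : ℕ × X => F q.1 q.2) (atTop ×ˢ 𝓝 x) (𝓝 (f x))) :
    TendstoUniformly F f atTop := by
  have hpt : ∀ x, Tendsto (fun n => F n x) atTop (𝓝 (f x)) := fun x =>
    (h x).comp (tendsto_id.prodMk (tendsto_const_pure.mono_right (pure_le_nhds x)))
  -- The limit is continuous: near x and for large n, F n y lies within ε/2 of f x; letting n tend
  -- to infinity with y fixed keeps this closed condition.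
  have hf : ∀ x, Tendsto f (𝓝 x) (𝓝 (f x)) := fun x => by
    refine Metric.tendsto_nhds.2 fun ε hε => ?_
    have h1 := (h x).eventually (Metric.closedBall_mem_nhds (f x) (half_pos hε))
    have h2 := (eventually_swap_iff.1 h1).curry
    filter_upwards [h2] with y hy
    have := Metric.isClosed_closedBall.mem_of_tendsto (hpt y) hy
    exact (Metric.mem_closedBall.1 this).trans_lt (half_lt_self hε)
  rw [← tendstoLocallyUniformly_iff_tendstoUniformly_of_compactSpace,
    tendstoLocallyUniformly_iff_forall_tendsto]
  refine fun x => ?_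
  have h3 := ((hf x).comp (tendsto_snd (f := (atTop : Filter ℕ)))).prodMk (h x)
  exact (h3.mono_right (by rw [← nhds_prod_eq])).mono_right (nhds_le_uniformity _)

theorem tendstoUniformly_refCorr {V E : Type u} [Fintype V] [Fintype E] [DecidableEq E]
    (s t : E → V) {K : E → ℝ} (hK : ∀ e, 0 < K e) :
    TendstoUniformly
      (fun (n : ℕ) (q : (V ⊕ (E × unitInterval)) × (V ⊕ (E × unitInterval))) =>
        refCorr s t K n q.1 q.2)
      (fun q => limitCorr s t K (ptBase s q.1) (ptBase s q.2) (ptPos q.1) (ptPos q.2)) atTop := by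
  -- With discrete topologies on the finite vertex and edge sets, the disjoint union of vertices and
  -- closed segments is compact.
  let _ : TopologicalSpace V := ⊥
  have : DiscreteTopology V := ⟨rfl⟩
  let _ : TopologicalSpace E := ⊥
  have : DiscreteTopology E := ⟨rfl⟩
  refine tendstoUniformly_of_continuous_convergence fun q => ?_
  obtain ⟨x, y⟩ := q
  refine tendsto_refCorr s t hK (fun p => ?_) x y
  rw [edgeMean_edgeLimit₀ _ _ fun e => (hK e).le]
  exact (villainMean_self_pos _ _ (fun e => (hK e).le) p).ne'

/-- Uniformity is proved before gluing, on pairs of representatives, and descends because every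
point of the quotient has a representative. No topology on the metric graph is used. -/
theorem tendstoUniformly_xyCorr {V : Type u} [Fintype V] (G : SimpleGraph V) (J : Sym2 V → ℝ)
    {β : ℝ} (hJ : ∀ e ∈ G.edgeSet, 0 < β * J e) :
    TendstoUniformly (fun (n : ℕ) (p : MetricGraph G × MetricGraph G) =>
      xyCorr G J β (n + 1) p.1 p.2) (fun p => villainMetricCorr G J β p.1 p.2) atTop := by
  classical
  have h := tendstoUniformly_refCorr (V := V) (src (G := G)) tgt
    (K := fun e => β * J e) fun e => hJ e e.2
  rw [Metric.tendstoUniformly_iff] at h ⊢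
  intro ε hε
  filter_upwards [h ε hε] with n hn
  have key : ∀ X Y : MetricGraph G,
      dist (villainMetricCorr G J β X Y) (xyCorr G J β (n + 1) X Y) < ε := by
    refine Quot.ind fun x => Quot.ind fun y => ?_
    rw [villainMetricCorr_eq G J hJ, xyCorr_mk]
    exact hn (x, y)
  exact fun p => key p.1 p.2

/-! ### Positive definite kernels -/

/-- Bounded kernels that define a positive semidefinite form. -/
def IsPSDKernel {X : Type*} [MeasurableSpace X] (μ : Measure X) (k : X × X → ℝ) : Prop :=
  Measurable k ∧ (∃ C, ∀ z, |k z| ≤ C) ∧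
    ∀ u : X → ℝ, Measurable u → (∃ C, ∀ x, |u x| ≤ C) → 0 ≤ ∫ z, u z.1 * u z.2 * k z ∂μ.prod μ

lemma isPSDKernel_one {X : Type*} [MeasurableSpace X] (μ : Measure X) [SFinite μ] :
    IsPSDKernel μ fun _ => 1 := by
  refine ⟨measurable_const, ⟨1, by simp⟩, fun u _ _ => ?_⟩
  simp only [mul_one]
  rw [integral_prod_mul]
  exact mul_self_nonneg _

/-- Expand the exponential: the n-th term is c^n/n! ≥ 0 times the form of k evaluated at u vⁿ. -/
lemma IsPSDKernel.mul_exp {X : Type*} [MeasurableSpace X] {μ : Measure X} [IsFiniteMeasure μ]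
    {k : X × X → ℝ} (hk : IsPSDKernel μ k) {v : X → ℝ} (hv : Measurable v) {B : ℝ}
    (hB : ∀ x, |v x| ≤ B) {c : ℝ} (hc : 0 ≤ c) :
    IsPSDKernel μ fun z => k z * Real.exp (c * (v z.1 * v z.2)) := by
  obtain ⟨hm, ⟨C, hC⟩, hpos⟩ := hk
  have hvv : ∀ z : X × X, |c * (v z.1 * v z.2)| ≤ c * (B * B) := fun z => by
    rw [abs_mul, abs_mul, abs_of_nonneg hc]
    have := hB z.1
    have := hB z.2
    gcongr
    exact (abs_nonneg _).trans (hB z.1)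
  refine ⟨by fun_prop, ⟨C * Real.exp (c * (B * B)), fun z => ?_⟩, fun u hu ⟨D, hD⟩ => ?_⟩
  · rw [abs_mul, Real.abs_exp]
    exact mul_le_mul (hC z) (Real.exp_le_exp.2 ((le_abs_self _).trans (hvv z)))
      (Real.exp_pos _).le ((abs_nonneg _).trans (hC z))
  have hexp : ∀ x : ℝ, HasSum (fun n : ℕ => x ^ n / n.factorial) (Real.exp x) := fun x => by
    rw [Real.exp_eq_exp_ℝ]
    exact NormedSpace.expSeries_div_hasSum_exp x
  have h := hasSum_integral_of_dominated_convergence (μ := μ.prod μ)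
    (F := fun (n : ℕ) z => u z.1 * u z.2 * (k z * ((c * (v z.1 * v z.2)) ^ n / n.factorial)))
    (f := fun z => u z.1 * u z.2 * (k z * Real.exp (c * (v z.1 * v z.2))))
    (fun n _ => D * D * (C * ((c * (B * B)) ^ n / n.factorial)))
    (fun n => by
      have : Measurable fun z : X × X =>
        u z.1 * u z.2 * (k z * ((c * (v z.1 * v z.2)) ^ n / n.factorial)) := by fun_prop
      exact this.aestronglyMeasurable)
    (fun n => Eventually.of_forall fun z => by
      rw [norm_mul, norm_mul, norm_mul, norm_div, norm_pow, Real.norm_eq_abs, Real.norm_eq_abs,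
        Real.norm_eq_abs, Real.norm_eq_abs, RCLike.norm_natCast]
      have h1 := hD z.1
      have h2 := hD z.2
      have h3 := hC z
      have h4 := hvv z
      have hD0 := (abs_nonneg _).trans h1
      have hC0 := (abs_nonneg _).trans h3
      gcongr)
    (Eventually.of_forall fun z => (((hexp (c * (B * B))).mul_left C).mul_left (D * D)).summable)
    (integrable_const _)
    (Eventually.of_forall fun z => ((hexp _).mul_left _).mul_left _)
  refine h.nonneg fun n => ?_
  have h0 := hpos (fun x => u x * v x ^ n) (by fun_prop) ⟨D * B ^ n, fun x => by
    rw [abs_mul, abs_pow]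
    have h1 := hD x
    have h2 := hB x
    have h3 := (abs_nonneg _).trans h1
    gcongr⟩
  have e : ∀ z : X × X, u z.1 * u z.2 * (k z * ((c * (v z.1 * v z.2)) ^ n / n.factorial)) =
      c ^ n / n.factorial * (u z.1 * v z.1 ^ n * (u z.2 * v z.2 ^ n) * k z) := fun z => by
    rw [mul_pow, mul_pow]; ring
  simp only [e]
  rw [integral_const_mul]
  exact mul_nonneg (by positivity) h0

lemma isPSDKernel_exp_sum {X : Type*} [MeasurableSpace X] {μ : Measure X} [IsFiniteMeasure μ]
    {ι : Type*} (S : Finset ι) {v : ι → X → ℝ} (hv : ∀ i, Measurable (v i)) {B : ℝ}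
    (hB : ∀ i x, |v i x| ≤ B) {c : ι → ℝ} (hc : ∀ i, 0 ≤ c i) :
    IsPSDKernel μ fun z => Real.exp (∑ i ∈ S, c i * (v i z.1 * v i z.2)) := by
  classical
  induction S using Finset.induction_on with
  | empty => simpa using isPSDKernel_one μ
  | insert i S hi ih =>
    have h := ih.mul_exp (hv i) (hB i) (hc i)
    simp only [Finset.sum_insert hi, Real.exp_add]
    simpa only [mul_comm] using h

/-! ### Rotation of two copies of the torus -/

instance : Fact (0 < 2 * π) := ⟨by positivity⟩

/-- The cosine on the circle. -/
def tcos : AddCircle (2 * π) → ℝ := Real.cos_periodic.lift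

/-- The sine on the circle. -/
def tsin : AddCircle (2 * π) → ℝ := Real.sin_periodic.lift

@[fun_prop]
lemma continuous_tcos : Continuous tcos := continuous_coinduced_dom.2 Real.continuous_cos

@[fun_prop]
lemma continuous_tsin : Continuous tsin := continuous_coinduced_dom.2 Real.continuous_sin

lemma abs_tcos_le (x : AddCircle (2 * π)) : |tcos x| ≤ 1 := by
  induction x using QuotientAddGroup.induction_on with
  | H x => exact Real.abs_cos_le_one x

lemma abs_tsin_le (x : AddCircle (2 * π)) : |tsin x| ≤ 1 := by
  induction x using QuotientAddGroup.induction_on with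
  | H x => exact Real.abs_sin_le_one x

lemma tcos_sub (x y : AddCircle (2 * π)) : tcos (x - y) = tcos x * tcos y + tsin x * tsin y := by
  induction x using QuotientAddGroup.induction_on with
  | H x =>
    induction y using QuotientAddGroup.induction_on with
    | H y => exact Real.cos_sub x y

lemma tcos_add (x y : AddCircle (2 * π)) : tcos (x + y) = tcos x * tcos y - tsin x * tsin y := by
  induction x using QuotientAddGroup.induction_on with
  | H x =>
    induction y using QuotientAddGroup.induction_on with
    | H y => exact Real.cos_add x y

/-- The normalized Haar measure of the torus. -/
abbrev torusHaar (ι : Type*) [Fintype ι] : Measure (ι → AddCircle (2 * π)) :=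
  Measure.pi fun _ => AddCircle.haarAddCircle

/-- A continuous surjective endomorphism of a compact group preserves normalized Haar measure.
Injectivity fails, as both copies may be shifted by a half period, but is not required. -/
lemma measurePreserving_rotate (ι : Type*) [Fintype ι] :
    MeasurePreserving (fun z : (ι → AddCircle (2 * π)) × (ι → AddCircle (2 * π)) =>
      (z.1 - z.2, z.1 + z.2)) ((torusHaar ι).prod (torusHaar ι))
      ((torusHaar ι).prod (torusHaar ι)) := by
  have : SecondCountableTopology (ι → AddCircle (2 * π)) := inferInstance
  have : ((torusHaar ι).prod (torusHaar ι)).IsAddHaarMeasure :=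
    Measure.prod.instIsAddHaarMeasure _ _
  refine AddMonoidHom.measurePreserving (μ := (torusHaar ι).prod (torusHaar ι))
    (ν := (torusHaar ι).prod (torusHaar ι))
    (f := (AddMonoidHom.fst (ι → AddCircle (2 * π)) (ι → AddCircle (2 * π)) -
      AddMonoidHom.snd _ _).prod (AddMonoidHom.fst _ _ + AddMonoidHom.snd _ _))
    (by
      change Continuous fun z : (ι → AddCircle (2 * π)) × (ι → AddCircle (2 * π)) =>
        (z.1 - z.2, z.1 + z.2)
      fun_prop) (fun z => ?_) rfl
  have hhalf : ∀ x y : AddCircle (2 * π), ∃ a b : AddCircle (2 * π), a - b = x ∧ a + b = y := by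
    intro x y
    induction x using QuotientAddGroup.induction_on with
    | H x =>
      induction y using QuotientAddGroup.induction_on with
      | H y =>
        -- Halving is done on real representatives.
        refine ⟨((x + y) / 2 : ℝ), ((y - x) / 2 : ℝ), ?_, ?_⟩
        · rw [← AddCircle.coe_sub]; congr 1; ring
        · rw [← AddCircle.coe_add]; congr 1; ring
  choose a b h1 h2 using fun i => hhalf (z.1 i) (z.2 i)
  exact ⟨(a, b), Prod.ext (funext h1) (funext h2)⟩

lemma measurePreserving_unif :
    MeasurePreserving ((↑) : ℝ → AddCircle (2 * π)) unif AddCircle.haarAddCircle := by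
  have h := AddCircle.measurePreserving_mk (2 * π) (-π)
  have h0 : ENNReal.ofReal (2 * π) ≠ 0 := by simpa using Real.pi_pos
  refine ⟨h.measurable, ?_⟩
  rw [unif, Measure.restrict_congr_set (Ico_ae_eq_Ioc (a := -π) (b := π)), Measure.map_smul]
  have h1 := h.map_eq
  rw [show -π + 2 * π = π by ring] at h1
  refine (congrArg _ h1).trans ?_
  rw [AddCircle.volume_eq_smul_haarAddCircle, smul_smul,
    ENNReal.inv_mul_cancel h0 ENNReal.ofReal_ne_top, one_smul]

lemma integral_unifPi_coe {ι : Type*} [Fintype ι] {F : (ι → AddCircle (2 * π)) → ℝ}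
    (hF : Continuous F) :
    ∫ θ, F (fun i => (θ i : AddCircle (2 * π))) ∂unifPi ι = ∫ φ, F φ ∂torusHaar ι := by
  have h := measurePreserving_pi (fun _ : ι => unif) (fun _ : ι => AddCircle.haarAddCircle)
    fun _ => measurePreserving_unif
  rw [torusHaar, ← h.map_eq, integral_map h.measurable.aemeasurable hF.aestronglyMeasurable]

/-! ### Ginibre's inequality -/

/-- Replace the copies by p - q and p + q. The difference of cosines becomes 2 sin p sin q, and (J +
d) cos(p - q) + J cos(p + q) = (2J + d) cos p cos q + d sin p sin q. So the integrand is twice u(p)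
u(q) times the exponential of a nonnegative combination of product kernels, whose form is positive
semidefinite. -/
lemma ginibre_double {ι B : Type*} [Fintype ι] [Fintype B] (a b : B → ι) {J d : B → ℝ}
    (hJ : ∀ i, 0 ≤ J i) (hd : ∀ i, 0 ≤ d i) (x y : ι) :
    0 ≤ ∫ z, (tcos (z.1 x - z.1 y) - tcos (z.2 x - z.2 y)) *
      (Real.exp (∑ i, (J i + d i) * tcos (z.1 (a i) - z.1 (b i))) *
        Real.exp (∑ i, J i * tcos (z.2 (a i) - z.2 (b i))))
      ∂(torusHaar ι).prod (torusHaar ι) := by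
  have hmp := measurePreserving_rotate ι
  have hF : Continuous fun z : (ι → AddCircle (2 * π)) × (ι → AddCircle (2 * π)) =>
      (tcos (z.1 x - z.1 y) - tcos (z.2 x - z.2 y)) *
      (Real.exp (∑ i, (J i + d i) * tcos (z.1 (a i) - z.1 (b i))) *
        Real.exp (∑ i, J i * tcos (z.2 (a i) - z.2 (b i)))) := by fun_prop
  have : SecondCountableTopology (ι → AddCircle (2 * π)) := inferInstance
  rw [← hmp.map_eq, integral_map hmp.measurable.aemeasurable hF.aestronglyMeasurable]
  have hk := (isPSDKernel_exp_sum (μ := torusHaar ι) (Finset.univ : Finset (B ⊕ B))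
    (v := Sum.elim (fun i φ => tcos (φ (a i) - φ (b i))) fun i φ => tsin (φ (a i) - φ (b i)))
    (B := 1) (c := Sum.elim (fun i => 2 * J i + d i) d)
    (by rintro (i | i) <;> simp only [Sum.elim_inl, Sum.elim_inr]
        exacts [(continuous_tcos.comp (by fun_prop)).measurable,
          (continuous_tsin.comp (by fun_prop)).measurable])
    (by rintro (i | i) φ
        exacts [abs_tcos_le _, abs_tsin_le _])
    (by rintro (i | i)
        · have := hJ i
          have := hd i
          simp only [Sum.elim_inl]
          positivity
        · exact hd i)).2.2 (fun φ => tsin (φ x - φ y))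
      (continuous_tsin.comp (by fun_prop)).measurable ⟨1, fun φ => abs_tsin_le _⟩
  refine (mul_nonneg zero_le_two hk).trans_eq ?_
  rw [← integral_const_mul]
  refine integral_congr_ae (Eventually.of_forall fun z => ?_)
  simp only [Pi.sub_apply, Pi.add_apply, Fintype.sum_sum_type, Sum.elim_inl, Sum.elim_inr]
  have e1 : ∀ i j, z.1 i - z.2 i - (z.1 j - z.2 j) = (z.1 i - z.1 j) - (z.2 i - z.2 j) :=
    fun i j => by abel
  have e2 : ∀ i j, z.1 i + z.2 i - (z.1 j + z.2 j) = (z.1 i - z.1 j) + (z.2 i - z.2 j) :=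
    fun i j => by abel
  simp only [e1, e2, tcos_sub, tcos_add]
  rw [← Real.exp_add, ← Finset.sum_add_distrib, ← Finset.sum_add_distrib]
  have e3 : ∀ i, (J i + d i) * (tcos (z.1 (a i)- z.1 (b i)) * tcos (z.2 (a i) - z.2 (b i)) +
      tsin (z.1 (a i)- z.1 (b i)) * tsin (z.2 (a i) - z.2 (b i))) +
      J i * (tcos (z.1 (a i)- z.1 (b i)) * tcos (z.2 (a i) - z.2 (b i)) -
      tsin (z.1 (a i)- z.1 (b i)) * tsin (z.2 (a i) - z.2 (b i))) =
      (2 * J i + d i) * (tcos (z.1 (a i)- z.1 (b i)) * tcos (z.2 (a i) - z.2 (b i))) +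
      d i * (tsin (z.1 (a i)- z.1 (b i)) * tsin (z.2 (a i) - z.2 (b i))) := fun i => by ring
  simp only [tcos_sub, tsin] at e3 ⊢
  simp only [e3]
  ring

lemma integrable_torus {ι : Type*} [Fintype ι] {F : (ι → AddCircle (2 * π)) → ℝ}
    (hF : Continuous F) : Integrable F (torusHaar ι) :=
  hF.integrable_of_hasCompactSupport (HasCompactSupport.of_compactSpace F)

/-- Ginibre's inequality for the plane rotator model. -/
theorem ginibre {ι B : Type*} [Fintype ι] [Fintype B] (a b : B → ι) {J J' : B → ℝ}
    (hJ : ∀ i, 0 ≤ J i) (hJ' : ∀ i, J i ≤ J' i) (x y : ι) :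
    (∫ θ, Real.cos (θ x - θ y) * Real.exp (∑ i, J i * Real.cos (θ (a i) - θ (b i))) ∂unifPi ι) /
      ∫ θ, Real.exp (∑ i, J i * Real.cos (θ (a i) - θ (b i))) ∂unifPi ι ≤
    (∫ θ, Real.cos (θ x - θ y) * Real.exp (∑ i, J' i * Real.cos (θ (a i) - θ (b i))) ∂unifPi ι) /
      ∫ θ, Real.exp (∑ i, J' i * Real.cos (θ (a i) - θ (b i))) ∂unifPi ι := by
  have hcont : ∀ J : B → ℝ, Continuous fun φ : ι → AddCircle (2 * π) =>
      Real.exp (∑ i, J i * tcos (φ (a i) - φ (b i))) := fun J => by fun_prop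
  have hcont' : ∀ J : B → ℝ, Continuous fun φ : ι → AddCircle (2 * π) =>
      tcos (φ x - φ y) * Real.exp (∑ i, J i * tcos (φ (a i) - φ (b i))) := fun J => by fun_prop
  have t1 : ∀ J : B → ℝ, ∫ θ, Real.exp (∑ i, J i * Real.cos (θ (a i) - θ (b i))) ∂unifPi ι =
      ∫ φ, Real.exp (∑ i, J i * tcos (φ (a i) - φ (b i))) ∂torusHaar ι := fun J =>
    integral_unifPi_coe (hcont J)
  have t2 : ∀ J : B → ℝ, ∫ θ, Real.cos (θ x - θ y) *
      Real.exp (∑ i, J i * Real.cos (θ (a i) - θ (b i))) ∂unifPi ι =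
      ∫ φ, tcos (φ x - φ y) * Real.exp (∑ i, J i * tcos (φ (a i) - φ (b i))) ∂torusHaar ι :=
    fun J => integral_unifPi_coe (hcont' J)
  have hpos : ∀ J : B → ℝ, 0 < ∫ φ, Real.exp (∑ i, J i * tcos (φ (a i) - φ (b i))) ∂torusHaar ι :=
    fun J => integral_exp_pos (integrable_torus (hcont J))
  -- After cross-multiplication the difference of the two sides is an integral over two independent
  -- copies, the first with couplings J' and the second with J.
  rw [t1, t1, t2, t2, div_le_div_iff₀ (hpos J) (hpos J'), ← sub_nonneg]
  have h := ginibre_double a b (J := J) (d := fun i => J' i - J i) hJ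
    (fun i => sub_nonneg.2 (hJ' i)) x y
  simp only [add_sub_cancel] at h
  refine h.trans_eq ?_
  rw [← integral_prod_mul, mul_comm (∫ φ, tcos (φ x - φ y) *
    Real.exp (∑ i, J i * tcos (φ (a i) - φ (b i))) ∂torusHaar ι), ← integral_prod_mul,
    ← integral_sub]
  · refine integral_congr_ae (Eventually.of_forall fun z => ?_)
    simp only
    ring
  · exact (integrable_torus (hcont' J')).mul_prod (integrable_torus (hcont J))
  · exact (integrable_torus (hcont J')).mul_prod (integrable_torus (hcont' J))

/-! ### Monotonicity of the Villain model -/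

/-- The `l`-th site along an edge. -/
def refSite {V E : Type*} (s t : E → V) (n : ℕ) (e : E) (l : ℕ) : V ⊕ (E × Fin n) :=
  if l = 0 then Sum.inl (s e) else if h : l - 1 < n then Sum.inr (e, ⟨l - 1, h⟩) else Sum.inl (t e)

lemma refPath_eq {V E : Type*} (s t : E → V) (n : ℕ) (θ : V ⊕ (E × Fin n) → ℝ) (e : E) (l : ℕ) :
    refPath s t n θ e l = θ (refSite s t n e l) := by
  unfold refPath chainPath refSite
  split_ifs <;> rfl

lemma refWeight_eq_exp {V E : Type*} [Fintype E] (s t : E → V) (K : E → ℝ) (n : ℕ)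
    (θ : V ⊕ (E × Fin n) → ℝ) :
    refWeight s t K n θ = Real.exp (-∑ i : E × Fin (n + 1), K i.1 * (n + 1 : ℕ)) *
      Real.exp (∑ i : E × Fin (n + 1), K i.1 * (n + 1 : ℕ) *
        Real.cos (θ (refSite s t n i.1 (i.2 + 1)) - θ (refSite s t n i.1 i.2))) := by
  rw [refWeight, ← Real.exp_sum, ← Real.exp_add, ← Finset.sum_neg_distrib,
    ← Finset.sum_add_distrib, Fintype.sum_prod_type]
  congr 1
  refine Finset.sum_congr rfl fun e _ => ?_
  rw [Finset.mul_sum, Finset.sum_range]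
  refine Finset.sum_congr rfl fun l _ => ?_
  rw [norm_spin_sub_sq, refPath_eq, refPath_eq]
  ring

/-- The refined model is a plane rotator model with coupling K N on each of its N steps per edge.
Its constant prefactor cancels, and Ginibre's inequality applies. -/
lemma gridCorr_mono {V E : Type u} [Fintype V] [Fintype E] (s t : E → V) {K K' : E → ℝ}
    (hK : ∀ e, 0 ≤ K e) (hK' : ∀ e, K e ≤ K' e) (n : ℕ) (p p' : V) :
    gridCorr s t K n p p' (fun _ => 0) (fun _ => 0) ≤
      gridCorr s t K' n p p' (fun _ => 0) (fun _ => 0) := by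
  have e1 : ∀ K : E → ℝ, gridCorr s t K n p p' (fun _ => 0) (fun _ => 0) =
      (∫ θ, Real.cos (θ (Sum.inl p) - θ (Sum.inl p')) * Real.exp (∑ i : E × Fin (n + 1),
        K i.1 * (n + 1 : ℕ) * Real.cos (θ (refSite s t n i.1 (i.2 + 1)) -
          θ (refSite s t n i.1 i.2))) ∂unifPi (V ⊕ (E × Fin n))) /
      ∫ θ, Real.exp (∑ i : E × Fin (n + 1),
        K i.1 * (n + 1 : ℕ) * Real.cos (θ (refSite s t n i.1 (i.2 + 1)) -
          θ (refSite s t n i.1 i.2))) ∂unifPi (V ⊕ (E × Fin n)) := fun K => by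
    rw [gridCorr, gibbsMean_eq]
    simp only [gridSpin_zero, inner_spin, refWeight_eq_exp, mul_left_comm (Real.cos _)]
    rw [integral_const_mul, integral_const_mul, mul_div_mul_left _ _ (Real.exp_pos _).ne']
  rw [e1, e1]
  exact ginibre _ _ (fun i => mul_nonneg (hK _) (Nat.cast_nonneg _))
    (fun i => mul_le_mul_of_nonneg_right (hK' _) (Nat.cast_nonneg _)) _ _

/-- Both sides are limits of vertex correlations in refined XY models, for which the inequality is
Ginibre's; zero couplings are included. -/
theorem villainMean_mono {V E : Type u} [Fintype V] [Fintype E] (s t : E → V) {K K' : E → ℝ}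
    (hK : ∀ e, 0 ≤ K e) (hK' : ∀ e, K e ≤ K' e) (p p' : V) :
    villainMean s t K p p' / villainMean s t K p p ≤
      villainMean s t K' p p' / villainMean s t K' p p := by
  have hlim : ∀ K : E → ℝ, (∀ e, 0 ≤ K e) →
      Tendsto (fun n => gridCorr s t K n p p' (fun _ => 0) (fun _ => 0)) atTop
        (𝓝 (villainMean s t K p p' / villainMean s t K p p)) := fun K hK => by
    rw [← limitCorr_zero s t hK]
    refine tendsto_gridCorr s t hK tendsto_id (fun _ _ => Nat.zero_le _) (fun _ _ => Nat.zero_le _)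
      (fun _ _ _ => ⟨rfl, rfl⟩) (by simp) (by simp) p p' ?_
    rw [edgeMean_edgeLimit₀ _ _ hK]
    exact (villainMean_self_pos s t hK p).ne'
  exact le_of_tendsto_of_tendsto' (hlim K hK) (hlim K' fun e => (hK e).trans (hK' e))
    fun n => gridCorr_mono s t hK hK' n p p'

/-! ### Subgraphs -/

/-- Needed because a graph and its subgraph select the orientations of their edges independently. -/
lemma villainEdge_symm (κ φ : ℝ) : villainEdge κ (-φ) = villainEdge κ φ := by
  rw [villainEdge, villainEdge]
  split_ifs
  · rfl
  · rw [← (Equiv.neg ℤ).tsum_eq]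
    congr 1
    refine tsum_congr fun n => ?_
    rw [Equiv.neg_apply]
    congr 1
    push_cast
    ring

/-- The Villain interaction of the end points of an edge. -/
def pairEdge {V : Type*} (κ : ℝ) (θ : V → ℝ) : Sym2 V → ℝ :=
  Sym2.lift ⟨fun v w => villainEdge κ (θ w - θ v), fun v w => by
    simp only
    rw [← villainEdge_symm, neg_sub]⟩

lemma pairEdge_map {V W : Type*} (κ : ℝ) (θ : V → ℝ) (f : W → V) (e : Sym2 W) :
    pairEdge κ θ (e.map f) = pairEdge κ (fun w => θ (f w)) e := by
  induction e with
  | h v w => rfl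

lemma villainEdge_src_tgt {V : Type u} {G : SimpleGraph V} (κ : ℝ) (θ : V → ℝ) (e : G.edgeSet) :
    villainEdge κ (θ (tgt e) - θ (src e)) = pairEdge κ θ e := by
  have h : (e : Sym2 V) = s(src e, tgt e) := (Quot.out_eq (e : Sym2 V)).symm
  rw [h]
  rfl

/-- The coordinates outside the range of f are integrated out at no cost, since the uniform angle
has mass one. -/
lemma measurePreserving_comp {V W : Type*} [Fintype V] [Fintype W] {f : W → V}
    (hf : Function.Injective f) :
    MeasurePreserving (fun (θ : V → ℝ) (w : W) => θ (f w)) (unifPi V) (unifPi W) := by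
  classical
  refine ⟨by fun_prop, (Measure.pi_eq fun s hs => ?_).symm⟩
  have hpre : (fun (θ : V → ℝ) (w : W) => θ (f w)) ⁻¹' Set.univ.pi s =
      Set.univ.pi (Function.extend f s fun _ => Set.univ) := by
    ext θ
    simp only [Set.mem_preimage, Set.mem_univ_pi]
    refine ⟨fun h v => ?_, fun h w => by simpa [hf.extend_apply] using h (f w)⟩
    by_cases hv : ∃ w, f w = v
    · obtain ⟨w, rfl⟩ := hv
      rw [hf.extend_apply]
      exact h w
    · rw [Function.extend_apply' _ _ _ hv]
      trivial
  rw [Measure.map_apply (by fun_prop) (MeasurableSet.univ_pi hs), hpre, Measure.pi_pi]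
  refine (Fintype.prod_of_injective f hf _ _ (fun v hv => ?_) fun w => ?_).symm
  · rw [Function.extend_apply' _ _ _ hv, measure_univ]
  · rw [hf.extend_apply]

/-- Erasing the edges outside of a subgraph is the same as setting their couplings to zero. -/
lemma villainMean_comap {V W : Type u} [Fintype V] [Fintype W] (f : W ↪ V) {H : SimpleGraph V}
    {H' : SimpleGraph W} [Fintype H.edgeSet] [Fintype H'.edgeSet]
    {K : H.edgeSet → ℝ} {K' : H'.edgeSet → ℝ} (m : H'.edgeSet → H.edgeSet)
    (hm : ∀ e, (m e : Sym2 V) = (e : Sym2 W).map f) (h1 : ∀ e, K (m e) = K' e)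
    (h2 : ∀ e ∉ Set.range m, K e = 0) (hK' : ∀ e, 0 ≤ K' e) (x y : W) :
    villainMean src tgt K' x y = villainMean src tgt K (f x) (f y) := by
  have hinj : Function.Injective m := fun e e' h => by
    have := congrArg (Subtype.val) h
    rw [hm, hm] at this
    exact Subtype.ext (Sym2.map.injective f.injective this)
  have hmp := measurePreserving_comp f.injective
  have e1 : ∀ θ : V → ℝ, ∏ e, villainEdge (K' e) (θ (f (tgt e)) - θ (f (src e))) =
      ∏ e, villainEdge (K e) (θ (tgt e) - θ (src e)) := fun θ => by
    refine Fintype.prod_of_injective m hinj _ _ (fun e he => ?_) fun e => ?_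
    · rw [h2 e he, villainEdge, if_pos rfl]
    · rw [villainEdge_src_tgt _ (fun w => θ (f w)), villainEdge_src_tgt, hm, pairEdge_map, h1]
  have hc := fun e => continuous_villainEdge (hK' e)
  have hF : Continuous fun θ : W → ℝ => Real.cos (θ x - θ y) *
      ∏ e, villainEdge (K' e) (θ (tgt e) - θ (src e)) :=
    Continuous.mul (by fun_prop) (continuous_finsetProd _ fun e _ => (hc e).comp (by fun_prop))
  rw [villainMean, ← hmp.map_eq, integral_map hmp.measurable.aemeasurable hF.aestronglyMeasurable]
  simp only [e1]
  rfl

open Classical in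
-- View the smaller model as one on the larger graph with the couplings outside the image set to
-- zero, then raise them to their true values.
theorem villainCorr_le_of_hom {V W : Type u} [Fintype V] [Fintype W] (f : W ↪ V)
    {H : SimpleGraph V} {H' : SimpleGraph W} (hH : ∀ {v w}, H'.Adj v w → H.Adj (f v) (f w))
    (J : Sym2 V → ℝ) {β : ℝ} (hJ : ∀ e ∈ H.edgeSet, 0 < β * J e) (x y : W) :
    villainCorr H' (fun e => J (e.map f)) β x y ≤ villainCorr H J β (f x) (f y) := by
  let m : H'.edgeSet → H.edgeSet := SimpleGraph.Hom.mapEdgeSet ⟨f, hH⟩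
  have hm : ∀ e, (m e : Sym2 V) = (e : Sym2 W).map f := fun e => rfl
  have hJ' : ∀ e ∈ H'.edgeSet, 0 < β * J (e.map f) := fun e he => by
    have := hJ _ (m ⟨e, he⟩).2
    rwa [hm] at this
  let K : H.edgeSet → ℝ := fun e => if e ∈ Set.range m then β * J e else 0
  have h := fun x y => villainMean_comap f m hm (K := K)
    (K' := fun e : H'.edgeSet => β * J ((e : Sym2 W).map f))
    (fun e => by simp only [K, Set.mem_range_self, if_true, hm]) (fun e he => if_neg he)
    (fun e => (hJ' e e.2).le) x y
  rw [villainCorr_eq _ _ hJ', villainCorr_eq H J hJ, h, h]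
  refine villainMean_mono src tgt (fun e => ?_) (fun e => ?_) _ _
  · simp only [K]
    split_ifs
    exacts [(hJ e e.2).le, le_rfl]
  · simp only [K]
    split_ifs
    exacts [le_rfl, (hJ e e.2).le]

lemma villainCorr_le_one {V : Type u} [Fintype V] (G : SimpleGraph V) (J : Sym2 V → ℝ) {β : ℝ}
    (hJ : ∀ e ∈ G.edgeSet, 0 < β * J e) (x y : V) : villainCorr G J β x y ≤ 1 := by
  classical
  have hK : ∀ e : G.edgeSet, 0 ≤ β * J e := fun e => (hJ e e.2).le
  rw [villainCorr_eq G J hJ, div_le_one (villainMean_self_pos _ _ hK x)]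
  refine integral_mono (integrable_villainMean _ _ hK x y) (integrable_villainMean _ _ hK x x)
    fun θ => ?_
  refine mul_le_mul_of_nonneg_right ?_ (Finset.prod_nonneg fun e _ => (villainEdge_pos (hK e) _).le)
  rw [sub_self, Real.cos_zero]
  exact Real.cos_le_one _

/-! ### The infinite-volume limit -/

lemma map_mem_edgeSet {V : Type u} {G : SimpleGraph V} {Λ : Finset V} {e : Sym2 {v : V // v ∈ Λ}}
    (he : e ∈ (G.comap (Subtype.val : {v : V // v ∈ Λ} → V)).edgeSet) :
    e.map Subtype.val ∈ G.edgeSet := by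
  induction e with
  | h v w => exact he

lemma villainVolumeCorr_mono {V : Type u} (G : SimpleGraph V) (J : Sym2 V → ℝ) {β : ℝ}
    (hJ : ∀ e ∈ G.edgeSet, 0 < β * J e) {x y : V} {Λ Λ' : Finset V} (hΛ : Λ ⊆ Λ') (hx : x ∈ Λ)
    (hy : y ∈ Λ) : villainVolumeCorr G J β Λ x y ≤ villainVolumeCorr G J β Λ' x y := by
  rw [villainVolumeCorr, dif_pos ⟨hx, hy⟩, villainVolumeCorr, dif_pos ⟨hΛ hx, hΛ hy⟩]
  have h := villainCorr_le_of_hom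
    (⟨fun v => ⟨v.1, hΛ v.2⟩, fun v w h => Subtype.ext (Subtype.mk.inj h)⟩ :
      {v : V // v ∈ Λ} ↪ {v : V // v ∈ Λ'})
    (H := G.comap Subtype.val) (H' := G.comap Subtype.val) id (fun e => J (e.map Subtype.val))
    (fun e he => hJ _ (map_mem_edgeSet he)) ⟨x, hx⟩ ⟨y, hy⟩
  simp only [Sym2.map_map] at h
  exact h

lemma villainVolumeCorr_le_one {V : Type u} (G : SimpleGraph V) (J : Sym2 V → ℝ) {β : ℝ}
    (hJ : ∀ e ∈ G.edgeSet, 0 < β * J e) (x y : V) (Λ : Finset V) :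
    villainVolumeCorr G J β Λ x y ≤ 1 := by
  rw [villainVolumeCorr]
  split_ifs
  · exact villainCorr_le_one _ _ (fun e he => hJ _ (map_mem_edgeSet he)) _ _
  · exact zero_le_one

theorem exists_tendsto_villainVolumeCorr {V : Type u} (G : SimpleGraph V) (J : Sym2 V → ℝ) {β : ℝ}
    (hJ : ∀ e ∈ G.edgeSet, 0 < β * J e) (x y : V) :
    ∃ l : ℝ, Tendsto (fun Λ : Finset V => villainVolumeCorr G J β Λ x y) atTop (𝓝 l) := by
  classical
  -- Volumes missing x or y have the default value 0. Adjoining {x, y} avoids comparing with it and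
  -- changes nothing for large Λ.
  have hmono : Monotone fun Λ : Finset V => villainVolumeCorr G J β (Λ ∪ {x, y}) x y :=
    fun Λ Λ' h => villainVolumeCorr_mono G J hJ (Finset.union_subset_union_left h) (by simp)
      (by simp)
  refine ⟨_, (tendsto_atTop_ciSup hmono ⟨1, ?_⟩).congr' ?_⟩
  · rintro _ ⟨Λ, rfl⟩
    exact villainVolumeCorr_le_one G J hJ x y _
  · filter_upwards [eventually_ge_atTop {x, y}] with Λ hΛ
    rw [Finset.union_eq_left.2 hΛ]

end

end MetricVillain

theorem mainTheorem11 (β : ℝ) (hβ : 0 < β) :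
    -- uniform convergence of the refined XY two-point functions on the metric graph
    (∀ (V : Type u) [Fintype V] (G : SimpleGraph V) (J : Sym2 V → ℝ),
      (∀ e ∈ G.edgeSet, 0 < J e) →
      TendstoUniformly
        (fun (n : ℕ) (p : MetricVillain.MetricGraph G × MetricVillain.MetricGraph G) =>
          MetricVillain.xyCorr G J β (n + 1) p.1 p.2)
        (fun p => MetricVillain.villainMetricCorr G J β p.1 p.2) atTop) ∧
    -- monotonicity of the Villain two-point function in the couplings
    (∀ (V : Type u) [Fintype V] (G : SimpleGraph V) (J J' : Sym2 V → ℝ),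
      (∀ e ∈ G.edgeSet, 0 < J e) → (∀ e ∈ G.edgeSet, J e ≤ J' e) →
      ∀ x y : V, MetricVillain.villainCorr G J β x y ≤ MetricVillain.villainCorr G J' β x y) ∧
    -- monotonicity in the volume, and existence of the infinite-volume limit
    (∀ (V : Type u) (G : SimpleGraph V) (J : Sym2 V → ℝ),
      (∀ e ∈ G.edgeSet, 0 < J e) → ∀ x y : V,
      (∀ Λ Λ' : Finset V, Λ ⊆ Λ' → x ∈ Λ → y ∈ Λ →
        MetricVillain.villainVolumeCorr G J β Λ x y ≤
          MetricVillain.villainVolumeCorr G J β Λ' x y) ∧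
      ∃ l : ℝ, Tendsto (fun Λ : Finset V => MetricVillain.villainVolumeCorr G J β Λ x y)
        atTop (𝓝 l)) := by
  refine ⟨fun V _ G J hJ => ?_, fun V _ G J J' hJ hJJ' x y => ?_, fun V G J hJ x y => ⟨?_, ?_⟩⟩
  · exact MetricVillain.tendstoUniformly_xyCorr G J fun e he => mul_pos hβ (hJ e he)
  · classical
    have h1 : ∀ e ∈ G.edgeSet, 0 < β * J e := fun e he => mul_pos hβ (hJ e he)
    have h2 : ∀ e ∈ G.edgeSet, β * J e ≤ β * J' e := fun e he =>
      mul_le_mul_of_nonneg_left (hJJ' e he) hβ.le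
    rw [MetricVillain.villainCorr_eq G J h1,
      MetricVillain.villainCorr_eq G J' fun e he => (h1 e he).trans_le (h2 e he)]
    exact MetricVillain.villainMean_mono _ _ (fun e : G.edgeSet => (h1 e e.2).le)
      (fun e : G.edgeSet => h2 e e.2) x y
  · exact fun Λ Λ' hΛ hx hy =>
      MetricVillain.villainVolumeCorr_mono G J (fun e he => mul_pos hβ (hJ e he)) hΛ hx hy
  · exact MetricVillain.exists_tendsto_villainVolumeCorr G J (fun e he => mul_pos hβ (hJ e he)) x y
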